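/- **Proposition (Sextilinear estimate).** *Notation.* Fix $1/2<s<1$ and an exponent $b>1/2$. Let $\varphi:\mathbb R\to[0,\infty)$ be a fixed smooth non-increasing function with $\varphi(r)=1$ for $r\le 1$ and $\varphi(r)=r^{s-1}$ for $r\ge 2$. For $N\ge 1$ let $m(\xi):=\varphi(|\xi|/N)$, $\xi\in\mathbb R^2$, and let $I=I_N$ be the Fourier multiplier in the space variable with symbol $m$, $\widehat{Iu}(\xi)=m(\xi)\hat u(\xi)$, where $\hat f(\xi)=\int_{\mathbb R^2}e^{-ix\cdot\xi}f(x)\,dx$. With $\tilde u(\tau,\xi)=\int_{\mathbb R}\int_{\mathbb R^2}e^{-i(t\tau+x\cdot\xi)}u(t,x)\,dx\,dt$ and $\langle r\rangle=(1+|r|^2)^{1/2}$ put $$\|v\|_{X^{1,b}}:=\big\|\langle\xi\rangle\,\langle\tau+|\xi|^2\rangle^{b}\,\tilde v(\tau,\xi)\big\|_{L^2_{\tau,\xi}(\mathbb R\times\mathbb R^2)} .$$ Let $\Sigma_k=\{(\xi_1,\dots,\xi_k)\in(\mathbb R^2)^k:\xi_1+\dots+\xi_k=0\}$ with the measure $d\xi_1\cdots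 d\xi_{k-1}$. For even $k$ and a symbol $M:\Sigma_k\to\mathbb C$ put $$\Lambda_k(M;f):=\frac1{(2\pi)^{2(k-1)}}\,\mathrm{Re}\int_{\Sigma_k}M(\xi_1,\dots,\xi_k)\,\hat f(\xi_1)\,\hat{\bar f}(\xi_2)\cdots\hat f(\xi_{k-1})\,\hat{\bar f}(\xi_k).$$ Let $[M]_{\rm sym}$ be the average of $M$ over the group of order $2\,((k/2)!)^2$ generated by the permutations of the odd-numbered arguments, the permutations of the even-numbered arguments, and $M\mapsto\overline{M(\xi_2,\xi_1,\dots,\xi_k,\xi_{k-1})}$; let $X(M)(\xi_1,\dots,\xi_{k+2}):=M(\xi_1+\xi_2+\xi_3,\xi_4,\dots,\xi_{k+2})$. Put $\sigma_2(\xi_1,\xi_2):=-\frac12\,m(\xi_1)\xi_1\cdot m(\xi_2)\xi_2$ and $\alpha_4:=-|\xi_1|^2+|\xi_2|^2-|\xi_3|^2+|\xi_4|^2$. For $0<\theta_0<1/100$ let $$\tilde\sigma_4:=\frac{[2iX(\sigma_2)]_{\rm sym}}{i\alpha_4}\,1_{\Omega_{nr}},\qquad \Omega_{nr}:=\Big\{\xi\in\Sigma_4:\max_{1\le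 j\le4}|\xi_j|\le N\ \text{ or }\ |\cos\angle(\xi_1+\xi_2,\,\xi_1+\xi_4)|\ge\theta_0\Big\}$$ (the null set where $\alpha_4=0$ or the angle is undefined plays no role). *Statement.* For every $\varepsilon>0$ there is a constant $C>0$ depending only on $s$, $b$, $\varepsilon$ and the choice of the profile $\varphi$, such that for all $N\ge 1$, all $0<\theta_0<1/100$, all $u\in L^2(\mathbb R\times\mathbb R^2)$ with $Iu\in X^{1,b}(\mathbb R\times\mathbb R^2)$, and all $0<t_0<1$, the integral defining $\Lambda_6([4iX(\tilde\sigma_4)]_{\rm sym};u(t))$ converges absolutely for almost every $t\in[0,t_0]$, the resulting function of $t$ is integrable on $[0,t_0]$, and $$\Big|\int_0^{t_0}\Lambda_6\big([4iX(\tilde\sigma_4)]_{\rm sym};u(t)\big)\,dt\Big|\le C\,\theta_0^{-1}\,N^{-3+\varepsilon}\,\|Iu\|_{X^{1,b}(\mathbb R\times\mathbb R^2)}^6 .$$ -/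

import Mathlib

open MeasureTheory FourierTransform
open scoped ENNReal ContDiff ComplexConjugate

namespace IMethod

noncomputable section

/-- The physical (or frequency) plane `ℝ²` with its Euclidean structure. -/
abbrev Plane : Type := EuclideanSpace ℝ (Fin 2)

/-- Space-time `ℝ × ℝ²` with its Euclidean structure (the volume is Lebesgue measure
`dt dx`); a point is `WithLp.toLp 2 (t, x)`, or `WithLp.toLp 2 (τ, ξ)` on the frequency side. -/
abbrev SpaceTime : Type := WithLp 2 (ℝ × Plane)

/-- `L²(ℝ²; ℂ)`. -/
abbrev L2Plane : Type := Lp ℂ 2 (volume : Measure Plane)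

/-- `L²(ℝ × ℝ²; ℂ)`. -/
abbrev L2SpaceTime : Type := Lp ℂ 2 (volume : Measure SpaceTime)

/-- The spatial Fourier transform `f̂(ξ) = ∫ exp(-i x·ξ) f(x) dx`, extended to `L²` by
Plancherel. Mathlib's transform has the phase `exp(-2πi x·ξ)`, whence the rescaling. -/
def spatialHat (f : L2Plane) : Plane → ℂ :=
  fun ξ => (𝓕 f : L2Plane) ((2 * Real.pi)⁻¹ • ξ)

/-- The space-time Fourier transform `ũ(τ,ξ) = ∫∫ exp(-i(tτ + x·ξ)) u(t,x) dx dt`, extended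
to `L²` by Plancherel. -/
def spaceTimeHat (u : L2SpaceTime) : SpaceTime → ℂ :=
  fun p => (𝓕 u : L2SpaceTime) ((2 * Real.pi)⁻¹ • p)

open scoped Classical in
/-- The time slice `u(t) = u(t, ·)` as an element of `L²(ℝ²)`; by Fubini it is the first
alternative for almost every `t`. -/
def slice (u : L2SpaceTime) (t : ℝ) : L2Plane :=
  if h : MemLp (fun x : Plane => u (WithLp.toLp 2 (t, x))) 2 volume then h.toLp _ else 0

/-- The Japanese bracket `⟨r⟩ = (1 + r²)^{1/2}`. -/
def japanese (r : ℝ) : ℝ := Real.sqrt (1 + r ^ 2)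

/-- The `X^{s,b}(ℝ × ℝ²)` norm `‖⟨ξ⟩^s ⟨τ + |ξ|²⟩^b ũ(τ,ξ)‖_{L²_{τ,ξ}}`, as an extended
nonnegative number, for `u ∈ L²(ℝ × ℝ²)`. -/
def xsbENorm (s b : ℝ) (u : L2SpaceTime) : ℝ≥0∞ :=
  eLpNorm (fun p : SpaceTime =>
    ((japanese ‖p.snd‖ ^ s * japanese (p.fst + ‖p.snd‖ ^ 2) ^ b : ℝ) : ℂ) * spaceTimeHat u p)
    2 volume

/-- Membership in `X^{s,b}(ℝ × ℝ²)`, for `s, b ≥ 0` (then this space is contained in `L²`). -/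
def MemXsb (s b : ℝ) (u : L2SpaceTime) : Prop := xsbENorm s b u < ⊤

/-- The real-valued `X^{s,b}(ℝ × ℝ²)` norm. -/
def xsbNorm (s b : ℝ) (u : L2SpaceTime) : ℝ := (xsbENorm s b u).toReal

/-- The fixed radial profile from which the symbol of the operator `I` is built: smooth,
nonnegative, nonincreasing, equal to `1` on `r ≤ 1` and to `r^{s-1}` on `r ≥ 2`. (The values at
`r < 0` play no role.) -/
structure Profile (s : ℝ) where
  toFun : ℝ → ℝ
  smooth : ContDiff ℝ ∞ toFun
  nonneg : ∀ r, 0 ≤ toFun r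
  antitone : Antitone toFun
  eq_one : ∀ r, r ≤ 1 → toFun r = 1
  eq_rpow : ∀ r, 2 ≤ r → toFun r = r ^ (s - 1)

/-- The symbol `m = m_N` of the operator `I = I_N`: equal to `1` for `|ξ| ≤ N` and to
`(|ξ|/N)^{s-1}` for `|ξ| ≥ 2N`. -/
def symb {s : ℝ} (φ : Profile s) (N : ℝ) (ξ : Plane) : ℝ := φ.toFun (‖ξ‖ / N)

theorem Profile.le_one {s : ℝ} (φ : Profile s) (r : ℝ) : φ.toFun r ≤ 1 := by
  rcases le_total r 1 with h | h
  · exact (φ.eq_one r h).le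
  · exact (φ.antitone h).trans (φ.eq_one 1 le_rfl).le

theorem memLp_symb_mul {s : ℝ} (φ : Profile s) (N : ℝ) (g : L2SpaceTime) :
    MemLp (fun p : SpaceTime => (symb φ N ((2 * Real.pi) • p.snd) : ℂ) * g p) 2 volume := by
  have hc : Continuous fun p : SpaceTime => (symb φ N ((2 * Real.pi) • p.snd) : ℂ) := by
    unfold symb
    have := φ.smooth.continuous
    fun_prop
  refine (Lp.memLp g).of_le (hc.aestronglyMeasurable.mul (Lp.aestronglyMeasurable g)) ?_
  refine Filter.Eventually.of_forall fun p => ?_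
  rw [norm_mul, Complex.norm_real, symb, Real.norm_of_nonneg (φ.nonneg _)]
  exact mul_le_of_le_one_left (norm_nonneg _) (φ.le_one _)

/-- The spatial Fourier multiplier `I = I_N` with symbol `m_N` acting on functions of
`(t, x)`; on the space-time Fourier side, `(Iu)~(τ,ξ) = m_N(ξ) ũ(τ,ξ)`. (The factor `2π` is the
same rescaling as in `spaceTimeHat`.) -/
def opI {s : ℝ} (φ : Profile s) (N : ℝ) (u : L2SpaceTime) : L2SpaceTime :=
  𝓕⁻ ((memLp_symb_mul φ N (𝓕 u)).toLp _)

/-- Symbols of order `k`. They are functions on `(ℝ²)^k`, of which only the values on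
`Σ_k = {ξ₁ + ⋯ + ξ_k = 0}` matter. The index `j : Fin k` stands for `j + 1` in `ξ₁, …, ξ_k`. -/
abbrev Symbol (k : ℕ) : Type := (Fin k → Plane) → ℂ

/-- The hyperplane `Σ_k`. -/
def hyper (k : ℕ) : Set (Fin k → Plane) := {ξ | ∑ j, ξ j = 0}

/-- The measure on `Σ_k`, `k = n + 1`: the push-forward of Lebesgue measure `dξ₁ ⋯ dξ_n` under
`(ξ₁, …, ξ_n) ↦ (ξ₁, …, ξ_n, -ξ₁ - ⋯ - ξ_n)`. -/
def hyperMeasure (n : ℕ) : Measure (Fin (n + 1) → Plane) :=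
  Measure.map
    (fun ξ : Fin n → Plane => (Fin.snoc (α := fun _ => Plane) ξ (-∑ j, ξ j) : Fin (n + 1) → Plane))
    volume

/-- The integrand `M(ξ₁,…,ξ_k) û₁(ξ₁) ⋯ û_k(ξ_k)`. -/
def multIntegrand {k : ℕ} (M : Symbol k) (u : Fin k → L2Plane) (ξ : Fin k → Plane) : ℂ :=
  M ξ * ∏ j, spatialHat (u j) (ξ j)

/-- The functional `Λ_k(M; u₁, …, u_k)`, `k = n + 1`. -/
def multForm {n : ℕ} (M : Symbol (n + 1)) (u : Fin (n + 1) → L2Plane) : ℝ :=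
  1 / (2 * Real.pi) ^ (2 * n) * (∫ ξ, multIntegrand M u ξ ∂(hyperMeasure n)).re

/-- The alternating tuple `(u, ū, u, ū, …)`. -/
def alternating (k : ℕ) (f : L2Plane) : Fin k → L2Plane :=
  fun j => if (j : ℕ) % 2 = 0 then f else star f

/-- `Λ_k(M; u) = Λ_k(M; u, ū, …, u, ū)`. -/
def form {n : ℕ} (M : Symbol (n + 1)) (f : L2Plane) : ℝ :=
  multForm M (alternating (n + 1) f)

/-- The odd-numbered arguments `ξ₁, ξ₃, …, ξ_{2n-1}`. -/
def oddArgs {n : ℕ} (ξ : Fin (2 * n) → Plane) : Fin n → Plane :=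
  fun j => ξ ⟨2 * j, by omega⟩

/-- The even-numbered arguments `ξ₂, ξ₄, …, ξ_{2n}`. -/
def evenArgs {n : ℕ} (ξ : Fin (2 * n) → Plane) : Fin n → Plane :=
  fun j => ξ ⟨2 * j + 1, by omega⟩

/-- The tuple `(a₁, b₁, a₂, b₂, …, a_n, b_n)`. -/
def interleave {n : ℕ} (a b : Fin n → Plane) : Fin (2 * n) → Plane :=
  fun i => if (i : ℕ) % 2 = 0 then a ⟨i / 2, by omega⟩ else b ⟨i / 2, by omega⟩

/-- The symmetrization `[M]_sym = |G_k|⁻¹ ∑_{g ∈ G_k} g M`, `k = 2n`, where the group `G_k`, of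
order `2 (n!)²`, consists of the permutations of the odd arguments, those of the even arguments,
and their compositions with the swap
`M ↦ conj M(ξ₂, ξ₁, …, ξ_k, ξ_{k-1})`. -/
def symmetrize (n : ℕ) (M : Symbol (2 * n)) : Symbol (2 * n) := fun ξ =>
  (1 / (2 * (n.factorial : ℂ) ^ 2)) *
    ∑ π : Equiv.Perm (Fin n), ∑ ρ : Equiv.Perm (Fin n),
      (M (interleave (oddArgs ξ ∘ π) (evenArgs ξ ∘ ρ)) +
        conj (M (interleave (evenArgs ξ ∘ ρ) (oddArgs ξ ∘ π))))

/-- The extended symbol `X(M)(ξ₁, …, ξ_{k+2}) = M(ξ₁ + ξ₂ + ξ₃, ξ₄, …, ξ_{k+2})`. -/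
def extendX {k : ℕ} (M : Symbol k) : Symbol (k + 2) := fun ξ =>
  M fun j => if (j : ℕ) = 0 then
      ξ ⟨0, by omega⟩ + ξ ⟨1, by omega⟩ + ξ ⟨2, by have := j.isLt; omega⟩
    else ξ ⟨j + 2, by omega⟩

/-- `α_k = -|ξ₁|² + |ξ₂|² - ⋯ + |ξ_k|²`. -/
def alphaSymb (k : ℕ) (ξ : Fin k → Plane) : ℝ := ∑ j : Fin k, (-1) ^ ((j : ℕ) + 1) * ‖ξ j‖ ^ 2

/-- `σ₂(ξ₁, ξ₂) = -(1/2) (m(ξ₁) ξ₁) · (m(ξ₂) ξ₂)`, which equals `(1/2) m(ξ₁)² |ξ₁|²` on `Σ₂`. -/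
def sigmaTwo {s : ℝ} (φ : Profile s) (N : ℝ) : Symbol 2 := fun ξ =>
  ((-(1 / 2) * inner ℝ (symb φ N (ξ 0) • ξ 0) (symb φ N (ξ 1) • ξ 1) : ℝ) : ℂ)

/-- The non-resonant set `Ω_nr ⊆ Σ₄`. -/
def nonresonant (N θ₀ : ℝ) : Set (Fin 4 → Plane) :=
  {ξ | ξ ∈ hyper 4 ∧ ((∀ j, ‖ξ j‖ ≤ N) ∨
    θ₀ ≤ |Real.cos (InnerProductGeometry.angle (ξ 0 + ξ 1) (ξ 0 + ξ 3))|)}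

/-- The corrected symbol `σ̃₄ = [2iX(σ₂)]_sym / (i α₄) · 1_{Ω_nr}`. -/
def sigmaFourTilde {s : ℝ} (φ : Profile s) (N θ₀ : ℝ) : Symbol 4 :=
  (nonresonant N θ₀).indicator fun ξ =>
    symmetrize 2 (fun η => 2 * Complex.I * extendX (sigmaTwo φ N) η) ξ /
      (Complex.I * (alphaSymb 4 ξ : ℂ))

/-- The six-linear symbol `[4iX(σ̃₄)]_sym`. -/
def sextilinearSymbol {s : ℝ} (φ : Profile s) (N θ₀ : ℝ) : Symbol 6 :=
  symmetrize 3 fun ξ => 4 * Complex.I * extendX (sigmaFourTilde φ N θ₀) ξ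

end

end IMethod

/-! The symbol is bounded by `C θ₀⁻¹`, it vanishes when all six frequencies are low, and at high
frequencies the weights together with the oscillation in time produce the power of `N`.

The symbol. On `Σ₄` one has `α₄ = -2 (ξ₁ + ξ₂)·(ξ₁ + ξ₄)`, while the numerator of `σ̃₄` is a mixed
second difference of `m²|ξ|²` over the parallelogram with vertices `ξ₁, -ξ₂, -ξ₄, ξ₃` and sides `ξ₁
+ ξ₂`, `ξ₁ + ξ₄`. Two derivatives of `m²|ξ|²` cost `(1 + |ξ|/N)^{2s-2}`, so the numerator is at most
the product of the side lengths times this factor, and the angle condition bounds the quotient by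
`θ₀⁻¹` with decay in every argument (`exists_sigmaFourTilde_bound`). If all frequencies are at most
`N/3`, the contracted ones are at most `N`, the quotient is `1/4`, and the constant `4i·(1/4) = i`
is annihilated by the conjugation in the symmetrization (`ae_sextilinearSymbol_eq_zero`). Hence only
tuples with a frequency above `N/3` matter.

Time. For almost every `t` the transform of the slice is a superposition of oscillations `exp(itτ)`
(`ae_fourier_slice_eq`). Integration over `[0, t₀]` gives the kernel `1/(1 + |∑ ±τ_j|)`. With `τ_j =
λ_j - |ξ_j|²` and the modulations `λ_j` frozen, this is a function of the quadratic form `∑ ±|ξ_j|²`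
plus a constant; the integrals over `λ_j` are then paid for by Cauchy–Schwarz, `⟨λ⟩^{-b}` being
square integrable for `b > 1/2` (`lintegral_modulation_le`).

Frozen modulations. Cauchy–Schwarz splits the six functions into two triples, and it remains to
integrate the squared weights `1/(m⟨ξ⟩)` times the kernel over three frequencies of fixed sum
(`lintegral_prod_mul_kernel_le`). Let `n ≥ N/3` be the largest norm. Either two frequencies are
below `n/80`; each is paired with a different large one, the quadratic form then has slope of order
`n` along the fiber, and the kernel integral gains almost `n⁻¹`. Or all frequencies but one are
comparable to `n`; then each triple can be given two large frequencies of equal sign, whose kernel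
integral is merely bounded, but both weights are small (`exists_arrangement`). In both cases each
squared half is `n^{-3+}` up to powers of `n/N`, which are harmless because `s > 1/2`; the two
square roots multiply to `N^{-3+}`.

Absolute convergence at a fixed time has no oscillation to use. For `s ≤ 2/3` the bare weights are
insufficient in this Schur argument, and the decay of `σ̃₄` is what closes it
(`lintegral_sextilinearSymbol_lt_top`). -/

namespace IMethod

noncomputable section

/-! ### The `L²` Fourier transform: integrable functions and complex conjugation -/

section FourierL2

variable {E : Type*} [NormedAddCommGroup E] [InnerProductSpace ℝ E] [FiniteDimensional ℝ E]
  [MeasurableSpace E] [BorelSpace E]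

/-- The `L²` Fourier transform is its own transpose against Schwartz functions. -/
theorem integral_smul_fourier_eq (f : Lp ℂ 2 (volume : Measure E)) (φ : SchwartzMap E ℂ) :
    ∫ x, φ x • (𝓕 f : Lp ℂ 2 (volume : Measure E)) x = ∫ x, (𝓕 φ) x • f x := by
  have h := congrArg (fun T => T φ) (Lp.fourier_toTemperedDistribution_eq f)
  simp only [TemperedDistribution.fourier_apply, Lp.toTemperedDistribution_apply] at h
  exact h.symm

theorem ae_eq_of_integral_schwartz_smul_eq {f g : E → ℂ} (hf : LocallyIntegrable f)
    (hg : LocallyIntegrable g)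
    (h : ∀ φ : SchwartzMap E ℂ, ∫ x, φ x • f x = ∫ x, φ x • g x) : f =ᵐ[volume] g := by
  refine ae_eq_of_integral_contDiff_smul_eq hf hg fun χ hχ hc => ?_
  have hc' : HasCompactSupport fun x => (χ x : ℂ) := hc.comp_left (g := Complex.ofReal) rfl
  have : ∫ x, (χ x : ℂ) • f x = ∫ x, (χ x : ℂ) • g x :=
    h (hc'.toSchwartzMap (Complex.ofRealCLM.contDiff.comp hχ))
  simpa only [Complex.real_smul, smul_eq_mul] using this

theorem locallyIntegrable_lp (f : Lp ℂ 2 (volume : Measure E)) : LocallyIntegrable f :=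
  (Lp.memLp f).locallyIntegrable (by norm_num)

/-- On `L¹ ∩ L²` the `L²` Fourier transform is the Fourier integral. -/
theorem fourier_toLp_ae {g : E → ℂ} (h1 : Integrable g) (h2 : MemLp g 2) :
    (𝓕 (h2.toLp g) : Lp ℂ 2 (volume : Measure E)) =ᵐ[volume] 𝓕 g := by
  have hcont : Continuous (𝓕 g) :=
    VectorFourier.fourierIntegral_continuous Real.continuous_fourierChar
      (by exact continuous_inner) h1
  refine ae_eq_of_integral_schwartz_smul_eq (locallyIntegrable_lp _) hcont.locallyIntegrable
    fun φ => ?_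
  rw [integral_smul_fourier_eq]
  have h3 : ∫ x, (𝓕 φ) x • (h2.toLp g) x = ∫ x, (𝓕 φ) x • g x := by
    refine integral_congr_ae ?_
    filter_upwards [h2.coeFn_toLp] with x hx
    rw [hx]
  rw [h3]
  have h4 := VectorFourier.integral_fourierIntegral_smul_eq_flip (L := innerₗ E)
    (μ := (volume : Measure E)) (ν := (volume : Measure E)) (f := φ) (g := g)
    Real.continuous_fourierChar continuous_inner φ.integrable h1
  rw [flip_innerₗ] at h4
  rw [SchwartzMap.fourier_coe]
  exact h4

/-- The Fourier transform of a complex conjugate. -/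
theorem fourier_star_ae (f : Lp ℂ 2 (volume : Measure E)) :
    (𝓕 (star f) : Lp ℂ 2 (volume : Measure E)) =ᵐ[volume]
      fun ξ => conj ((𝓕 f : Lp ℂ 2 (volume : Measure E)) (-ξ)) := by
  have hneg : MeasurePreserving (fun x : E => -x) volume volume :=
    Measure.measurePreserving_neg volume
  have hm : MemLp (fun ξ => conj ((𝓕 f : Lp ℂ 2 (volume : Measure E)) (-ξ))) 2 volume :=
    ((Lp.memLp (𝓕 f : Lp ℂ 2 (volume : Measure E))).comp_measurePreserving hneg).star
  refine ae_eq_of_integral_schwartz_smul_eq (locallyIntegrable_lp _)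
    (hm.locallyIntegrable (by norm_num)) fun φ => ?_
  rw [integral_smul_fourier_eq]
  -- With `ψ(x) = conj φ(-x)` one has `𝓕 φ = conj (𝓕 ψ)`, so the conjugation is moved from `f` to
  -- the test function.
  let ψ : SchwartzMap E ℂ :=
    SchwartzMap.postcompCLM (𝕜 := ℝ) (Complex.conjCLE : ℂ →L[ℝ] ℂ)
      (SchwartzMap.compCLMOfContinuousLinearEquiv ℝ (ContinuousLinearEquiv.neg ℝ (M := E)) φ)
  have hψ : ∀ x, ψ x = conj (φ (-x)) := fun x => by simp [ψ]
  have hF : ∀ x, (𝓕 φ) x = conj ((𝓕 ψ) x) := by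
    intro x
    rw [SchwartzMap.fourier_coe, SchwartzMap.fourier_coe, Real.fourier_eq, Real.fourier_eq,
      ← integral_conj, ← integral_neg_eq_self]
    refine integral_congr_ae (Filter.Eventually.of_forall fun v => ?_)
    simp [hψ, Circle.smul_def]
  have e1 : ∫ x, (𝓕 φ) x • (star f : Lp ℂ 2 (volume : Measure E)) x =
      conj (∫ x, (𝓕 ψ) x • f x) := by
    rw [← integral_conj]
    refine integral_congr_ae ?_
    filter_upwards [Lp.coeFn_star f] with x hx
    rw [hx, hF]
    simp
  rw [e1, ← integral_smul_fourier_eq, ← integral_conj, ← integral_neg_eq_self]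
  refine integral_congr_ae (Filter.Eventually.of_forall fun v => ?_)
  simp [hψ]

end FourierL2

/-- The spatial transform of the complex conjugate of `f`. -/
theorem spatialHat_star_ae (f : L2Plane) :
    spatialHat (star f) =ᵐ[volume] fun ξ => conj (spatialHat f (-ξ)) := by
  have h := fourier_star_ae f
  have hq : Measure.QuasiMeasurePreserving (fun ξ : Plane => (2 * Real.pi)⁻¹ • ξ) volume volume := by
    refine ⟨by fun_prop, ?_⟩
    rw [Measure.map_addHaar_smul _ (by positivity)]
    exact Measure.smul_absolutelyContinuous
  filter_upwards [hq.ae h] with ξ hξ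
  simp only [spatialHat]
  rw [hξ, smul_neg]

end

end IMethod

/-! ### The Fourier transform of a time slice -/

namespace IMethod

noncomputable section

theorem memLp_uncurry (u : L2SpaceTime) :
    MemLp (fun q : ℝ × Plane => u (WithLp.toLp 2 q)) 2 (volume.prod volume) :=
  (Lp.memLp u).comp_measurePreserving (WithLp.volume_preserving_toLp ℝ Plane)

theorem ae_slice_eq (u : L2SpaceTime) :
    ∀ᵐ t : ℝ, (slice u t : Plane → ℂ) =ᵐ[volume] fun x => u (WithLp.toLp 2 (t, x)) := by
  have h := memLp_uncurry u
  have hi := ((memLp_two_iff_integrable_sq_norm h.1).1 h).prod_right_ae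
  filter_upwards [hi, h.1.prodMk_left] with t ht hm
  have hmem : MemLp (fun x : Plane => u (WithLp.toLp 2 (t, x))) 2 volume :=
    (memLp_two_iff_integrable_sq_norm hm).2 ht
  rw [slice, dif_pos hmem]
  exact hmem.coeFn_toLp

/-- The Fourier transform of a tensor product. -/
theorem fourier_tensor (ψ : ℝ → ℂ) (h : Plane → ℂ) (q : ℝ × Plane) :
    𝓕 (fun p : SpaceTime => ψ p.fst * h p.snd) (WithLp.toLp 2 q) = 𝓕 ψ q.1 * 𝓕 h q.2 := by
  rw [Real.fourier_eq, Real.fourier_eq, Real.fourier_eq,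
    ← (WithLp.volume_preserving_toLp ℝ Plane).integral_comp
      (MeasurableEquiv.toLp 2 (ℝ × Plane)).measurableEmbedding, Measure.volume_eq_prod,
    ← integral_prod_mul]
  refine integral_congr_ae (Filter.Eventually.of_forall fun v => ?_)
  simp only [WithLp.prod_inner_apply, neg_add, AddChar.map_add_eq_mul, Circle.smul_def,
    Circle.coe_mul, smul_eq_mul, WithLp.toLp_fst, WithLp.toLp_snd]
  ring

/-- The function `t ↦ ∫ exp(2πi t τ) V(τ, ξ) dτ`. -/
def timeSynthesis (V : ℝ × Plane → ℂ) (t : ℝ) (ξ : Plane) : ℂ :=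
  ∫ τ : ℝ, Real.fourierChar (t * τ) • V (τ, ξ)

theorem stronglyMeasurable_timeSynthesis {V : ℝ × Plane → ℂ} (hV : StronglyMeasurable V) :
    StronglyMeasurable fun q : ℝ × Plane => timeSynthesis V q.1 q.2 := by
  unfold timeSynthesis
  refine StronglyMeasurable.integral_prod_right'
    (f := fun q : (ℝ × Plane) × ℝ => Real.fourierChar (q.1.1 * q.2) • V (q.2, q.1.2)) ?_
  refine StronglyMeasurable.smul ?_ (hV.comp_measurable (by fun_prop))
  have : Continuous fun q : (ℝ × Plane) × ℝ => q.1.1 * q.2 := by fun_prop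
  exact (continuous_subtype_val.comp (Real.continuous_fourierChar.comp this)).stronglyMeasurable

theorem enorm_timeSynthesis_le (V : ℝ × Plane → ℂ) (t : ℝ) (ξ : Plane) :
    ‖timeSynthesis V t ξ‖ₑ ≤ ∫⁻ τ, ‖V (τ, ξ)‖ₑ := by
  refine (enorm_integral_le_lintegral_enorm _).trans (lintegral_mono fun τ => ?_)
  rw [← ofReal_norm, ← ofReal_norm, Circle.norm_smul]

section

variable {V : ℝ × Plane → ℂ} (hV : StronglyMeasurable V)
  (hG : ∫⁻ ξ, (∫⁻ τ, ‖V (τ, ξ)‖ₑ) ^ 2 < ⊤)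

include hV in
theorem measurable_lintegral_time : Measurable fun ξ : Plane => ∫⁻ τ, ‖V (τ, ξ)‖ₑ :=
  Measurable.lintegral_prod_left' (f := fun q : ℝ × Plane => ‖V q‖ₑ) hV.measurable.enorm

include hV hG in
theorem ae_lintegral_time_lt_top : ∀ᵐ ξ : Plane, ∫⁻ τ, ‖V (τ, ξ)‖ₑ < ⊤ := by
  filter_upwards [ae_lt_top ((measurable_lintegral_time hV).pow_const 2) hG.ne] with ξ hξ
  by_contra hc
  rw [not_lt_top_iff] at hc
  simp [hc] at hξ

include hV hG in
theorem memLp_lintegral_time :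
    MemLp (fun ξ : Plane => (∫⁻ τ, ‖V (τ, ξ)‖ₑ).toReal) 2 volume := by
  have hm := measurable_lintegral_time hV
  refine ⟨hm.ennreal_toReal.aestronglyMeasurable, ?_⟩
  rw [eLpNorm_lt_top_iff_lintegral_rpow_enorm_lt_top (by norm_num) (by norm_num)]
  refine lt_of_le_of_lt (lintegral_mono fun ξ => ?_) hG
  have : ‖(∫⁻ τ, ‖V (τ, ξ)‖ₑ).toReal‖ₑ ≤ ∫⁻ τ, ‖V (τ, ξ)‖ₑ := by
    rw [Real.enorm_of_nonneg ENNReal.toReal_nonneg]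
    exact ENNReal.ofReal_toReal_le
  simpa using pow_le_pow_left' this 2

include hV hG in
-- The exceptional set of frequencies does not depend on `t`, so this is a majorant uniform in time
-- and can serve in Fubini arguments.
theorem ae_norm_timeSynthesis_le :
    ∀ᵐ ξ : Plane, ∀ t, ‖timeSynthesis V t ξ‖ ≤ (∫⁻ τ, ‖V (τ, ξ)‖ₑ).toReal := by
  filter_upwards [ae_lintegral_time_lt_top hV hG] with ξ hξ t
  have := ENNReal.toReal_mono hξ.ne (enorm_timeSynthesis_le V t ξ)
  rwa [toReal_enorm] at this

include hV hG in
theorem memLp_timeSynthesis (t : ℝ) : MemLp (timeSynthesis V t) 2 volume := by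
  refine (memLp_lintegral_time hV hG).of_le ?_ ?_
  · exact ((stronglyMeasurable_timeSynthesis hV).comp_measurable
      (measurable_prodMk_left (x := t))).aestronglyMeasurable
  · filter_upwards [ae_norm_timeSynthesis_le hV hG] with ξ hξ
    rw [Real.norm_of_nonneg ENNReal.toReal_nonneg]
    exact hξ t

include hV hG in
-- Fubini in the form of the transposition formula. The pairing `-innerₗ ℝ` is used because the
-- synthesis has the opposite phase to `𝓕`; for real `ψ` the transform with that phase is `conj (𝓕
-- ψ)`.
theorem ae_integral_smul_timeSynthesis {ψ : ℝ → ℝ} (hψ : Integrable ψ) :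
    ∀ᵐ ξ : Plane, ∫ t, ψ t • timeSynthesis V t ξ =
      ∫ τ, conj ((𝓕 (fun t => (ψ t : ℂ)) : ℝ → ℂ) τ) * V (τ, ξ) := by
  filter_upwards [ae_lintegral_time_lt_top hV hG] with ξ hξ
  have hi : Integrable fun τ => V (τ, ξ) :=
    ⟨(hV.comp_measurable measurable_prodMk_right).aestronglyMeasurable, hξ⟩
  have h4 := VectorFourier.integral_fourierIntegral_smul_eq_flip (L := -innerₗ ℝ)
    (μ := (volume : Measure ℝ)) (ν := (volume : Measure ℝ)) (f := fun t => (ψ t : ℂ))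
    (g := fun τ => V (τ, ξ))
    Real.continuous_fourierChar (by simp only [LinearMap.neg_apply]; exact continuous_inner.neg)
    hψ.ofReal hi
  calc _ = ∫ t, (ψ t : ℂ) • VectorFourier.fourierIntegral Real.fourierChar volume
        (-innerₗ ℝ).flip (fun τ => V (τ, ξ)) t := by
        refine integral_congr_ae (Filter.Eventually.of_forall fun t => ?_)
        simp only [timeSynthesis, VectorFourier.fourierIntegral, Complex.real_smul, smul_eq_mul]
        congr 1
        refine integral_congr_ae (Filter.Eventually.of_forall fun τ => ?_)
        simp [mul_comm]
    _ = _ := h4.symm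
    _ = _ := by
        refine integral_congr_ae (Filter.Eventually.of_forall fun τ => ?_)
        simp only [smul_eq_mul]
        congr 1
        rw [Real.fourier_eq, ← integral_conj, VectorFourier.fourierIntegral]
        refine integral_congr_ae (Filter.Eventually.of_forall fun t => ?_)
        simp [Circle.smul_def]

end

/-- The weak form of the slicing theorem, tested against one Schwartz function. -/
theorem ae_integral_slice_eq (u : L2SpaceTime)
    (hG : ∫⁻ ξ : Plane, (∫⁻ τ : ℝ, ‖(𝓕 u : L2SpaceTime) (WithLp.toLp 2 (τ, ξ))‖ₑ) ^ 2 < ⊤)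
    (h : SchwartzMap Plane ℂ) :
    ∀ᵐ t : ℝ, ∫ x, conj (h x) * u (WithLp.toLp 2 (t, x)) =
      ∫ ξ, conj ((𝓕 h) ξ) *
        timeSynthesis (fun q => (𝓕 u : L2SpaceTime) (WithLp.toLp 2 q)) t ξ := by
  set V : ℝ × Plane → ℂ := fun q => (𝓕 u : L2SpaceTime) (WithLp.toLp 2 q) with hVdef
  have hV : StronglyMeasurable V :=
    (Lp.stronglyMeasurable (𝓕 u : L2SpaceTime)).comp_measurable (by fun_prop)
  have hu := memLp_uncurry u
  have hGm := memLp_lintegral_time hV hG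
  have hconst : ∀ (h' : SchwartzMap Plane ℂ),
      MemLp (fun ξ : Plane => conj (h' ξ)) 2 volume := fun h' => (h'.memLp 2 volume).star
  have hdom : Integrable fun ξ : Plane => ‖(𝓕 h) ξ‖ * (∫⁻ τ, ‖V (τ, ξ)‖ₑ).toReal :=
    ((𝓕 h).memLp 2 volume).norm.integrable_mul hGm
  -- An arbitrary time measure serves two purposes: restricted to a compact set, with `ψ = 1`, it
  -- gives local integrability in time; with `ν = volume` it justifies exchanging the integrals.
  have key : ∀ (ν : Measure ℝ) [SigmaFinite ν] (ψ : ℝ → ℝ), Integrable ψ ν →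
      Integrable (fun q : Plane × ℝ => conj ((𝓕 h) q.1) * (ψ q.2 • timeSynthesis V q.2 q.1))
        (volume.prod ν) := by
    intro ν _ ψ hψ
    refine (hdom.mul_prod hψ.norm).mono' ?_ ?_
    · refine AEStronglyMeasurable.mul ?_ (AEStronglyMeasurable.fun_smul ?_ ?_)
      · exact ((𝓕 h).continuous.star.comp continuous_fst).aestronglyMeasurable
      · exact hψ.1.comp_snd
      · exact ((stronglyMeasurable_timeSynthesis hV).comp_measurable
          measurable_swap).aestronglyMeasurable
    · filter_upwards [(Measure.quasiMeasurePreserving_fst (μ := (volume : Measure Plane))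
        (ν := ν)).ae (ae_norm_timeSynthesis_le hV hG)] with q hq
      rw [norm_mul, norm_smul, RCLike.norm_conj]
      nlinarith [mul_le_mul_of_nonneg_left (hq q.2)
        (mul_nonneg (norm_nonneg ((𝓕 h) q.1)) (norm_nonneg (ψ q.2)))]
  refine ae_eq_of_integral_contDiff_smul_eq ?_ ?_ fun ψ hψ hc => ?_
  · rw [locallyIntegrable_iff]
    intro K hK
    have : IsFiniteMeasure (volume.restrict K) := ⟨by simpa using hK.measure_lt_top⟩
    have h1 : MemLp (fun q : ℝ × Plane => conj (h q.2)) 2 ((volume.restrict K).prod volume) :=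
      (hconst h).comp_snd _
    have h2 : MemLp (fun q : ℝ × Plane => u (WithLp.toLp 2 q)) 2
        ((volume.restrict K).prod volume) := by
      refine hu.mono_measure ?_
      have := Measure.prod_restrict (μ := (volume : Measure ℝ)) (ν := (volume : Measure Plane))
        K Set.univ
      rw [Measure.restrict_univ] at this
      rw [this]
      exact Measure.restrict_le_self
    exact (h1.integrable_mul h2).integral_prod_left
  · rw [locallyIntegrable_iff]
    intro K hK
    have : IsFiniteMeasure (volume.restrict K) := ⟨by simpa using hK.measure_lt_top⟩
    have := (key (volume.restrict K) (fun _ => 1) (integrable_const 1)).integral_prod_right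
    simpa [IntegrableOn] using this
  · have hψi : Integrable ψ := hψ.continuous.integrable_of_hasCompactSupport hc
    have hψ2 : MemLp ψ 2 := hψ.continuous.memLp_of_hasCompactSupport hc
    have hT1 : Integrable fun p : SpaceTime => (ψ p.fst : ℂ) * h p.snd := by
      rw [← (WithLp.volume_preserving_toLp ℝ Plane).integrable_comp_emb
        (MeasurableEquiv.toLp 2 (ℝ × Plane)).measurableEmbedding]
      exact hψi.ofReal.mul_prod h.integrable
    have hT2 : MemLp (fun p : SpaceTime => (ψ p.fst : ℂ) * h p.snd) 2 := by
      rw [memLp_two_iff_integrable_sq_norm hT1.1,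
        ← (WithLp.volume_preserving_toLp ℝ Plane).integrable_comp_emb
        (MeasurableEquiv.toLp 2 (ℝ × Plane)).measurableEmbedding]
      simp only [Function.comp_def, norm_mul, mul_pow, Complex.norm_real]
      exact ((memLp_two_iff_integrable_sq_norm hψ2.1).1 hψ2).mul_prod
        ((memLp_two_iff_integrable_sq_norm (h.memLp 2 volume).1).1 (h.memLp 2 volume))
    -- Plancherel against the tensor product `ψ ⊗ h`; the two sides unfold to the two sides of the
    -- claim tested against `ψ`.
    have hin := Lp.inner_fourier_eq (hT2.toLp _) u
    rw [L2.inner_def, L2.inner_def] at hin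
    have e1 : ∫ t, ψ t • ∫ x, conj (h x) * u (WithLp.toLp 2 (t, x)) =
        ∫ p, inner ℂ ((hT2.toLp _) p) (u p) := by
      have hint : Integrable (fun p => inner ℂ ((hT2.toLp _) p) (u p)) :=
        L2.integrable_inner _ _
      have hae : (fun p => inner ℂ ((hT2.toLp _) p) (u p)) =ᵐ[volume]
          fun p : SpaceTime => ψ p.fst • (conj (h p.snd) * u p) := by
        filter_upwards [hT2.coeFn_toLp] with p hp
        rw [hp, RCLike.inner_apply]
        simp only [map_mul, Complex.conj_ofReal, Complex.real_smul]
        ring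
      rw [integral_congr_ae hae]
      rw [integrable_congr hae, ← (WithLp.volume_preserving_toLp ℝ Plane).integrable_comp_emb
        (MeasurableEquiv.toLp 2 (ℝ × Plane)).measurableEmbedding, Function.comp_def] at hint
      rw [← (WithLp.volume_preserving_toLp ℝ Plane).integral_comp
        (MeasurableEquiv.toLp 2 (ℝ × Plane)).measurableEmbedding, Measure.volume_eq_prod,
        integral_prod _ hint]
      exact integral_congr_ae (Filter.Eventually.of_forall fun t => (integral_smul _ _).symm)
    have e2 : ∫ p, inner ℂ ((𝓕 (hT2.toLp _) : L2SpaceTime) p) ((𝓕 u : L2SpaceTime) p) =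
        ∫ t, ψ t • ∫ ξ, conj ((𝓕 h) ξ) * timeSynthesis V t ξ := by
      have hint : Integrable (fun p => inner ℂ ((𝓕 (hT2.toLp _) : L2SpaceTime) p)
          ((𝓕 u : L2SpaceTime) p)) := L2.integrable_inner _ _
      have hae : (fun p => inner ℂ ((𝓕 (hT2.toLp _) : L2SpaceTime) p)
          ((𝓕 u : L2SpaceTime) p)) =ᵐ[volume] fun p : SpaceTime => conj ((𝓕 h) p.snd) *
            (conj ((𝓕 (fun t => (ψ t : ℂ)) : ℝ → ℂ) p.fst) * V (p.fst, p.snd)) := by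
        filter_upwards [fourier_toLp_ae hT1 hT2] with p hp
        have := fourier_tensor (fun t => (ψ t : ℂ)) h (p.fst, p.snd)
        rw [hp, RCLike.inner_apply, SchwartzMap.fourier_coe]
        change _ = conj (𝓕 (h : Plane → ℂ) p.snd) * (_ * (𝓕 u : L2SpaceTime) p)
        change 𝓕 (fun p : SpaceTime => (ψ p.fst : ℂ) * h p.snd) p = _ at this
        rw [this, map_mul]
        ring
      rw [integral_congr_ae hae]
      rw [integrable_congr hae, ← (WithLp.volume_preserving_toLp ℝ Plane).integrable_comp_emb
        (MeasurableEquiv.toLp 2 (ℝ × Plane)).measurableEmbedding, Function.comp_def] at hint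
      rw [← (WithLp.volume_preserving_toLp ℝ Plane).integral_comp
        (MeasurableEquiv.toLp 2 (ℝ × Plane)).measurableEmbedding, Measure.volume_eq_prod,
        integral_prod_symm _ hint]
      simp only [WithLp.toLp_fst, WithLp.toLp_snd, integral_const_mul]
      have e3 : (fun ξ : Plane => conj ((𝓕 h) ξ) *
          ∫ τ, conj ((𝓕 (fun t => (ψ t : ℂ)) : ℝ → ℂ) τ) * V (τ, ξ)) =ᵐ[volume]
          fun ξ => ∫ t, conj ((𝓕 h) ξ) * (ψ t • timeSynthesis V t ξ) := by
        filter_upwards [ae_integral_smul_timeSynthesis hV hG hψi] with ξ hξ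
        rw [integral_const_mul, hξ]
      rw [integral_congr_ae e3, integral_integral_swap (key volume ψ hψi)]
      refine integral_congr_ae (Filter.Eventually.of_forall fun t => ?_)
      simp only [mul_smul_comm, integral_smul]
    rw [e1, ← hin, e2]

/-- The spatial Fourier transform of almost every time slice, computed from the space-time
transform. -/
theorem ae_fourier_slice_eq (u : L2SpaceTime)
    (hG : ∫⁻ ξ : Plane, (∫⁻ τ : ℝ, ‖(𝓕 u : L2SpaceTime) (WithLp.toLp 2 (τ, ξ))‖ₑ) ^ 2 < ⊤) :
    ∀ᵐ t : ℝ, (𝓕 (slice u t) : L2Plane) =ᵐ[volume]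
      timeSynthesis (fun q => (𝓕 u : L2SpaceTime) (WithLp.toLp 2 q)) t := by
  set V : ℝ × Plane → ℂ := fun q => (𝓕 u : L2SpaceTime) (WithLp.toLp 2 q) with hVdef
  have hV : StronglyMeasurable V :=
    (Lp.stronglyMeasurable (𝓕 u : L2SpaceTime)).comp_measurable (by fun_prop)
  let T : SchwartzMap Plane ℂ → L2Plane := SchwartzMap.toLpCLM ℝ ℂ 2 volume
  have hT : DenseRange T := SchwartzMap.denseRange_toLpCLM (by norm_num)
  have : Fact ((2 : ℝ≥0∞) ≠ ⊤) := ⟨by norm_num⟩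
  -- The null set of times in the weak identity depends on the test function, so only countably many
  -- Schwartz functions may be used; a dense set of them determines an element of `L²`.
  obtain ⟨c, hcs, hcc, hcd⟩ := TopologicalSpace.IsSeparable.exists_countable_dense_subset
    (TopologicalSpace.IsSeparable.of_separableSpace (Set.range T))
  choose! k hk using fun x (hx : x ∈ c) => hcs hx
  have hall : ∀ᵐ t : ℝ, ∀ x ∈ c, ∫ y, conj (k x y) * u (WithLp.toLp 2 (t, y)) =
      ∫ ξ, conj ((𝓕 (k x)) ξ) * timeSynthesis V t ξ :=
    (ae_ball_iff hcc).2 fun x _ => ae_integral_slice_eq u hG (k x)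
  filter_upwards [hall, ae_slice_eq u] with t ht hs
  have hmem := memLp_timeSynthesis hV hG t
  have heq : (𝓕 (slice u t) : L2Plane) = hmem.toLp _ := by
    rw [← sub_eq_zero]
    have hd : Dense c := by
      intro x
      exact closure_minimal hcd isClosed_closure (hT x)
    have hz : ∀ x ∈ c, inner ℂ (𝓕 x : L2Plane) (𝓕 (slice u t) - hmem.toLp _) = 0 := by
      intro x hx
      have hx' : x = (k x).toLp 2 := (hk x hx).symm
      rw [inner_sub_right, Lp.inner_fourier_eq, sub_eq_zero]
      have a1 : inner ℂ x (slice u t) = ∫ y, conj (k x y) * u (WithLp.toLp 2 (t, y)) := by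
        rw [L2.inner_def]
        refine integral_congr_ae ?_
        have := (k x).coeFn_toLp 2 volume
        rw [← hx'] at this
        filter_upwards [this, hs] with y h1 h2
        rw [h1, h2, RCLike.inner_apply, mul_comm]
      have a2 : inner ℂ (𝓕 x : L2Plane) (hmem.toLp _) =
          ∫ ξ, conj ((𝓕 (k x)) ξ) * timeSynthesis V t ξ := by
        rw [L2.inner_def]
        refine integral_congr_ae ?_
        have := (𝓕 (k x)).coeFn_toLp 2 volume
        rw [← SchwartzMap.toLp_fourier_eq, ← hx'] at this
        filter_upwards [this, hmem.coeFn_toLp] with y h1 h2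
        rw [h1, h2, RCLike.inner_apply, mul_comm]
      rw [a1, a2, ht x hx]
    have hz' : ∀ x : L2Plane, inner ℂ (𝓕 x : L2Plane) (𝓕 (slice u t) - hmem.toLp _) = 0 := by
      intro x
      have hcl : IsClosed {x : L2Plane |
          inner ℂ (𝓕 x : L2Plane) (𝓕 (slice u t) - hmem.toLp _) = 0} :=
        isClosed_eq ((Lp.fourierTransformₗᵢ Plane ℂ).continuous.inner continuous_const)
          continuous_const
      exact closure_minimal hz hcl (hd x)
    -- Testing the difference against itself.
    have := hz' (𝓕⁻ (𝓕 (slice u t) - hmem.toLp _))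
    rwa [fourier_fourierInv_eq, inner_self_eq_zero] at this
  rw [heq]
  exact hmem.coeFn_toLp

end

end IMethod

/-! ### The function `φ(|ξ|)²|ξ|²` and its gradient -/

namespace IMethod

noncomputable section

/-- `p(r)` is such that `p(‖ξ‖) ξ` is the gradient of `φ(‖ξ‖)² ‖ξ‖²`. -/
def Profile.slope {s : ℝ} (φ : Profile s) (r : ℝ) : ℝ :=
  2 * φ.toFun r * deriv φ.toFun r * r + 2 * φ.toFun r ^ 2

theorem Profile.contDiff_slope {s : ℝ} (φ : Profile s) : ContDiff ℝ 1 φ.slope := by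
  have h1 : ContDiff ℝ 1 φ.toFun := φ.smooth.of_le (by exact_mod_cast le_top)
  have h2 : ContDiff ℝ 1 (deriv φ.toFun) :=
    ((contDiff_infty_iff_deriv.1 φ.smooth).2).of_le (by exact_mod_cast le_top)
  unfold Profile.slope
  fun_prop

theorem Profile.slope_eq_of_lt {s : ℝ} (φ : Profile s) {r : ℝ} (hr : 2 < r) :
    φ.slope r = 2 * s * r ^ (2 * s - 2) := by
  have hr0 : 0 < r := by linarith
  have he : φ.toFun =ᶠ[nhds r] fun x => x ^ (s - 1) := by
    filter_upwards [lt_mem_nhds hr] with x hx using φ.eq_rpow x hx.le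
  have hd : deriv φ.toFun r = (s - 1) * r ^ (s - 1 - 1) := by
    rw [he.deriv_eq, Real.deriv_rpow_const]
  rw [Profile.slope, hd, φ.eq_rpow r hr.le]
  have e1 : r ^ (2 * s - 2) = r ^ (s - 1) * r ^ (s - 1) := by
    rw [← Real.rpow_add hr0]; ring_nf
  have e2 : r ^ (s - 1) = r ^ (s - 1 - 1) * r := by
    rw [Real.rpow_sub_one hr0.ne' (s - 1)]; field_simp
  rw [e1, show 2 * r ^ (s - 1) * ((s - 1) * r ^ (s - 1 - 1)) * r =
    2 * (s - 1) * r ^ (s - 1) * (r ^ (s - 1 - 1) * r) by ring, ← e2]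
  ring

theorem Profile.slope_eq_of_lt_one {s : ℝ} (φ : Profile s) {r : ℝ} (hr : r < 1) :
    φ.slope r = 2 := by
  have he : φ.toFun =ᶠ[nhds r] fun _ => 1 := by
    filter_upwards [gt_mem_nhds hr] with x hx using φ.eq_one x hx.le
  rw [Profile.slope, he.deriv_eq, φ.eq_one r hr.le]
  simp

theorem rpow_le_two_mul_one_add_rpow {γ r : ℝ} (hγ0 : 0 ≤ γ) (hγ1 : γ ≤ 1) (hr : 1 ≤ r) :
    r ^ (-γ) ≤ 2 * (1 + r) ^ (-γ) := by
  have h1 : (2 * r) ^ (-γ) ≤ (1 + r) ^ (-γ) :=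
    Real.rpow_le_rpow_of_nonpos (by linarith) (by linarith) (by linarith)
  rw [Real.mul_rpow (by norm_num) (by linarith)] at h1
  have h2 : (2 : ℝ)⁻¹ ≤ 2 ^ (-γ) := by
    rw [← Real.rpow_neg_one]
    exact Real.rpow_le_rpow_of_exponent_le (by norm_num) (by linarith)
  have h3 : 0 ≤ r ^ (-γ) := Real.rpow_nonneg (by linarith) _
  nlinarith

/-- The gradient coefficient and its logarithmic derivative decay like `(1 + r)^{2s - 2}`. -/
theorem Profile.exists_slope_bound {s : ℝ} (hs : 1 / 2 < s) (hs' : s < 1) (φ : Profile s) :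
    ∃ C : ℝ, 0 < C ∧ ∀ r : ℝ, 0 ≤ r → |φ.slope r| ≤ C * (1 + r) ^ (-(2 - 2 * s)) ∧
      |deriv φ.slope r| * r ≤ C * (1 + r) ^ (-(2 - 2 * s)) := by
  have hc1 : Continuous φ.slope := φ.contDiff_slope.continuous
  have hc2 : Continuous fun r => deriv φ.slope r * r :=
    (φ.contDiff_slope.continuous_deriv le_rfl).mul continuous_id
  obtain ⟨C1, hC1⟩ := (isCompact_Icc (a := (0 : ℝ)) (b := 3)).exists_bound_of_continuousOn
    hc1.continuousOn
  obtain ⟨C2, hC2⟩ := (isCompact_Icc (a := (0 : ℝ)) (b := 3)).exists_bound_of_continuousOn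
    hc2.continuousOn
  refine ⟨4 * (|C1| + |C2|) + 8, by positivity, fun r hr => ?_⟩
  have hpos : 0 < (1 + r) ^ (-(2 - 2 * s)) := Real.rpow_pos_of_pos (by linarith) _
  -- On `[0, 3]` compactness suffices, the decay factor being at least `1/4` because `2 - 2s ≤ 1`;
  -- beyond `3` the profile is an explicit power near `r`.
  rcases le_or_gt r 3 with h3 | h3
  · have hlow : (1 / 4 : ℝ) ≤ (1 + r) ^ (-(2 - 2 * s)) := by
      calc (1 / 4 : ℝ) = 4 ^ (-1 : ℝ) := by norm_num [Real.rpow_neg_one]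
        _ ≤ 4 ^ (-(2 - 2 * s)) :=
          Real.rpow_le_rpow_of_exponent_le (by norm_num) (by linarith)
        _ ≤ _ := Real.rpow_le_rpow_of_nonpos (by linarith) (by linarith) (by linarith)
    have b1 := hC1 r ⟨hr, h3⟩
    have b2 := hC2 r ⟨hr, h3⟩
    rw [Real.norm_eq_abs] at b1
    rw [Real.norm_eq_abs, abs_mul, abs_of_nonneg hr] at b2
    have := le_abs_self C1
    have := le_abs_self C2
    have := abs_nonneg C1
    have := abs_nonneg C2
    constructor <;> nlinarith
  · have hr2 : 2 < r := by linarith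
    have hr0 : 0 < r := by linarith
    have he : φ.slope =ᶠ[nhds r] fun x => 2 * s * x ^ (2 * s - 2) := by
      filter_upwards [lt_mem_nhds hr2] with x hx using φ.slope_eq_of_lt hx
    have hd : deriv φ.slope r = 2 * s * ((2 * s - 2) * r ^ (2 * s - 2 - 1)) := by
      rw [he.deriv_eq, deriv_const_mul_field, Real.deriv_rpow_const]
    have e2 : r ^ (2 * s - 2) = r ^ (2 * s - 2 - 1) * r := by
      rw [Real.rpow_sub_one hr0.ne' (2 * s - 2)]; field_simp
    have hle := rpow_le_two_mul_one_add_rpow (γ := 2 - 2 * s) (by linarith) (by linarith)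
      (show 1 ≤ r by linarith)
    rw [neg_sub] at hle
    have hp : 0 < r ^ (2 * s - 2) := Real.rpow_pos_of_pos hr0 _
    have hA := abs_nonneg C1
    have hB := abs_nonneg C2
    rw [neg_sub] at hpos ⊢
    constructor
    · rw [φ.slope_eq_of_lt hr2, abs_of_nonneg (by positivity)]
      nlinarith
    · rw [hd, show |2 * s * ((2 * s - 2) * r ^ (2 * s - 2 - 1))| * r =
        2 * s * (2 - 2 * s) * r ^ (2 * s - 2) by
          rw [e2, abs_mul (2 * s), abs_mul (2 * s - 2), abs_of_nonneg (by linarith : 0 ≤ 2 * s),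
            abs_of_nonpos (by linarith : 2 * s - 2 ≤ 0),
            abs_of_nonneg (Real.rpow_nonneg hr0.le _)]
          ring]
      have : 2 * s * (2 - 2 * s) ≤ 2 := by nlinarith
      nlinarith

/-- `φ(‖ξ‖)² ‖ξ‖²`. -/
def Profile.energy {s : ℝ} (φ : Profile s) (ξ : Plane) : ℝ := φ.toFun ‖ξ‖ ^ 2 * ‖ξ‖ ^ 2

/-- The norm is not differentiable at the origin, so the open unit ball, where the function is
`‖ξ‖²`, is separated from the region where the chain rule applies. -/
theorem Profile.hasFDerivAt_energy {s : ℝ} (φ : Profile s) (ξ : Plane) :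
    HasFDerivAt φ.energy (innerSL ℝ (φ.slope ‖ξ‖ • ξ)) ξ := by
  have hsq : HasFDerivAt (fun x : Plane => ‖x‖ ^ 2) (2 • innerSL ℝ ξ) ξ :=
    (hasStrictFDerivAt_norm_sq ξ).hasFDerivAt
  rcases lt_or_ge ‖ξ‖ 1 with h | h
  · have he : φ.energy =ᶠ[nhds ξ] fun x => ‖x‖ ^ 2 := by
      filter_upwards [continuous_norm.continuousAt.eventually (gt_mem_nhds h)] with x hx
      simp [Profile.energy, φ.eq_one _ (le_of_lt hx)]
    refine (hsq.congr_of_eventuallyEq he).congr_fderiv ?_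
    rw [φ.slope_eq_of_lt_one h]
    ext y
    simp
  · have h0 : ‖ξ‖ ≠ 0 := by linarith
    have hξ : ξ ≠ 0 := norm_ne_zero_iff.1 h0
    have hn : HasFDerivAt (fun x : Plane => ‖x‖) (‖ξ‖⁻¹ • innerSL ℝ ξ) ξ := by
      have := hsq.sqrt (by positivity)
      simp only [Real.sqrt_sq (norm_nonneg _)] at this
      refine this.congr_fderiv ?_
      ext y
      simp
      field_simp
    have hφ : HasDerivAt φ.toFun (deriv φ.toFun ‖ξ‖) ‖ξ‖ :=
      ((φ.smooth.differentiable (by simp)) _).hasDerivAt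
    have hc := hφ.comp_hasFDerivAt ξ hn
    refine ((hc.pow 2).mul hsq).congr_fderiv ?_
    ext y
    simp [Profile.slope]
    field_simp
    ring

end

end IMethod

/-! ### First and second differences of the energy density -/

namespace IMethod

noncomputable section

section DoubleDifference

variable {s : ℝ} (hs : 1 / 2 < s) (hs' : s < 1) (φ : Profile s) {C : ℝ}
  (hC : ∀ r : ℝ, 0 ≤ r → |φ.slope r| ≤ C * (1 + r) ^ (-(2 - 2 * s)) ∧
      |deriv φ.slope r| * r ≤ C * (1 + r) ^ (-(2 - 2 * s)))

include hs' hC in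
-- Write `p(|x|)x - p(|y|)y = p(|x|)(x - y) + (p(|x|) - p(|y|))y`. Since `y` is the shorter vector,
-- `|y| |p'(r)| ≤ r |p'(r)|` between the two norms, and this is the quantity that decays. Working
-- with the radial variable avoids following the segment from `x` to `y`, which may pass near the
-- origin.
theorem Profile.norm_gradient_sub_le_of_le {x y : Plane} {w : ℝ} (hw : 0 ≤ w) (hy : w ≤ ‖y‖)
    (hyx : ‖y‖ ≤ ‖x‖) :
    ‖φ.slope ‖x‖ • x - φ.slope ‖y‖ • y‖ ≤ 2 * C * (1 + w) ^ (-(2 - 2 * s)) * ‖x - y‖ := by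
  have hC0 : 0 ≤ C := by
    have := (abs_nonneg _).trans (hC 0 le_rfl).1
    simpa using this
  have hmono : ∀ r, w ≤ r → (1 + r) ^ (-(2 - 2 * s)) ≤ (1 + w) ^ (-(2 - 2 * s)) := fun r hr =>
    Real.rpow_le_rpow_of_nonpos (by linarith) (by linarith) (by linarith)
  set D := C * (1 + w) ^ (-(2 - 2 * s)) with hD
  have hD0 : 0 ≤ D := mul_nonneg hC0 (Real.rpow_nonneg (by linarith) _)
  have h1 : ‖y‖ * |φ.slope ‖x‖ - φ.slope ‖y‖| ≤ D * ‖x - y‖ := by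
    rcases eq_or_lt_of_le (norm_nonneg y) with h0 | h0
    · rw [← h0, zero_mul]; positivity
    have hmv := (convex_Icc ‖y‖ ‖x‖).norm_image_sub_le_of_norm_deriv_le (f := φ.slope)
      (C := D / ‖y‖) (fun r _ => (φ.contDiff_slope.differentiable (by simp)) r)
      (fun r hr => by
        have hr0 : 0 < r := h0.trans_le hr.1
        rw [le_div_iff₀ h0, Real.norm_eq_abs]
        calc |deriv φ.slope r| * ‖y‖ ≤ |deriv φ.slope r| * r := by gcongr; exact hr.1
          _ ≤ C * (1 + r) ^ (-(2 - 2 * s)) := (hC r hr0.le).2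
          _ ≤ D := by
            exact mul_le_mul_of_nonneg_left (hmono r (hy.trans hr.1)) hC0)
      (Set.left_mem_Icc.2 hyx) (Set.right_mem_Icc.2 hyx)
    rw [Real.norm_eq_abs] at hmv
    have h2 : ‖‖x‖ - ‖y‖‖ ≤ ‖x - y‖ := abs_norm_sub_norm_le x y
    calc _ ≤ ‖y‖ * (D / ‖y‖ * ‖‖x‖ - ‖y‖‖) := by gcongr
      _ = D * ‖‖x‖ - ‖y‖‖ := by field_simp
      _ ≤ _ := by gcongr
  have h3 : |φ.slope ‖x‖| ≤ D := ((hC _ (norm_nonneg x)).1).trans (mul_le_mul_of_nonneg_left (hmono _ (hy.trans hyx)) hC0)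
  calc ‖φ.slope ‖x‖ • x - φ.slope ‖y‖ • y‖
      = ‖φ.slope ‖x‖ • (x - y) + (φ.slope ‖x‖ - φ.slope ‖y‖) • y‖ := by
        congr 1; module
    _ ≤ |φ.slope ‖x‖| * ‖x - y‖ + |φ.slope ‖x‖ - φ.slope ‖y‖| * ‖y‖ := by
        refine (norm_add_le _ _).trans ?_
        rw [norm_smul, norm_smul, Real.norm_eq_abs, Real.norm_eq_abs]
    _ ≤ D * ‖x - y‖ + D * ‖x - y‖ := by
        rw [mul_comm _ ‖y‖]; gcongr
    _ = _ := by rw [hD]; ring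

include hs' hC in
theorem Profile.norm_gradient_sub_le {x y : Plane} {w : ℝ} (hw : 0 ≤ w) (hx : w ≤ ‖x‖)
    (hy : w ≤ ‖y‖) :
    ‖φ.slope ‖x‖ • x - φ.slope ‖y‖ • y‖ ≤ 2 * C * (1 + w) ^ (-(2 - 2 * s)) * ‖x - y‖ := by
  rcases le_total ‖y‖ ‖x‖ with h | h
  · exact φ.norm_gradient_sub_le_of_le hs' hC hw hy h
  · rw [norm_sub_rev, norm_sub_rev x y]
    exact φ.norm_gradient_sub_le_of_le hs' hC hw hx h

/-- The function `(1 + t)^{-γ} t` is `(1 + t)^{1-γ}` times `t/(1 + t)`, and both factors increase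
when `γ ≤ 1`. For `γ = 2 - 2s` this is where `s > 1/2` enters the symbol bound. -/
theorem mul_one_add_rpow_le {γ r w : ℝ} (hγ1 : γ ≤ 1) (hr : 0 ≤ r) (hrw : r ≤ w) :
    (1 + r) ^ (-γ) * r ≤ (1 + w) ^ (-γ) * w := by
  have e : ∀ t : ℝ, 0 ≤ t → (1 + t) ^ (-γ) * t = (1 + t) ^ (1 - γ) * (t / (1 + t)) := by
    intro t ht
    rw [show -γ = (1 - γ) - 1 by ring, Real.rpow_sub_one (by linarith)]
    field_simp
  rw [e r hr, e w (hr.trans hrw)]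
  have h1 : (1 + r) ^ (1 - γ) ≤ (1 + w) ^ (1 - γ) :=
    Real.rpow_le_rpow (by linarith) (by linarith) (by linarith)
  have h2 : r / (1 + r) ≤ w / (1 + w) := by
    rw [div_le_div_iff₀ (by linarith) (by linarith)]
    nlinarith
  exact mul_le_mul h1 h2 (by positivity) (Real.rpow_nonneg (by linarith) _)

include hs hC in
-- The mean value inequality on the ball of radius `w`, where the gradient is largest near the
-- boundary up to the constant, by the preceding monotonicity.
theorem Profile.abs_energy_sub_le {x b : Plane} {w : ℝ} (hx : ‖x‖ ≤ w) (hxb : ‖x - b‖ ≤ w) :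
    |φ.energy x - φ.energy (x - b)| ≤ C * ((1 + w) ^ (-(2 - 2 * s)) * w) * ‖b‖ := by
  have hC0 : 0 ≤ C := by
    have := (abs_nonneg _).trans (hC 0 le_rfl).1
    simpa using this
  have hball : Convex ℝ (Metric.closedBall (0 : Plane) w) := convex_closedBall _ _
  have := hball.norm_image_sub_le_of_norm_hasFDerivWithin_le (f := φ.energy)
    (C := C * ((1 + w) ^ (-(2 - 2 * s)) * w))
    (fun y _ => (φ.hasFDerivAt_energy y).hasFDerivWithinAt)
    (fun y hy => by
      rw [innerSL_apply_norm, norm_smul, Real.norm_eq_abs]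
      have hy' : ‖y‖ ≤ w := by simpa using hy
      calc |φ.slope ‖y‖| * ‖y‖ ≤ C * (1 + ‖y‖) ^ (-(2 - 2 * s)) * ‖y‖ := by
            gcongr; exact (hC _ (norm_nonneg y)).1
        _ = C * ((1 + ‖y‖) ^ (-(2 - 2 * s)) * ‖y‖) := by ring
        _ ≤ _ := by
            gcongr ?_ * ?_
            exact mul_one_add_rpow_le (by linarith) (norm_nonneg _) hy')
    (show x - b ∈ _ by simpa using hxb) (show x ∈ _ by simpa using hx)
  simpa using this

include hs hs' hC in
/-- The mixed second difference of the energy density over a parallelogram one of whose vertices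
has the largest norm `w`. -/
theorem Profile.abs_double_difference_le {x a b : Plane} {w : ℝ}
    (h1 : ‖x‖ ≤ w) (h2 : ‖x - a‖ ≤ w) (h3 : ‖x - b‖ ≤ w) (h4 : ‖x - a - b‖ ≤ w)
    (hw : w = ‖x‖ ∨ w = ‖x - a‖ ∨ w = ‖x - b‖ ∨ w = ‖x - a - b‖) :
    |φ.energy x - φ.energy (x - a) - φ.energy (x - b) + φ.energy (x - a - b)| ≤
      16 * C * (1 + w) ^ (-(2 - 2 * s)) * ‖a‖ * ‖b‖ := by
  have hC0 : 0 ≤ C := by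
    have := (abs_nonneg _).trans (hC 0 le_rfl).1
    simpa using this
  have hw0 : 0 ≤ w := (norm_nonneg _).trans h1
  set D := (1 + w) ^ (-(2 - 2 * s)) with hD
  have hD0 : 0 ≤ D := Real.rpow_nonneg (by linarith) _
  -- If one side is at least `w/8`, two first differences along the other side suffice: each carries
  -- a factor `w ≤ 8‖a‖`, which accounts for the constant `16 = 2·8`.
  rcases le_or_gt (w / 8) ‖a‖ with ha | ha
  · have b1 := φ.abs_energy_sub_le hs hC (b := b) h1 h3
    have b2 := φ.abs_energy_sub_le hs hC (b := b) h2 h4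
    have hk : C * (D * w) * ‖b‖ ≤ C * (D * (8 * ‖a‖)) * ‖b‖ := by gcongr; linarith
    rw [abs_le] at *
    constructor <;> nlinarith
  rcases le_or_gt (w / 8) ‖b‖ with hb | hb
  · have b1 := φ.abs_energy_sub_le hs hC (b := a) h1 h2
    have h4' : ‖x - b - a‖ ≤ w := by rwa [sub_right_comm]
    have b2 := φ.abs_energy_sub_le hs hC (b := a) h3 h4'
    rw [sub_right_comm x b a] at b2
    have hk : C * (D * w) * ‖a‖ ≤ C * (D * (8 * ‖b‖)) * ‖a‖ := by gcongr; linarith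
    rw [abs_le] at *
    constructor <;> nlinarith
  -- When both sides are shorter than `w/8`, every point of the parallelogram is within `w/4` of the
  -- vertex of norm `w`, so the whole of it stays away from the origin.
  have hlow : ∀ t r : ℝ, 0 ≤ t → t ≤ 1 → 0 ≤ r → r ≤ 1 → w / 2 ≤ ‖x - r • a - t • b‖ := by
    intro t r ht ht1 hr hr1
    have key : ∀ y : Plane, ∀ t' r' : ℝ, |t'| ≤ 1 → |r'| ≤ 1 → w = ‖y‖ →
        x - r • a - t • b = y + r' • a + t' • b → w / 2 ≤ ‖x - r • a - t • b‖ := by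
      intro y t' r' ht' hr' hy he
      rw [he, hy]
      have n1 : ‖r' • a‖ ≤ ‖a‖ := by
        rw [norm_smul, Real.norm_eq_abs]; exact mul_le_of_le_one_left (norm_nonneg _) hr'
      have n2 : ‖t' • b‖ ≤ ‖b‖ := by
        rw [norm_smul, Real.norm_eq_abs]; exact mul_le_of_le_one_left (norm_nonneg _) ht'
      have n3 : ‖y‖ ≤ ‖y + r' • a + t' • b‖ + ‖r' • a‖ + ‖t' • b‖ := by
        calc ‖y‖ = ‖(y + r' • a + t' • b) - r' • a - t' • b‖ := by congr 1; abel
          _ ≤ _ := (norm_sub_le _ _).trans (by gcongr; exact norm_sub_le _ _)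
      rw [← hy] at n3
      linarith
    rcases hw with h | h | h | h
    · exact key x (-t) (-r) (abs_le.2 ⟨by linarith, by linarith⟩)
        (abs_le.2 ⟨by linarith, by linarith⟩) h (by module)
    · exact key (x - a) (-t) (1 - r) (abs_le.2 ⟨by linarith, by linarith⟩)
        (abs_le.2 ⟨by linarith, by linarith⟩) h (by module)
    · exact key (x - b) (1 - t) (-r) (abs_le.2 ⟨by linarith, by linarith⟩)
        (abs_le.2 ⟨by linarith, by linarith⟩) h (by module)
    · exact key (x - a - b) (1 - t) (1 - r) (abs_le.2 ⟨by linarith, by linarith⟩)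
        (abs_le.2 ⟨by linarith, by linarith⟩) h (by module)
  have hshift : ∀ y : Plane, HasFDerivAt (fun y => φ.energy (y - a))
      (innerSL ℝ (φ.slope ‖y - a‖ • (y - a))) y := fun y => by
    have h : HasFDerivAt (fun y : Plane => y - a) (ContinuousLinearMap.id ℝ Plane) y :=
      (hasFDerivAt_id y).sub_const a
    exact ((φ.hasFDerivAt_energy (y - a)).comp (f := fun y : Plane => y - a) y h).congr_fderiv
      (ContinuousLinearMap.comp_id _)
  -- The mean value inequality in the direction `b` for the difference in the direction `a`, whose
  -- derivative is a difference of gradients. Passing from `w/2` to `w` in the decay factor costs a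
  -- factor `2`.
  have hseg := (convex_segment (𝕜 := ℝ) x (x - b)).norm_image_sub_le_of_norm_hasFDerivWithin_le
    (f := fun y => φ.energy y - φ.energy (y - a))
    (f' := fun y => innerSL ℝ (φ.slope ‖y‖ • y) - innerSL ℝ (φ.slope ‖y - a‖ • (y - a)))
    (C := 4 * C * D * ‖a‖)
    (fun y _ => ((φ.hasFDerivAt_energy y).sub
      (hshift y)).hasFDerivWithinAt)
    (fun y hy => by
      rw [segment_eq_image_lineMap] at hy
      obtain ⟨t, ht, rfl⟩ := hy
      have e1 : AffineMap.lineMap x (x - b) t = x - (0 : ℝ) • a - t • b := by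
        rw [AffineMap.lineMap_apply_module]; module
      have e2 : AffineMap.lineMap x (x - b) t - a = x - (1 : ℝ) • a - t • b := by
        rw [AffineMap.lineMap_apply_module]; module
      rw [← map_sub, innerSL_apply_norm]
      refine (φ.norm_gradient_sub_le hs' hC (w := w / 2) (by linarith) ?_ ?_).trans ?_
      · rw [e1]; exact hlow t 0 ht.1 ht.2 le_rfl zero_le_one
      · rw [e2]; exact hlow t 1 ht.1 ht.2 zero_le_one le_rfl
      · rw [sub_sub_cancel]
        have hd : (1 + w / 2) ^ (-(2 - 2 * s)) ≤ 2 * D := by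
          have g1 : (1 + w / 2) ^ (-(2 - 2 * s)) ≤ ((1 + w) * 2⁻¹) ^ (-(2 - 2 * s)) :=
            Real.rpow_le_rpow_of_nonpos (by linarith) (by linarith) (by linarith)
          have g2 : (2 : ℝ)⁻¹ ^ (-(2 - 2 * s)) ≤ 2 := by
            rw [Real.inv_rpow (by norm_num), ← Real.rpow_neg (by norm_num), neg_neg]
            calc (2 : ℝ) ^ (2 - 2 * s) ≤ 2 ^ (1 : ℝ) :=
                  Real.rpow_le_rpow_of_exponent_le (by norm_num) (by linarith)
              _ = 2 := by simp
          rw [Real.mul_rpow (by linarith) (by norm_num)] at g1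
          nlinarith
        calc 2 * C * (1 + w / 2) ^ (-(2 - 2 * s)) * ‖a‖ ≤ 2 * C * (2 * D) * ‖a‖ := by gcongr
          _ = _ := by ring)
    (right_mem_segment ℝ x (x - b)) (left_mem_segment ℝ x (x - b))
  rw [sub_sub_cancel, Real.norm_eq_abs] at hseg
  rw [sub_right_comm x b a] at hseg
  calc _ = |φ.energy x - φ.energy (x - a) - (φ.energy (x - b) - φ.energy (x - a - b))| := by
        congr 1; ring
    _ ≤ 4 * C * D * ‖a‖ * ‖b‖ := hseg
    _ ≤ _ := by
        have : 0 ≤ C * D * ‖a‖ * ‖b‖ := by positivity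
        linarith

end DoubleDifference

end

end IMethod

/-! ### The corrected symbol `σ̃₄` -/

namespace IMethod

noncomputable section

theorem symb_neg {s : ℝ} (φ : Profile s) (N : ℝ) (ξ : Plane) : symb φ N (-ξ) = symb φ N ξ := by
  simp [symb]

/-- `m(ξ)² |ξ|²`. -/
def symbEnergy {s : ℝ} (φ : Profile s) (N : ℝ) (ξ : Plane) : ℝ := symb φ N ξ ^ 2 * ‖ξ‖ ^ 2

theorem symbEnergy_eq {s : ℝ} (φ : Profile s) {N : ℝ} (hN : 0 < N) (ξ : Plane) :
    symbEnergy φ N ξ = N ^ 2 * φ.energy (N⁻¹ • ξ) := by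
  have : ‖N⁻¹ • ξ‖ = ‖ξ‖ / N := by
    rw [norm_smul, norm_inv, Real.norm_of_nonneg hN.le]; field_simp
  rw [symbEnergy, Profile.energy, this, symb]
  field_simp

theorem symbEnergy_of_norm_le {s : ℝ} (φ : Profile s) {N : ℝ} (hN : 0 < N) {ξ : Plane}
    (h : ‖ξ‖ ≤ N) : symbEnergy φ N ξ = ‖ξ‖ ^ 2 := by
  rw [symbEnergy, symb, φ.eq_one _ ((div_le_one hN).2 h)]
  ring

theorem sigmaTwo_of_eq_neg {s : ℝ} (φ : Profile s) (N : ℝ) {ξ : Fin 2 → Plane}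
    (h : ξ 0 = -ξ 1) : sigmaTwo φ N ξ = ((1 / 2 * symbEnergy φ N (ξ 1) : ℝ) : ℂ) := by
  rw [sigmaTwo, h, symb_neg, symbEnergy]
  congr 1
  simp only [smul_neg, inner_neg_left, real_inner_self_eq_norm_sq, norm_smul, mul_pow,
    Real.norm_eq_abs, sq_abs]
  ring

theorem mem_hyper_four {ξ : Fin 4 → Plane} : ξ ∈ hyper 4 ↔ ξ 0 + ξ 1 + ξ 2 + ξ 3 = 0 := by
  simp [hyper, Fin.sum_univ_four]

theorem extendX_sigmaTwo {s : ℝ} (φ : Profile s) (N : ℝ) {ξ : Fin 4 → Plane}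
    (h : ξ ∈ hyper 4) :
    extendX (sigmaTwo φ N) ξ = ((1 / 2 * symbEnergy φ N (ξ 3) : ℝ) : ℂ) := by
  rw [extendX, sigmaTwo_of_eq_neg]
  · rfl
  · rw [mem_hyper_four] at h
    exact eq_neg_of_add_eq_zero_left h

/-- On `Σ₄` the extended symbol depends on the last argument alone. The permutations spread it over
the even positions; the swap spreads it over the odd ones with the opposite sign, since it
conjugates the factor `i`. -/
theorem symmetrize_sigmaTwo {s : ℝ} (φ : Profile s) (N : ℝ) {ξ : Fin 4 → Plane}
    (h : ξ ∈ hyper 4) :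
    symmetrize 2 (fun η => 2 * Complex.I * extendX (sigmaTwo φ N) η) ξ =
      Complex.I * ((1 / 4 * (-symbEnergy φ N (ξ 0) + symbEnergy φ N (ξ 1) - symbEnergy φ N (ξ 2)
        + symbEnergy φ N (ξ 3)) : ℝ) : ℂ) := by
  have hperm : (Finset.univ : Finset (Equiv.Perm (Fin 2))) = {1, Equiv.swap 0 1} := by decide
  rw [mem_hyper_four] at h
  have hs : ∀ η : Fin 4 → Plane, η 0 + η 1 + η 2 + η 3 = 0 →
      extendX (sigmaTwo φ N) η = ((1 / 2 * symbEnergy φ N (η 3) : ℝ) : ℂ) :=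
    fun η hη => extendX_sigmaTwo φ N (mem_hyper_four.2 hη)
  have hne : (1 : Equiv.Perm (Fin 2)) ≠ Equiv.swap 0 1 := by decide
  simp only [symmetrize, hperm, Finset.sum_pair hne]
  rw [hs, hs, hs, hs, hs, hs, hs, hs]
  · have h2 : conj (2 : ℂ) = 2 := map_ofNat _ 2
    simp [interleave, oddArgs, evenArgs, h2]
    ring
  all_goals
    rw [← h]
    simp [interleave, oddArgs, evenArgs]
    try abel

theorem alphaSymb_four (ξ : Fin 4 → Plane) :
    alphaSymb 4 ξ = -‖ξ 0‖ ^ 2 + ‖ξ 1‖ ^ 2 - ‖ξ 2‖ ^ 2 + ‖ξ 3‖ ^ 2 := by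
  simp [alphaSymb, Fin.sum_univ_four]
  ring

/-- The mixed second difference of `|ξ|²` over the parallelogram on which the numerator is the one
of `m²|ξ|²`. The cosine of the angle between its sides is exactly what `Ω_nr` bounds below. -/
theorem alphaSymb_four_eq_inner {ξ : Fin 4 → Plane} (h : ξ ∈ hyper 4) :
    alphaSymb 4 ξ = -2 * inner ℝ (ξ 0 + ξ 1) (ξ 0 + ξ 3) := by
  rw [mem_hyper_four] at h
  have h2 : ξ 2 = -(ξ 0 + ξ 1 + ξ 3) := by
    rw [eq_neg_iff_add_eq_zero, ← h]; abel
  rw [alphaSymb_four, h2, norm_neg]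
  simp only [← real_inner_self_eq_norm_sq, inner_add_left, inner_add_right,
    real_inner_comm (ξ 1) (ξ 0), real_inner_comm (ξ 3) (ξ 0), real_inner_comm (ξ 3) (ξ 1)]
  ring

theorem sigmaFourTilde_of_mem {s : ℝ} (φ : Profile s) {N θ₀ : ℝ} {ξ : Fin 4 → Plane}
    (h : ξ ∈ nonresonant N θ₀) :
    sigmaFourTilde φ N θ₀ ξ = ((1 / 4 * (-symbEnergy φ N (ξ 0) + symbEnergy φ N (ξ 1)
      - symbEnergy φ N (ξ 2) + symbEnergy φ N (ξ 3)) / alphaSymb 4 ξ : ℝ) : ℂ) := by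
  rw [sigmaFourTilde, Set.indicator_of_mem h, symmetrize_sigmaTwo φ N h.1,
    mul_div_mul_left _ _ Complex.I_ne_zero, Complex.ofReal_div]

/-- Here `m = 1`, so the numerator is a multiple of `α₄`. The condition `α₄ ≠ 0` cannot be dropped,
since division by zero returns `0`. -/
theorem sigmaFourTilde_of_norm_le {s : ℝ} (φ : Profile s) {N θ₀ : ℝ} (hN : 0 < N)
    {ξ : Fin 4 → Plane} (h : ξ ∈ hyper 4) (hle : ∀ j, ‖ξ j‖ ≤ N) (hα : alphaSymb 4 ξ ≠ 0) :
    sigmaFourTilde φ N θ₀ ξ = 1 / 4 := by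
  rw [sigmaFourTilde_of_mem φ ⟨h, Or.inl hle⟩]
  simp only [symbEnergy_of_norm_le φ hN (hle _), ← alphaSymb_four]
  rw [mul_div_assoc, div_self hα]
  norm_num

/-- After rescaling by `N`, the points `ξ₁, -ξ₂, -ξ₄, ξ₃` are the vertices of a parallelogram and
the density is even. The decay obtained is in the largest norm, hence in each of the four. -/
theorem symbEnergy_double_difference_le {s : ℝ} (hs : 1 / 2 < s) (hs' : s < 1) (φ : Profile s)
    {C : ℝ} (hC : ∀ r : ℝ, 0 ≤ r → |φ.slope r| ≤ C * (1 + r) ^ (-(2 - 2 * s)) ∧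
      |deriv φ.slope r| * r ≤ C * (1 + r) ^ (-(2 - 2 * s))) {N : ℝ} (hN : 0 < N)
    {ξ : Fin 4 → Plane} (h : ξ ∈ hyper 4) (j : Fin 4) :
    |-symbEnergy φ N (ξ 0) + symbEnergy φ N (ξ 1) - symbEnergy φ N (ξ 2)
        + symbEnergy φ N (ξ 3)| ≤
      16 * C * (1 + ‖ξ j‖ / N) ^ (-(2 - 2 * s)) * ‖ξ 0 + ξ 1‖ * ‖ξ 0 + ξ 3‖ := by
  have hC0 : 0 ≤ C := by
    have := (abs_nonneg _).trans (hC 0 le_rfl).1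
    simpa using this
  obtain ⟨i, -, hi⟩ := Finset.exists_max_image Finset.univ (fun k => ‖ξ k‖) ⟨0, Finset.mem_univ 0⟩
  have hn : ∀ y : Plane, ‖N⁻¹ • y‖ = ‖y‖ / N := fun y => by
    rw [norm_smul, norm_inv, Real.norm_of_nonneg hN.le]; field_simp
  have h4 := mem_hyper_four.1 h
  have e1 : N⁻¹ • ξ 0 - N⁻¹ • (ξ 0 + ξ 1) = -(N⁻¹ • ξ 1) := by module
  have e2 : N⁻¹ • ξ 0 - N⁻¹ • (ξ 0 + ξ 3) = -(N⁻¹ • ξ 3) := by module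
  have e3 : N⁻¹ • ξ 0 - N⁻¹ • (ξ 0 + ξ 1) - N⁻¹ • (ξ 0 + ξ 3) = N⁻¹ • ξ 2 := by
    have : ξ 2 = -(ξ 0 + ξ 1 + ξ 3) := by
      rw [eq_neg_iff_add_eq_zero, ← h4]; abel
    rw [this]; module
  have hb : ∀ k, ‖ξ k‖ / N ≤ ‖ξ i‖ / N := fun k => by
    gcongr; exact hi k (Finset.mem_univ k)
  have key := φ.abs_double_difference_le hs hs' hC (x := N⁻¹ • ξ 0) (a := N⁻¹ • (ξ 0 + ξ 1))
    (b := N⁻¹ • (ξ 0 + ξ 3)) (w := ‖ξ i‖ / N)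
    (by rw [hn]; exact hb 0) (by rw [e1, norm_neg, hn]; exact hb 1)
    (by rw [e2, norm_neg, hn]; exact hb 3) (by rw [e3, hn]; exact hb 2)
    (by
      rw [e3, e2, e1, norm_neg, norm_neg, hn, hn, hn, hn]
      fin_cases i <;> simp)
  have hev : ∀ y : Plane, φ.energy (-y) = φ.energy y := fun y => by simp [Profile.energy]
  rw [e3, e2, e1, hev, hev, hn, hn] at key
  have hmono : (1 + ‖ξ i‖ / N) ^ (-(2 - 2 * s)) ≤ (1 + ‖ξ j‖ / N) ^ (-(2 - 2 * s)) :=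
    Real.rpow_le_rpow_of_nonpos (by positivity) (by linarith [hb j]) (by linarith)
  simp only [symbEnergy_eq φ hN]
  calc _ = N ^ 2 * |φ.energy (N⁻¹ • ξ 0) - φ.energy (N⁻¹ • ξ 1) - φ.energy (N⁻¹ • ξ 3) +
        φ.energy (N⁻¹ • ξ 2)| := by
        rw [← abs_of_nonneg (sq_nonneg N), ← abs_mul, ← abs_neg, abs_of_nonneg (sq_nonneg N)]
        congr 1; ring
    _ ≤ N ^ 2 * (16 * C * (1 + ‖ξ i‖ / N) ^ (-(2 - 2 * s)) * (‖ξ 0 + ξ 1‖ / N) *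
        (‖ξ 0 + ξ 3‖ / N)) := by gcongr
    _ = 16 * C * (1 + ‖ξ i‖ / N) ^ (-(2 - 2 * s)) * ‖ξ 0 + ξ 1‖ * ‖ξ 0 + ξ 3‖ := by
        field_simp
    _ ≤ _ := by gcongr

/-- The pointwise bound for the corrected symbol. -/
theorem exists_sigmaFourTilde_bound {s : ℝ} (hs : 1 / 2 < s) (hs' : s < 1) (φ : Profile s) :
    ∃ C : ℝ, 0 < C ∧ ∀ N : ℝ, 0 < N → ∀ θ₀ : ℝ, 0 < θ₀ → θ₀ < 1 → ∀ ξ ∈ hyper 4, ∀ j : Fin 4,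
      ‖sigmaFourTilde φ N θ₀ ξ‖ ≤ C * θ₀⁻¹ * (1 + ‖ξ j‖ / N) ^ (-(2 - 2 * s)) := by
  obtain ⟨C, hC0, hC⟩ := φ.exists_slope_bound hs hs'
  refine ⟨2 * C + 1, by positivity, fun N hN θ₀ hθ hθ1 ξ hξ j => ?_⟩
  have hr : 0 ≤ (1 + ‖ξ j‖ / N) ^ (-(2 - 2 * s)) := Real.rpow_nonneg (by positivity) _
  by_cases hm : ξ ∈ nonresonant N θ₀
  swap
  · rw [sigmaFourTilde, Set.indicator_of_notMem hm, norm_zero]; positivity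
  by_cases hα : alphaSymb 4 ξ = 0
  · rw [sigmaFourTilde_of_mem φ hm, hα]; simp; positivity
  rcases hm.2 with hle | hang
  · rw [sigmaFourTilde_of_norm_le φ hN hξ hle hα]
    have h1 : (1 / 2 : ℝ) ≤ (1 + ‖ξ j‖ / N) ^ (-(2 - 2 * s)) := by
      calc (1 / 2 : ℝ) = 2 ^ (-1 : ℝ) := by norm_num [Real.rpow_neg_one]
        _ ≤ 2 ^ (-(2 - 2 * s)) :=
          Real.rpow_le_rpow_of_exponent_le (by norm_num) (by linarith)
        _ ≤ _ := by
          refine Real.rpow_le_rpow_of_nonpos (by positivity) ?_ (by linarith)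
          have := (div_le_one hN).2 (hle j)
          linarith
    have h2 : 1 ≤ θ₀⁻¹ := (one_le_inv₀ hθ).2 hθ1.le
    have h3 : 1 ≤ (2 * C + 1) * θ₀⁻¹ := by nlinarith
    calc ‖(1 / 4 : ℂ)‖ = 1 / 4 := by norm_num
      _ ≤ 1 * (1 / 2) := by norm_num
      _ ≤ _ := by gcongr
  · rw [sigmaFourTilde_of_mem φ hm, Complex.norm_real, Real.norm_eq_abs, abs_div, abs_mul]
    have hαabs : |alphaSymb 4 ξ| =
        2 * (|Real.cos (InnerProductGeometry.angle (ξ 0 + ξ 1) (ξ 0 + ξ 3))| *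
          (‖ξ 0 + ξ 1‖ * ‖ξ 0 + ξ 3‖)) := by
      rw [alphaSymb_four_eq_inner hξ, ← InnerProductGeometry.cos_angle_mul_norm_mul_norm]
      simp [abs_mul]
    -- The side lengths here cancel those in the bound for the numerator, leaving only `θ₀⁻¹`.
    have hlow : 2 * θ₀ * (‖ξ 0 + ξ 1‖ * ‖ξ 0 + ξ 3‖) ≤ |alphaSymb 4 ξ| := by
      rw [hαabs, mul_assoc]; gcongr
    have hd := symbEnergy_double_difference_le hs hs' φ hC hN hξ j
    rw [div_le_iff₀ (abs_pos.2 hα), abs_of_pos (by norm_num : (0 : ℝ) < 1 / 4)]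
    set D := (1 + ‖ξ j‖ / N) ^ (-(2 - 2 * s))
    calc _ ≤ 1 / 4 * (16 * C * D * ‖ξ 0 + ξ 1‖ * ‖ξ 0 + ξ 3‖) := by gcongr
      _ = 2 * C * θ₀⁻¹ * D * (2 * θ₀ * (‖ξ 0 + ξ 1‖ * ‖ξ 0 + ξ 3‖)) := by
        field_simp; ring
      _ ≤ (2 * C + 1) * θ₀⁻¹ * D * |alphaSymb 4 ξ| := by gcongr; linarith

end

end IMethod

namespace IMethod

noncomputable section

/-! ### The measure on the hyperplane -/

/-- The linear parametrization of the hyperplane by its first `n` coordinates. -/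
def hyperMap (n : ℕ) : (Fin n → Plane) →ₗ[ℝ] (Fin (n + 1) → Plane) where
  toFun ξ := Fin.snoc (α := fun _ => Plane) ξ (-∑ j, ξ j)
  map_add' ξ η := by
    ext1 i
    refine Fin.lastCases ?_ (fun j => ?_) i
    · simp [Finset.sum_add_distrib, add_comm]
    · simp
  map_smul' c ξ := by
    ext1 i
    refine Fin.lastCases ?_ (fun j => ?_) i
    · simp [Finset.smul_sum]
    · simp

theorem measurable_hyperMap (n : ℕ) : Measurable (hyperMap n) :=
  (hyperMap n).continuous_of_finiteDimensional.measurable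

theorem hyperMeasure_eq (n : ℕ) : hyperMeasure n = Measure.map (hyperMap n) volume := rfl

@[simp] theorem hyperMap_castSucc {n : ℕ} (ξ : Fin n → Plane) (j : Fin n) :
    hyperMap n ξ j.castSucc = ξ j := by
  simp [hyperMap]

@[simp] theorem hyperMap_last {n : ℕ} (ξ : Fin n → Plane) :
    hyperMap n ξ (Fin.last n) = -∑ j, ξ j := by
  simp [hyperMap]

theorem hyperMap_mem (n : ℕ) (ξ : Fin n → Plane) : hyperMap n ξ ∈ hyper (n + 1) := by
  simp [hyper, Fin.sum_univ_castSucc]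

theorem hyperMap_restrict {n : ℕ} {ξ : Fin (n + 1) → Plane} (h : ξ ∈ hyper (n + 1)) :
    hyperMap n (fun j => ξ j.castSucc) = ξ := by
  ext1 i
  refine Fin.lastCases ?_ (fun j => ?_) i
  · rw [hyperMap_last]
    have : ∑ j, ξ j = 0 := h
    rw [Fin.sum_univ_castSucc] at this
    exact (eq_neg_of_add_eq_zero_right this).symm
  · simp

theorem comp_perm_mem_hyper {n : ℕ} {ξ : Fin n → Plane} (h : ξ ∈ hyper n)
    (e : Equiv.Perm (Fin n)) : ξ ∘ e ∈ hyper n := by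
  have : ∑ j, ξ (e j) = ∑ j, ξ j := Equiv.sum_comp e ξ
  exact this.trans h

theorem measurableSet_hyper (n : ℕ) : MeasurableSet (hyper n) := by
  have : Continuous fun ξ : Fin n → Plane => ∑ j, ξ j := by fun_prop
  exact (isClosed_singleton.preimage this : IsClosed (hyper n)).measurableSet

theorem ae_mem_hyper (n : ℕ) : ∀ᵐ ξ ∂hyperMeasure n, ξ ∈ hyper (n + 1) := by
  rw [hyperMeasure_eq]
  exact (ae_map_iff (p := fun ξ => ξ ∈ hyper (n + 1)) (measurable_hyperMap n).aemeasurable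
    (measurableSet_hyper _)).2 (Filter.Eventually.of_forall (hyperMap_mem n))

/-- A permutation of the coordinates of the hyperplane, read in the first `n` coordinates. -/
def hyperPerm (n : ℕ) (e : Equiv.Perm (Fin (n + 1))) : (Fin n → Plane) →ₗ[ℝ] (Fin n → Plane) where
  toFun ξ := fun j => hyperMap n ξ (e j.castSucc)
  map_add' ξ η := by ext1 j; simp
  map_smul' c ξ := by ext1 j; simp

theorem hyperMap_hyperPerm {n : ℕ} (e : Equiv.Perm (Fin (n + 1))) (ξ : Fin n → Plane) :
    hyperMap n (hyperPerm n e ξ) = hyperMap n ξ ∘ e :=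
  hyperMap_restrict (comp_perm_mem_hyper (hyperMap_mem n ξ) e)

theorem hyperPerm_pow {n : ℕ} (e : Equiv.Perm (Fin (n + 1))) (k : ℕ) :
    hyperPerm n e ^ k = hyperPerm n (e ^ k) := by
  induction k with
  | zero =>
    ext1 ξ
    · ext1 j
      simp [hyperPerm]
  | succ k ih =>
    rw [pow_succ, ih]
    refine LinearMap.ext fun ξ => ?_
    ext1 j
    rw [Module.End.mul_apply]
    change hyperMap n (hyperPerm n e ξ) _ = hyperMap n ξ _
    rw [hyperMap_hyperPerm, pow_succ']
    rfl

/-- In the first `n` coordinates a permutation acts linearly but not by a permutation matrix; it has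
finite order, however, so its determinant is a real root of unity. Hence the measure on the
hyperplane does not depend on which coordinate is eliminated. -/
theorem abs_det_hyperPerm {n : ℕ} (e : Equiv.Perm (Fin (n + 1))) :
    |LinearMap.det (hyperPerm n e)| = 1 := by
  have h1 : hyperPerm n e ^ orderOf e = 1 := by
    rw [hyperPerm_pow, pow_orderOf_eq_one]
    exact (hyperPerm_pow e 0).symm ▸ pow_zero _
  have h2 := congrArg LinearMap.det h1
  rw [map_pow, map_one] at h2
  have h3 := congrArg abs h2
  rw [abs_pow, abs_one] at h3
  exact (pow_eq_one_iff_of_nonneg (abs_nonneg _) (orderOf_pos e).ne').1 h3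

theorem measurePreserving_comp_perm {n : ℕ} (e : Equiv.Perm (Fin (n + 1))) :
    MeasurePreserving (fun ξ : Fin (n + 1) → Plane => ξ ∘ e) (hyperMeasure n) (hyperMeasure n) := by
  have hm : Measurable fun ξ : Fin (n + 1) → Plane => ξ ∘ e :=
    measurable_pi_lambda _ fun j => measurable_pi_apply _
  refine ⟨hm, ?_⟩
  rw [hyperMeasure_eq, Measure.map_map hm (measurable_hyperMap n)]
  have hfun : (fun ξ : Fin (n + 1) → Plane => ξ ∘ e) ∘ hyperMap n =
      hyperMap n ∘ hyperPerm n e := by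
    funext ξ
    exact (hyperMap_hyperPerm e ξ).symm
  have hdet := abs_det_hyperPerm e
  have hdet0 : LinearMap.det (hyperPerm n e) ≠ 0 := fun h => by simp [h] at hdet
  rw [hfun, ← Measure.map_map (measurable_hyperMap n)
    (hyperPerm n e).continuous_of_finiteDimensional.measurable,
    Measure.map_linearMap_addHaar_eq_smul_addHaar _ hdet0, abs_inv, hdet]
  simp

theorem lintegral_hyperMeasure {n : ℕ} {f : (Fin (n + 1) → Plane) → ℝ≥0∞} (hf : Measurable f) :
    ∫⁻ ξ, f ξ ∂hyperMeasure n = ∫⁻ ξ, f (hyperMap n ξ) := by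
  rw [hyperMeasure_eq, lintegral_map hf (measurable_hyperMap n)]

theorem lintegral_comp_perm {n : ℕ} (e : Equiv.Perm (Fin (n + 1)))
    {f : (Fin (n + 1) → Plane) → ℝ≥0∞} (hf : Measurable f) :
    ∫⁻ ξ, f (ξ ∘ e) ∂hyperMeasure n = ∫⁻ ξ, f ξ ∂hyperMeasure n :=
  (measurePreserving_comp_perm e).lintegral_comp hf

/-- Transforms of `L²` functions are known only almost everywhere on the plane; this transports such
identities to each argument on the hyperplane. It requires at least one free coordinate; the first
coordinate is free, and a transposition reduces the others to it. -/
theorem quasiMeasurePreserving_eval {n : ℕ} (j : Fin (n + 2)) :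
    Measure.QuasiMeasurePreserving (fun ξ : Fin (n + 2) → Plane => ξ j) (hyperMeasure (n + 1))
      volume := by
  have h0 : Measure.QuasiMeasurePreserving (fun ξ : Fin (n + 2) → Plane => ξ 0)
      (hyperMeasure (n + 1)) volume := by
    refine ⟨measurable_pi_apply _, ?_⟩
    rw [hyperMeasure_eq, Measure.map_map (measurable_pi_apply _) (measurable_hyperMap _)]
    have : (fun ξ : Fin (n + 2) → Plane => ξ 0) ∘ hyperMap (n + 1) = Function.eval 0 := by
      funext ξ
      exact hyperMap_castSucc ξ 0
    rw [this]
    exact (Measure.quasiMeasurePreserving_eval (fun _ : Fin (n + 1) => (volume : Measure Plane))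
      0).absolutelyContinuous
  have := h0.comp (measurePreserving_comp_perm (Equiv.swap 0 j)).quasiMeasurePreserving
  convert this using 1
  funext ξ
  simp

instance (n : ℕ) : SFinite (hyperMeasure n) := by
  rw [hyperMeasure_eq]; infer_instance

/-- Iterated integration over a pi type of planes. -/
theorem lintegral_fin_succ {n : ℕ} {f : (Fin (n + 1) → Plane) → ℝ≥0∞} (hf : Measurable f) :
    ∫⁻ ξ, f ξ = ∫⁻ x : Plane, ∫⁻ ξ : Fin n → Plane, f (Fin.cons (α := fun _ => Plane) x ξ) := by
  have h := (volume_preserving_piFinSuccAbove (fun _ : Fin (n + 1) => Plane) 0).symm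
  rw [← h.lintegral_comp hf, Measure.volume_eq_prod, lintegral_prod]
  · refine lintegral_congr fun x => lintegral_congr fun ξ => ?_
    congr 1
    exact Fin.insertNth_zero' x ξ
  · exact (hf.comp (MeasurableEquiv.measurable _)).aemeasurable

theorem lintegral_fin_zero (f : (Fin 0 → Plane) → ℝ≥0∞) : ∫⁻ ξ, f ξ = f ![] := by
  have : (volume : Measure (Fin 0 → Plane)) = Measure.dirac ![] :=
    Measure.volume_pi_eq_dirac _
  rw [this, lintegral_dirac]

theorem lintegral_hyperMeasure_five {f : (Fin 6 → Plane) → ℝ≥0∞} (hf : Measurable f) :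
    ∫⁻ ξ, f ξ ∂hyperMeasure 5 = ∫⁻ a : Plane, ∫⁻ b : Plane, ∫⁻ c : Plane, ∫⁻ d : Plane,
      ∫⁻ e : Plane, f ![a, b, c, d, e, -(a + b + c + d + e)] := by
  rw [lintegral_hyperMeasure hf]
  have hcons : ∀ {n : ℕ} (x : Plane),
      Measurable fun ξ : Fin n → Plane => Fin.cons (α := fun _ => Plane) x ξ := fun {n} x =>
    measurable_pi_lambda _ fun i => Fin.cases (by simp) (fun j => by simp; fun_prop) i
  have hfm : Measurable fun ξ => f (hyperMap 5 ξ) := hf.comp (measurable_hyperMap 5)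
  rw [lintegral_fin_succ hfm]
  refine lintegral_congr fun a => ?_
  have h1 := hfm.comp (hcons a)
  refine (lintegral_fin_succ h1).trans ?_
  refine lintegral_congr fun b => ?_
  have h2 := h1.comp (hcons b)
  refine (lintegral_fin_succ h2).trans ?_
  refine lintegral_congr fun c => ?_
  have h3 := h2.comp (hcons c)
  refine (lintegral_fin_succ h3).trans ?_
  refine lintegral_congr fun d => ?_
  have h4 := h3.comp (hcons d)
  refine (lintegral_fin_succ h4).trans ?_
  refine lintegral_congr fun e => ?_
  rw [lintegral_fin_zero]
  change f _ = f _
  congr 1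
  ext1 i
  refine Fin.lastCases ?_ (fun j => ?_) i
  · rw [hyperMap_last]
    simp [Fin.sum_univ_five]
  · rw [hyperMap_castSucc]
    fin_cases j <;> rfl

end

end IMethod

namespace IMethod

noncomputable section

/-! ### Symmetrized symbols -/

theorem exists_perm_interleave {n : ℕ} (π ρ : Equiv.Perm (Fin n)) :
    ∃ e : Equiv.Perm (Fin (2 * n)), ∀ ξ : Fin (2 * n) → Plane,
      interleave (oddArgs ξ ∘ π) (evenArgs ξ ∘ ρ) = ξ ∘ e := by
  let g : Fin (2 * n) → Fin (2 * n) := fun i =>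
    if (i : ℕ) % 2 = 0 then ⟨2 * π ⟨i / 2, by omega⟩, by omega⟩
    else ⟨2 * ρ ⟨i / 2, by omega⟩ + 1, by omega⟩
  have hg : Function.Injective g := by
    intro i j hij
    have key : ∀ (τ : Equiv.Perm (Fin n)) (a b : Fin n), (τ a : ℕ) = τ b → (a : ℕ) = b :=
      fun τ a b h => congrArg Fin.val (τ.injective (Fin.ext h))
    rcases Nat.mod_two_eq_zero_or_one i with hi | hi <;>
    rcases Nat.mod_two_eq_zero_or_one j with hj | hj <;>
    simp only [g, hi, hj, if_true, one_ne_zero, if_false, Fin.mk.injEq] at hij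
    · have := key π ⟨i / 2, by omega⟩ ⟨j / 2, by omega⟩ (by omega)
      simp only at this
      omega
    · omega
    · omega
    · have := key ρ ⟨i / 2, by omega⟩ ⟨j / 2, by omega⟩ (by omega)
      simp only at this
      omega
  refine ⟨Equiv.ofBijective g (Finite.injective_iff_bijective.1 hg), fun ξ => ?_⟩
  funext i
  simp only [interleave, oddArgs, evenArgs, Function.comp_apply, Equiv.ofBijective_apply, g]
  split_ifs <;> rfl

/-- The exchange of the odd and the even positions. -/
theorem exists_perm_swap {n : ℕ} :
    ∃ e : Equiv.Perm (Fin (2 * n)), ∀ ξ : Fin (2 * n) → Plane,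
      oddArgs (ξ ∘ e) = evenArgs ξ ∧ evenArgs (ξ ∘ e) = oddArgs ξ := by
  let g : Fin (2 * n) → Fin (2 * n) := fun i =>
    if h : (i : ℕ) % 2 = 0 then ⟨i + 1, by omega⟩ else ⟨i - 1, by omega⟩
  have hg : Function.Involutive g := by
    intro i
    ext
    rcases Nat.mod_two_eq_zero_or_one i with hi | hi
    · have h1 : ((i : ℕ) + 1) % 2 ≠ 0 := by omega
      simp [g, hi, h1]
    · have h1 : ((i : ℕ) - 1) % 2 = 0 := by omega
      simp [g, hi, h1]
      omega
  refine ⟨hg.toPerm, fun ξ => ⟨?_, ?_⟩⟩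
  · funext j
    simp [oddArgs, evenArgs, g]
  · funext j
    simp [oddArgs, evenArgs, g]

theorem exists_perm_interleave_swap {n : ℕ} (π ρ : Equiv.Perm (Fin n)) :
    ∃ e : Equiv.Perm (Fin (2 * n)), ∀ ξ : Fin (2 * n) → Plane,
      interleave (evenArgs ξ ∘ ρ) (oddArgs ξ ∘ π) = ξ ∘ e := by
  obtain ⟨e₁, h₁⟩ := exists_perm_swap (n := n)
  obtain ⟨e₂, h₂⟩ := exists_perm_interleave ρ π
  refine ⟨e₂.trans e₁, fun ξ => ?_⟩
  rw [← (h₁ ξ).1, ← (h₁ ξ).2, h₂]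
  rfl

/-- An average of `2 (n!)²` values of `M` and conjugates of values, all taken at permutations of
`ξ`. Bounding over all permutations, not only those in the group, is wasteful but simpler. -/
theorem norm_symmetrize_le {n : ℕ} {M : Symbol (2 * n)} {ξ : Fin (2 * n) → Plane} {B : ℝ}
    (h : ∀ e : Equiv.Perm (Fin (2 * n)), ‖M (ξ ∘ e)‖ ≤ B) : ‖symmetrize n M ξ‖ ≤ B := by
  have hterm : ∀ π ρ : Equiv.Perm (Fin n), ‖M (interleave (oddArgs ξ ∘ π) (evenArgs ξ ∘ ρ)) +
      conj (M (interleave (evenArgs ξ ∘ ρ) (oddArgs ξ ∘ π)))‖ ≤ 2 * B := by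
    intro π ρ
    obtain ⟨e₁, h₁⟩ := exists_perm_interleave π ρ
    obtain ⟨e₂, h₂⟩ := exists_perm_interleave_swap π ρ
    rw [h₁, h₂]
    refine (norm_add_le _ _).trans ?_
    rw [RCLike.norm_conj]
    linarith [h e₁, h e₂]
  have hcard : (Finset.univ : Finset (Equiv.Perm (Fin n))).card = n.factorial := by
    rw [Finset.card_univ, Fintype.card_perm, Fintype.card_fin]
  have hsum : ‖∑ π : Equiv.Perm (Fin n), ∑ ρ : Equiv.Perm (Fin n),
      (M (interleave (oddArgs ξ ∘ π) (evenArgs ξ ∘ ρ)) +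
        conj (M (interleave (evenArgs ξ ∘ ρ) (oddArgs ξ ∘ π))))‖ ≤
      n.factorial * (n.factorial * (2 * B)) := by
    refine (norm_sum_le_of_le _ fun π _ => norm_sum_le_of_le _ fun ρ _ => hterm π ρ).trans ?_
    simp [Finset.sum_const, hcard]
  rw [symmetrize, norm_mul]
  have hf : (0 : ℝ) < n.factorial := by exact_mod_cast n.factorial_pos
  calc _ ≤ ‖1 / (2 * (n.factorial : ℂ) ^ 2)‖ * (n.factorial * (n.factorial * (2 * B))) := by
        gcongr
    _ = B := by
        simp
        field_simp

/-- Half of the group conjugates, so a purely imaginary constant averages to zero. This is the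
low-frequency cancellation. -/
theorem symmetrize_eq_zero {n : ℕ} {M : Symbol (2 * n)} {ξ : Fin (2 * n) → Plane} {c : ℂ}
    (hc : c + conj c = 0) (h : ∀ e : Equiv.Perm (Fin (2 * n)), M (ξ ∘ e) = c) :
    symmetrize n M ξ = 0 := by
  have hterm : ∀ π ρ : Equiv.Perm (Fin n), M (interleave (oddArgs ξ ∘ π) (evenArgs ξ ∘ ρ)) +
      conj (M (interleave (evenArgs ξ ∘ ρ) (oddArgs ξ ∘ π))) = 0 := by
    intro π ρ
    obtain ⟨e₁, h₁⟩ := exists_perm_interleave π ρ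
    obtain ⟨e₂, h₂⟩ := exists_perm_interleave_swap π ρ
    rw [h₁, h₂, h, h, hc]
  simp [symmetrize, hterm]

theorem measurable_symmetrize {n : ℕ} {M : Symbol (2 * n)} (hM : Measurable M) :
    Measurable (symmetrize n M) := by
  have hp : ∀ e : Equiv.Perm (Fin (2 * n)), Measurable fun ξ : Fin (2 * n) → Plane => ξ ∘ e :=
    fun e => measurable_pi_lambda _ fun j => measurable_pi_apply _
  unfold symmetrize
  refine Measurable.const_mul (Finset.measurable_sum _ fun π _ => Finset.measurable_sum _
    fun ρ _ => ?_) _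
  obtain ⟨e₁, h₁⟩ := exists_perm_interleave π ρ
  obtain ⟨e₂, h₂⟩ := exists_perm_interleave_swap π ρ
  simp only [h₁, h₂]
  exact (hM.comp (hp e₁)).add (Complex.continuous_conj.measurable.comp (hM.comp (hp e₂)))

theorem measurable_symb {s : ℝ} (φ : Profile s) (N : ℝ) : Measurable (symb φ N) := by
  have := φ.smooth.continuous
  unfold symb
  exact (this.comp (continuous_norm.div_const N)).measurable

theorem measurable_extendX {k : ℕ} {M : Symbol k} (hM : Measurable M) :
    Measurable (extendX M) := by
  refine hM.comp (measurable_pi_lambda _ fun j => ?_)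
  split_ifs <;> fun_prop

theorem measurable_sigmaTwo {s : ℝ} (φ : Profile s) (N : ℝ) : Measurable (sigmaTwo φ N) := by
  have := measurable_symb φ N
  unfold sigmaTwo
  fun_prop

theorem measurableSet_nonresonant (N θ₀ : ℝ) : MeasurableSet (nonresonant N θ₀) := by
  have h1 : MeasurableSet {ξ : Fin 4 → Plane | ∀ j, ‖ξ j‖ ≤ N} := by
    rw [Set.ofPred_forall]
    exact MeasurableSet.iInter fun j => measurableSet_le (by fun_prop) measurable_const
  have h2 : MeasurableSet {ξ : Fin 4 → Plane |
      θ₀ ≤ |Real.cos (InnerProductGeometry.angle (ξ 0 + ξ 1) (ξ 0 + ξ 3))|} := by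
    refine measurableSet_le measurable_const ?_
    unfold InnerProductGeometry.angle
    have := Real.measurable_arccos
    simp only [← Real.norm_eq_abs]
    fun_prop
  exact (measurableSet_hyper 4).inter (h1.union h2)

theorem measurable_alphaSymb (k : ℕ) : Measurable (alphaSymb k) := by
  unfold alphaSymb
  fun_prop

theorem measurable_sigmaFourTilde {s : ℝ} (φ : Profile s) (N θ₀ : ℝ) :
    Measurable (sigmaFourTilde φ N θ₀) := by
  have h1 : Measurable (symmetrize 2 fun η => 2 * Complex.I * extendX (sigmaTwo φ N) η) :=
    measurable_symmetrize ((measurable_extendX (measurable_sigmaTwo φ N)).const_mul _)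
  refine Measurable.indicator (h1.div ?_) (measurableSet_nonresonant N θ₀)
  exact (Complex.measurable_ofReal.comp (measurable_alphaSymb 4)).const_mul _

theorem measurable_sextilinearSymbol {s : ℝ} (φ : Profile s) (N θ₀ : ℝ) :
    Measurable (sextilinearSymbol φ N θ₀) :=
  measurable_symmetrize ((measurable_extendX (measurable_sigmaFourTilde φ N θ₀)).const_mul _)

/-! ### Bounds for the six-linear symbol -/

/-- The contracted tuple `(ξ₁ + ξ₂ + ξ₃, ξ₄, ξ₅, ξ₆)`. -/
def contract (ξ : Fin 6 → Plane) : Fin 4 → Plane := ![ξ 0 + ξ 1 + ξ 2, ξ 3, ξ 4, ξ 5]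

theorem extendX_eq_contract (M : Symbol 4) (ξ : Fin 6 → Plane) :
    extendX M ξ = M (contract ξ) := by
  unfold extendX contract
  congr 1
  funext j
  fin_cases j <;> rfl

theorem contract_mem {ξ : Fin 6 → Plane} (h : ξ ∈ hyper 6) : contract ξ ∈ hyper 4 := by
  have h' : ∑ j, ξ j = 0 := h
  rw [mem_hyper_four, ← h', Fin.sum_univ_six]
  rfl

theorem measurable_contract : Measurable contract := by
  refine measurable_pi_lambda _ fun j => ?_
  fin_cases j <;> simp [contract] <;> fun_prop

theorem alphaSymb_contract {ξ : Fin 6 → Plane} (h : ξ ∈ hyper 6) :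
    alphaSymb 4 (contract ξ) = 2 * inner ℝ (ξ 0 + ξ 1 + ξ 2 + ξ 3) (ξ 3 + ξ 4) := by
  rw [alphaSymb_four_eq_inner (contract_mem h)]
  have h' : ∑ j, ξ j = 0 := h
  rw [Fin.sum_univ_six] at h'
  have e : ξ 0 + ξ 1 + ξ 2 + ξ 5 = -(ξ 3 + ξ 4) := by
    rw [eq_neg_iff_add_eq_zero, ← h']; abel
  simp only [contract, Matrix.cons_val_zero, Matrix.cons_val_one, Matrix.cons_val]
  rw [e, inner_neg_right]
  ring

/-- The resonance function of the contracted tuple vanishes on a null set only. -/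
theorem ae_alphaSymb_contract_ne_zero :
    ∀ᵐ ξ ∂hyperMeasure 5, alphaSymb 4 (contract ξ) ≠ 0 := by
  have hmS : MeasurableSet {ξ : Fin 6 → Plane | alphaSymb 4 (contract ξ) = 0} :=
    measurableSet_eq_fun ((measurable_alphaSymb 4).comp measurable_contract) measurable_const
  rw [ae_iff]
  simp only [ne_eq, not_not]
  rw [← lintegral_indicator_one hmS, lintegral_hyperMeasure_five (measurable_one.indicator hmS)]
  have hinner : ∀ a b c d : Plane, a + b + c + d ≠ 0 →
      ∫⁻ e : Plane, {ξ : Fin 6 → Plane | alphaSymb 4 (contract ξ) = 0}.indicator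
        (1 : (Fin 6 → Plane) → ℝ≥0∞) ![a, b, c, d, e, -(a + b + c + d + e)] = 0 := by
    intro a b c d hne
    rw [lintegral_eq_zero_iff]
    swap
    · refine (measurable_one.indicator hmS).comp (measurable_pi_lambda _ fun j => ?_)
      fin_cases j <;> simp <;> fun_prop
    -- For fixed `a, b, c, d` with nonzero sum, the zero set in `e` is an affine line.
    have hnull : volume {e : Plane | inner ℝ (a + b + c + d) (d + e) = 0} = 0 := by
      generalize a + b + c + d = v at hne
      let S : AffineSubspace ℝ Plane := AffineSubspace.mk' (-d) (LinearMap.ker (innerₗ Plane v))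
      have hS : (S : Set Plane) = {e : Plane | inner ℝ v (d + e) = 0} := by
        ext e
        simp [S, AffineSubspace.mem_mk', add_comm]
      rw [← hS]
      refine Measure.addHaar_affineSubspace _ _ fun htop => hne ?_
      have : v - d ∈ S := htop ▸ AffineSubspace.mem_top ℝ Plane _
      rw [← SetLike.mem_coe, hS, Set.mem_ofPred_eq, add_sub_cancel] at this
      exact inner_self_eq_zero.1 this
    rw [Filter.eventuallyEq_iff_exists_mem]
    refine ⟨_, compl_mem_ae_iff.2 hnull, fun e he => ?_⟩
    refine Set.indicator_of_notMem (fun hmem => he ?_) _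
    have hh : ![a, b, c, d, e, -(a + b + c + d + e)] ∈ hyper 6 := by
      simp [hyper, Fin.sum_univ_six]
    rw [Set.mem_ofPred_eq, alphaSymb_contract hh] at hmem
    simpa using hmem
  have hz : ∀ a b c : Plane, ∫⁻ d : Plane, ∫⁻ e : Plane,
      {ξ : Fin 6 → Plane | alphaSymb 4 (contract ξ) = 0}.indicator
        (1 : (Fin 6 → Plane) → ℝ≥0∞) ![a, b, c, d, e, -(a + b + c + d + e)] = 0 := by
    intro a b c
    have : ∀ᵐ d : Plane, d ≠ -(a + b + c) := by simp [ae_iff]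
    rw [lintegral_congr_ae (g := fun _ => 0), lintegral_zero]
    filter_upwards [this] with d hd
    refine hinner a b c d fun h => hd ?_
    rw [eq_neg_iff_add_eq_zero, ← h]; abel
  simp only [hz, lintegral_zero]

/-- The six-linear symbol is dominated by sums of permuted contracted symbols. -/
theorem norm_sextilinearSymbol_le {s : ℝ} (φ : Profile s) (N θ₀ : ℝ) (ξ : Fin 6 → Plane) :
    ‖sextilinearSymbol φ N θ₀ ξ‖ ≤
      ∑ e : Equiv.Perm (Fin 6), 4 * ‖sigmaFourTilde φ N θ₀ (contract (ξ ∘ e))‖ := by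
  refine norm_symmetrize_le (n := 3) fun e => ?_
  have := Finset.single_le_sum (f := fun e : Equiv.Perm (Fin 6) =>
    4 * ‖sigmaFourTilde φ N θ₀ (contract (ξ ∘ e))‖) (fun i _ => by positivity)
    (Finset.mem_univ e)
  refine le_trans (le_of_eq ?_) this
  rw [norm_mul, norm_mul, Complex.norm_I, extendX_eq_contract]
  simp

theorem norm_sextilinearSymbol_le_of_forall {s : ℝ} (φ : Profile s) {N θ₀ B : ℝ}
    {ξ : Fin 6 → Plane}
    (h : ∀ e : Equiv.Perm (Fin 6), ‖sigmaFourTilde φ N θ₀ (contract (ξ ∘ e))‖ ≤ B) :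
    ‖sextilinearSymbol φ N θ₀ ξ‖ ≤ 4 * B := by
  refine norm_symmetrize_le (n := 3) fun e => ?_
  rw [norm_mul, norm_mul, Complex.norm_I, extendX_eq_contract]
  simpa using h e

/-- The six-linear symbol vanishes almost everywhere at low frequencies. -/
theorem ae_sextilinearSymbol_eq_zero {s : ℝ} (φ : Profile s) {N : ℝ} (θ₀ : ℝ) (hN : 0 < N) :
    ∀ᵐ ξ ∂hyperMeasure 5, (∀ j, ‖ξ j‖ ≤ N / 3) → sextilinearSymbol φ N θ₀ ξ = 0 := by
  have hall : ∀ᵐ ξ ∂hyperMeasure 5, ∀ e : Equiv.Perm (Fin 6),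
      alphaSymb 4 (contract (ξ ∘ e)) ≠ 0 :=
    ae_all_iff.2 fun e => (measurePreserving_comp_perm e).quasiMeasurePreserving.ae
      ae_alphaSymb_contract_ne_zero
  filter_upwards [hall, ae_mem_hyper 5] with ξ hξ hmem hle
  -- The constant is `4i·(1/4) = i`. The threshold `N/3` ensures that the contracted frequency, a
  -- sum of three, is at most `N`.
  refine symmetrize_eq_zero (n := 3) (c := Complex.I) (by simp) fun e => ?_
  rw [extendX_eq_contract, sigmaFourTilde_of_norm_le φ hN
    (contract_mem (comp_perm_mem_hyper hmem e)) ?_ (hξ e)]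
  · ring
  · intro j
    have hb : ∀ k, ‖(ξ ∘ e) k‖ ≤ N / 3 := fun k => hle _
    fin_cases j
    · refine (norm_add₃_le).trans ?_
      linarith [hb 0, hb 1, hb 2]
    · exact (hb 3).trans (by linarith)
    · exact (hb 4).trans (by linarith)
    · exact (hb 5).trans (by linarith)

end

end IMethod

namespace IMethod

noncomputable section

/-! ### One-dimensional integrals -/

/-- The kernel `1 / (1 + |x|)`, which dominates the Fourier transform of a time interval. -/
def kern (x : ℝ) : ℝ := (1 + |x|)⁻¹

theorem kern_nonneg (x : ℝ) : 0 ≤ kern x := by unfold kern; positivity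

theorem kern_neg (x : ℝ) : kern (-x) = kern x := by simp [kern]

theorem continuous_kern : Continuous kern := by
  unfold kern
  exact (continuous_const.add continuous_abs).inv₀ fun x =>
    ne_of_gt (by positivity : (0 : ℝ) < 1 + |x|)

/-- For `B < 0` the quadratic factors as `2(z - a)(z + a)`, and its modulus is at least twice the
squared distance to the nearer root. The integral is therefore bounded uniformly in `B`. -/
theorem kern_sq_add_le (B : ℝ) : ∃ a : ℝ, ∀ z : ℝ,
    kern (2 * z ^ 2 + B) ≤ (1 + (z - a) ^ 2)⁻¹ + (1 + (z + a) ^ 2)⁻¹ := by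
  rcases le_or_gt 0 B with hB | hB
  · refine ⟨0, fun z => ?_⟩
    have h1 : kern (2 * z ^ 2 + B) ≤ (1 + (z - 0) ^ 2)⁻¹ := by
      unfold kern
      rw [abs_of_nonneg (by positivity), sub_zero]
      exact inv_anti₀ (by positivity) (by nlinarith [sq_nonneg z])
    have h2 : 0 ≤ (1 + (z + 0) ^ 2)⁻¹ := by positivity
    linarith
  · obtain ⟨a, ha0, ha⟩ : ∃ a : ℝ, 0 ≤ a ∧ B = -(2 * a ^ 2) :=
      ⟨√(-B / 2), Real.sqrt_nonneg _, by rw [Real.sq_sqrt (by linarith)]; ring⟩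
    refine ⟨a, fun z => ?_⟩
    have hk : 2 * z ^ 2 + B = 2 * ((z - a) * (z + a)) := by rw [ha]; ring
    have p1 : 0 ≤ (1 + (z - a) ^ 2)⁻¹ := by positivity
    have p2 : 0 ≤ (1 + (z + a) ^ 2)⁻¹ := by positivity
    have habs : |2 * ((z - a) * (z + a))| = 2 * (|z - a| * |z + a|) := by
      rw [abs_mul, abs_mul, abs_of_pos (by norm_num : (0 : ℝ) < 2)]
    rcases le_total 0 z with hz | hz
    · have h1 : kern (2 * z ^ 2 + B) ≤ (1 + (z - a) ^ 2)⁻¹ := by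
        unfold kern
        refine inv_anti₀ (by positivity) ?_
        have h3 : |z - a| ≤ |z + a| := by
          rw [abs_of_nonneg (by linarith : 0 ≤ z + a)]
          exact abs_le.2 ⟨by linarith, by linarith⟩
        rw [hk, habs, ← sq_abs (z - a)]
        nlinarith [abs_nonneg (z - a), abs_nonneg (z + a)]
      linarith
    · have h1 : kern (2 * z ^ 2 + B) ≤ (1 + (z + a) ^ 2)⁻¹ := by
        unfold kern
        refine inv_anti₀ (by positivity) ?_
        have h3 : |z + a| ≤ |z - a| := by
          rw [abs_of_nonpos (by linarith : z - a ≤ 0)]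
          exact abs_le.2 ⟨by linarith, by linarith⟩
        rw [hk, habs, ← sq_abs (z + a)]
        nlinarith [abs_nonneg (z - a), abs_nonneg (z + a)]
      linarith

theorem lintegral_inv_one_add_sq_shift (a : ℝ) :
    ∫⁻ x : ℝ, ENNReal.ofReal ((1 + (x + a) ^ 2)⁻¹) = ENNReal.ofReal Real.pi := by
  rw [lintegral_add_right_eq_self (fun x : ℝ => ENNReal.ofReal ((1 + x ^ 2)⁻¹)) a,
    ← ofReal_integral_eq_lintegral_ofReal integrable_inv_one_add_sq
      (Filter.Eventually.of_forall fun x => by positivity), integral_univ_inv_one_add_sq]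

theorem lintegral_kern_sq_le (A B : ℝ) :
    ∫⁻ x : ℝ, ENNReal.ofReal (kern (2 * (x + A) ^ 2 + B)) ≤ ENNReal.ofReal (2 * Real.pi) := by
  obtain ⟨a, ha⟩ := kern_sq_add_le B
  calc _ ≤ ∫⁻ x : ℝ, (ENNReal.ofReal ((1 + (x + (A - a)) ^ 2)⁻¹) +
        ENNReal.ofReal ((1 + (x + (A + a)) ^ 2)⁻¹)) := by
        refine lintegral_mono fun x => ?_
        rw [← ENNReal.ofReal_add (by positivity) (by positivity)]
        refine ENNReal.ofReal_le_ofReal ((ha _).trans (le_of_eq ?_))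
        rw [add_sub_assoc, add_assoc]
    _ = ENNReal.ofReal (2 * Real.pi) := by
        rw [lintegral_add_left (by fun_prop), lintegral_inv_one_add_sq_shift,
          lintegral_inv_one_add_sq_shift, ← ENNReal.ofReal_add Real.pi_pos.le Real.pi_pos.le,
          two_mul]

/-- `∫ (1 + |x|)^{-1-δ} dx`. -/
def lineConst (δ : ℝ) : ℝ≥0∞ := ∫⁻ x : ℝ, ENNReal.ofReal ((1 + |x|) ^ (-(1 + δ)))

theorem lineConst_lt_top {δ : ℝ} (hδ : 0 < δ) : lineConst δ < ⊤ := by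
  have := finite_integral_one_add_norm (E := ℝ) (μ := volume) (r := 1 + δ) (by simp [hδ])
  simpa [lineConst, Real.norm_eq_abs] using this

theorem lintegral_line_scaled {β : ℝ} (hβ : 0 < β) (δ x₀ : ℝ) :
    ∫⁻ x : ℝ, ENNReal.ofReal ((1 + β * |x - x₀|) ^ (-(1 + δ))) =
      ENNReal.ofReal β⁻¹ * lineConst δ := by
  rw [lintegral_sub_right_eq_self (fun x : ℝ => ENNReal.ofReal ((1 + β * |x|) ^ (-(1 + δ)))) x₀]
  have hm : Measurable fun x : ℝ => ENNReal.ofReal ((1 + |x|) ^ (-(1 + δ))) := by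
    have : Measurable fun x : ℝ => |x| := continuous_abs.measurable
    fun_prop
  have h := lintegral_map (μ := volume) hm (measurable_const_mul β)
  rw [Real.map_volume_mul_left hβ.ne', lintegral_smul_measure, abs_of_pos (inv_pos.2 hβ)] at h
  rw [lineConst, ← smul_eq_mul, h]
  refine lintegral_congr fun x => ?_
  rw [abs_mul, abs_of_pos hβ]

/-- A truncation at height `μ`: the logarithmically divergent `1/(1 + t)` becomes an integrable
power at the price `μ^δ`, plus a small constant. -/
theorem inv_one_add_le {δ t μ : ℝ} (hδ : 0 ≤ δ) (ht : 0 ≤ t) (hμ : 0 < μ) :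
    (1 + t)⁻¹ ≤ μ ^ δ * (1 + t) ^ (-(1 + δ)) + μ⁻¹ := by
  have h1 : 0 ≤ μ ^ δ * (1 + t) ^ (-(1 + δ)) := by positivity
  rcases le_total (1 + t) μ with h | h
  · have e : (1 + t)⁻¹ = (1 + t) ^ δ * (1 + t) ^ (-(1 + δ)) := by
      rw [← Real.rpow_add (by linarith), ← Real.rpow_neg_one]; ring_nf
    have h2 : (1 + t) ^ δ ≤ μ ^ δ := Real.rpow_le_rpow (by linarith) h hδ
    rw [e]
    have h3 : 0 ≤ (1 + t) ^ (-(1 + δ)) := by positivity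
    have h4 : 0 ≤ μ⁻¹ := by positivity
    nlinarith
  · have := inv_anti₀ hμ h
    linarith

/-- The integral of `1 / (1 + |A| |x - x₀| / 2)` over `|x| ≤ |A|` loses only `|A|^{2δ - 1}`. -/
theorem lintegral_line_le {δ A : ℝ} (hδ : 0 < δ) (hδ1 : δ ≤ 1 / 2) (hA : 1 / 60 ≤ |A|) (x₀ : ℝ) :
    ENNReal.ofReal (|A| ^ (1 - 2 * δ)) * ∫⁻ x in Set.Icc (-|A|) |A|,
      ENNReal.ofReal ((1 + |A| / 2 * |x - x₀|)⁻¹) ≤ 7202 * lineConst δ + 4 := by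
  have hA0 : 0 < |A| := by linarith
  -- With this `μ` the constant term `μ⁻¹`, integrated over an interval of length `2|A|`, is of
  -- order `|A|⁻¹` for large `|A|`, and `μ^δ` is only the loss `|A|^{2δ}`.
  set μ : ℝ := 1 + |A| ^ 2 with hμ
  have hμ0 : 0 < μ := by positivity
  have h1 : ∫⁻ x in Set.Icc (-|A|) |A|, ENNReal.ofReal ((1 + |A| / 2 * |x - x₀|)⁻¹) ≤
      ENNReal.ofReal (μ ^ δ) * (ENNReal.ofReal (|A| / 2)⁻¹ * lineConst δ) +
        ENNReal.ofReal μ⁻¹ * ENNReal.ofReal (2 * |A|) := by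
    have hmeas : Measurable fun x : ℝ => ENNReal.ofReal
        ((1 + |A| / 2 * |x - x₀|) ^ (-(1 + δ))) := by
      have : Measurable fun x : ℝ => |x - x₀| := (continuous_abs.comp (by fun_prop)).measurable
      fun_prop
    calc _ ≤ ∫⁻ x in Set.Icc (-|A|) |A|, (ENNReal.ofReal (μ ^ δ) *
          ENNReal.ofReal ((1 + |A| / 2 * |x - x₀|) ^ (-(1 + δ))) + ENNReal.ofReal μ⁻¹) := by
          refine lintegral_mono fun x => ?_
          rw [← ENNReal.ofReal_mul (by positivity), ← ENNReal.ofReal_add (by positivity)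
            (by positivity)]
          exact ENNReal.ofReal_le_ofReal (inv_one_add_le hδ.le (by positivity) hμ0)
      _ = ENNReal.ofReal (μ ^ δ) * (∫⁻ x in Set.Icc (-|A|) |A|,
          ENNReal.ofReal ((1 + |A| / 2 * |x - x₀|) ^ (-(1 + δ)))) +
          ENNReal.ofReal μ⁻¹ * ENNReal.ofReal (2 * |A|) := by
          rw [lintegral_add_right _ measurable_const, lintegral_const_mul _ hmeas,
            lintegral_const, Measure.restrict_apply_univ, Real.volume_Icc,
            show |A| - -|A| = 2 * |A| by ring]
      _ ≤ _ := by
          gcongr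
          rw [← lintegral_line_scaled (by positivity) δ x₀]
          exact setLIntegral_le_lintegral _ _
  have e1 : |A| ^ (1 - 2 * δ) = |A| * (|A| ^ 2) ^ (-δ) := by
    rw [← Real.rpow_natCast |A| 2, ← Real.rpow_mul hA0.le, sub_eq_add_neg, Real.rpow_add hA0,
      Real.rpow_one]
    congr 2; push_cast; ring
  have b1 : |A| ^ (1 - 2 * δ) * (μ ^ δ * (|A| / 2)⁻¹) ≤ 7202 := by
    -- From `|A| ≥ 1/60`, that is `1 ≤ 3600 |A|²`; the final `7202` is `2·3601`.
    have hq : μ ≤ 3601 * |A| ^ 2 := by nlinarith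
    have hμd : μ ^ δ ≤ 3601 * (|A| ^ 2) ^ δ := by
      calc μ ^ δ ≤ (3601 * |A| ^ 2) ^ δ := Real.rpow_le_rpow hμ0.le hq hδ.le
        _ = 3601 ^ δ * (|A| ^ 2) ^ δ := Real.mul_rpow (by norm_num) (by positivity)
        _ ≤ 3601 ^ (1 : ℝ) * (|A| ^ 2) ^ δ := by
          gcongr
          · norm_num
          · linarith
        _ = _ := by rw [Real.rpow_one]
    have hinv : (|A| ^ 2) ^ (-δ) * (|A| ^ 2) ^ δ = 1 := by
      rw [← Real.rpow_add (by positivity)]; simp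
    calc _ ≤ |A| * (|A| ^ 2) ^ (-δ) * (3601 * (|A| ^ 2) ^ δ * (|A| / 2)⁻¹) := by
          rw [e1]; gcongr
      _ = 7202 * ((|A| ^ 2) ^ (-δ) * (|A| ^ 2) ^ δ) := by field_simp; ring
      _ = 7202 := by rw [hinv, mul_one]
  have b2 : |A| ^ (1 - 2 * δ) * (μ⁻¹ * (2 * |A|)) ≤ 4 := by
    have hle : |A| ^ (1 - 2 * δ) ≤ 1 + |A| := by
      rcases le_total |A| 1 with h | h
      · have := Real.rpow_le_one hA0.le h (by linarith : 0 ≤ 1 - 2 * δ)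
        linarith
      · have := Real.rpow_le_rpow_of_exponent_le h (by linarith : 1 - 2 * δ ≤ 1)
        rw [Real.rpow_one] at this
        linarith
    calc _ ≤ (1 + |A|) * (μ⁻¹ * (2 * |A|)) := by gcongr
      _ = (1 + |A|) * (2 * |A|) / μ := by field_simp
      _ ≤ 4 := by
        rw [div_le_iff₀ hμ0, hμ]
        nlinarith [sq_nonneg (|A| - 1)]
  calc _ ≤ ENNReal.ofReal (|A| ^ (1 - 2 * δ)) *
        (ENNReal.ofReal (μ ^ δ) * (ENNReal.ofReal (|A| / 2)⁻¹ * lineConst δ) +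
        ENNReal.ofReal μ⁻¹ * ENNReal.ofReal (2 * |A|)) := by gcongr
    _ = ENNReal.ofReal (|A| ^ (1 - 2 * δ) * (μ ^ δ * (|A| / 2)⁻¹)) * lineConst δ +
        ENNReal.ofReal (|A| ^ (1 - 2 * δ) * (μ⁻¹ * (2 * |A|))) := by
        have f : ∀ a b c : ℝ, 0 ≤ a → 0 ≤ b → ENNReal.ofReal (a * (b * c)) =
            ENNReal.ofReal a * (ENNReal.ofReal b * ENNReal.ofReal c) := fun a b c ha hb => by
          rw [ENNReal.ofReal_mul ha, ENNReal.ofReal_mul hb]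
        rw [f _ _ _ (by positivity) (by positivity), f _ _ _ (by positivity) (by positivity)]
        ring
    _ ≤ ENNReal.ofReal 7202 * lineConst δ + ENNReal.ofReal 4 := by
        gcongr
    _ = _ := by norm_num

/-- On a line transversal to the level sets, the kernel of a quadratic resonance function is
dominated by two linear kernels. -/
theorem exists_kern_le {A B η₁ η₂ : ℝ} (h₁ : η₁ = 1 ∨ η₁ = -1) (h₂ : η₂ = 1 ∨ η₂ = -1)
    (hA : A ≠ 0) :
    ∃ x₁ x₂ : ℝ, ∀ x : ℝ, |x| ≤ |A| / 5 →
      kern (η₁ * (A - x) ^ 2 + η₂ * x ^ 2 + B) ≤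
        (1 + |A| / 2 * |x - x₁|)⁻¹ + (1 + |A| / 2 * |x - x₂|)⁻¹ := by
  have hA0 : 0 < |A| := abs_pos.2 hA
  have hpos : ∀ t : ℝ, 0 ≤ (1 + |A| / 2 * |t|)⁻¹ := fun t => by positivity
  have hlin : ∀ q x x₀ : ℝ, |A| / 2 * |x - x₀| ≤ |q| → kern q ≤ (1 + |A| / 2 * |x - x₀|)⁻¹ := by
    intro q x x₀ h
    unfold kern
    exact inv_anti₀ (by positivity) (by linarith)
  -- For equal signs the vertex of the parabola is `A/2`, at distance at least `3|A|/10` from the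
  -- allowed `x`. Hence the factor belonging to the root on the other side of the vertex is of size
  -- `|A|`, and the form grows linearly from the nearer root.
  have hsame : ∀ B : ℝ, ∃ x₁ x₂ : ℝ, ∀ x : ℝ, |x| ≤ |A| / 5 →
      kern ((A - x) ^ 2 + x ^ 2 + B) ≤
        (1 + |A| / 2 * |x - x₁|)⁻¹ + (1 + |A| / 2 * |x - x₂|)⁻¹ := by
    intro B
    have hz : ∀ x : ℝ, |x| ≤ |A| / 5 → 3 / 10 * |A| ≤ |x - A / 2| := by
      intro x hx
      have := abs_sub_abs_le_abs_sub (A / 2) x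
      rw [abs_sub_comm, abs_div, abs_of_pos (by norm_num : (0 : ℝ) < 2)] at this
      linarith
    have he : ∀ x : ℝ, (A - x) ^ 2 + x ^ 2 + B = 2 * (x - A / 2) ^ 2 + (B + A ^ 2 / 2) := by
      intro x; ring
    rcases le_or_gt 0 (B + A ^ 2 / 2) with hB | hB
    · refine ⟨A / 2, A / 2, fun x hx => ?_⟩
      have := hlin ((A - x) ^ 2 + x ^ 2 + B) x (A / 2) (by
        have hnn : 0 ≤ 2 * (x - A / 2) ^ 2 + (B + A ^ 2 / 2) :=
          add_nonneg (by positivity) hB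
        rw [he, abs_of_nonneg hnn, ← sq_abs (x - A / 2)]
        nlinarith [hz x hx, abs_nonneg (x - A / 2)])
      linarith [hpos (x - A / 2)]
    · obtain ⟨a, ha0, ha⟩ : ∃ a : ℝ, 0 ≤ a ∧ B + A ^ 2 / 2 = -(2 * a ^ 2) :=
        ⟨√(-(B + A ^ 2 / 2) / 2), Real.sqrt_nonneg _, by
          rw [Real.sq_sqrt (by linarith)]; ring⟩
      refine ⟨A / 2 + a, A / 2 - a, fun x hx => ?_⟩
      have habs : |(A - x) ^ 2 + x ^ 2 + B| = 2 * (|x - (A / 2 + a)| * |x - (A / 2 - a)|) := by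
        rw [he, ha, ← abs_mul, ← abs_of_pos (by norm_num : (0 : ℝ) < 2), ← abs_mul,
          abs_of_pos (by norm_num : (0 : ℝ) < 2)]
        congr 1; ring
      have hzx := hz x hx
      rcases le_total 0 (x - A / 2) with hs | hs
      · have := hlin ((A - x) ^ 2 + x ^ 2 + B) x (A / 2 + a) (by
          rw [habs]
          have h3 : |x - A / 2| ≤ |x - (A / 2 - a)| := by
            rw [abs_of_nonneg hs, abs_of_nonneg (by linarith)]; linarith
          nlinarith [abs_nonneg (x - (A / 2 + a))])
        linarith [hpos (x - (A / 2 - a))]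
      · have := hlin ((A - x) ^ 2 + x ^ 2 + B) x (A / 2 - a) (by
          rw [habs]
          have h3 : |x - A / 2| ≤ |x - (A / 2 + a)| := by
            rw [abs_of_nonpos hs, abs_of_nonpos (by linarith)]; linarith
          nlinarith [abs_nonneg (x - (A / 2 - a))])
        linarith [hpos (x - (A / 2 + a))]
  -- For opposite signs the squares cancel and the form is affine with slope `-2A`; the second
  -- kernel is only padding.
  have hopp : ∀ B : ℝ, ∃ x₁ x₂ : ℝ, ∀ x : ℝ, |x| ≤ |A| / 5 →
      kern ((A - x) ^ 2 - x ^ 2 + B) ≤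
        (1 + |A| / 2 * |x - x₁|)⁻¹ + (1 + |A| / 2 * |x - x₂|)⁻¹ := by
    intro B
    refine ⟨(A ^ 2 + B) / (2 * A), 0, fun x _ => ?_⟩
    have he : (A - x) ^ 2 - x ^ 2 + B = (-2 * A) * (x - (A ^ 2 + B) / (2 * A)) := by
      field_simp; ring
    have := hlin ((A - x) ^ 2 - x ^ 2 + B) x ((A ^ 2 + B) / (2 * A)) (by
      rw [he, abs_mul, abs_mul, abs_neg, abs_of_pos (by norm_num : (0 : ℝ) < 2)]
      gcongr
      linarith)
    linarith [hpos (x - 0)]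
  rcases h₁ with rfl | rfl <;> rcases h₂ with rfl | rfl
  · obtain ⟨x₁, x₂, h⟩ := hsame B
    exact ⟨x₁, x₂, fun x hx => by simpa only [one_mul] using h x hx⟩
  · obtain ⟨x₁, x₂, h⟩ := hopp B
    refine ⟨x₁, x₂, fun x hx => (le_of_eq ?_).trans (h x hx)⟩
    congr 1; ring
  · obtain ⟨x₁, x₂, h⟩ := hopp (-B)
    refine ⟨x₁, x₂, fun x hx => (le_of_eq ?_).trans (h x hx)⟩
    rw [← kern_neg]; congr 1; ring
  · obtain ⟨x₁, x₂, h⟩ := hsame (-B)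
    refine ⟨x₁, x₂, fun x hx => (le_of_eq ?_).trans (h x hx)⟩
    rw [← kern_neg]; congr 1; ring

end

end IMethod

namespace IMethod

noncomputable section

/-! ### Fiber integrals in the plane -/

theorem lintegral_plane {f : Plane → ℝ≥0∞} (hf : Measurable f) :
    ∫⁻ l, f l = ∫⁻ q : ℝ × ℝ, f (!₂[q.1, q.2]) := by
  refine ((PiLp.volume_preserving_toLp (Fin 2)).lintegral_comp hf).symm.trans ?_
  exact ((volume_preserving_finTwoArrow ℝ).symm.lintegral_comp
      (hf.comp (by fun_prop : Measurable (WithLp.toLp 2 : (Fin 2 → ℝ) → Plane)))).symm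

theorem norm_sq_plane (x : Plane) : ‖x‖ ^ 2 = x 0 ^ 2 + x 1 ^ 2 := by
  rw [EuclideanSpace.norm_sq_eq, Fin.sum_univ_two, Real.norm_eq_abs, Real.norm_eq_abs, sq_abs,
    sq_abs]

/-- Cartesian coordinates, ordered so that the first coordinate of `c` is not small. -/
theorem exists_adapted_coordinates (c : Plane) :
    ∃ P : ℝ → ℝ → Plane,
      (∀ f : Plane → ℝ≥0∞, Measurable f → ∫⁻ l, f l = ∫⁻ y : ℝ, ∫⁻ x : ℝ, f (P x y)) ∧
      (∀ x y, ‖P x y‖ ^ 2 = x ^ 2 + y ^ 2) ∧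
      ∃ A B : ℝ, (∀ x y, ‖c - P x y‖ ^ 2 = (A - x) ^ 2 + (B - y) ^ 2) ∧ 7 / 10 * ‖c‖ ≤ |A| := by
  -- The larger coordinate is at least `‖c‖/√2`, and `7/10 < 1/√2`.
  have hbig : ∀ u v : ℝ, ‖c‖ ^ 2 = u ^ 2 + v ^ 2 → |v| ≤ |u| → 7 / 10 * ‖c‖ ≤ |u| := by
    intro u v h hvu
    refine abs_le_of_sq_le_sq' ?_ (abs_nonneg u) |>.2
    have := sq_le_sq' (by linarith [abs_nonneg u, abs_nonneg v]) hvu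
    rw [sq_abs, sq_abs] at this
    rw [mul_pow, h, sq_abs]
    nlinarith [sq_nonneg u]
  rcases le_total |c 1| |c 0| with h | h
  · refine ⟨fun x y => !₂[x, y], fun f hf => ?_, fun x y => ?_, c 0, c 1, fun x y => ?_, ?_⟩
    · rw [lintegral_plane hf, Measure.volume_eq_prod, lintegral_prod_symm]
      exact (hf.comp (by fun_prop)).aemeasurable
    · rw [norm_sq_plane]; simp
    · rw [norm_sq_plane]; simp
    · exact hbig _ _ (norm_sq_plane c) h
  · refine ⟨fun x y => !₂[y, x], fun f hf => ?_, fun x y => ?_, c 1, c 0, fun x y => ?_, ?_⟩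
    · rw [lintegral_plane hf, Measure.volume_eq_prod, lintegral_prod]
      exact (hf.comp (by fun_prop)).aemeasurable
    · rw [norm_sq_plane]; simp [add_comm]
    · rw [norm_sq_plane]; simp [add_comm]
    · exact hbig _ _ (by rw [norm_sq_plane c, add_comm]) h

theorem rpow_one_add_norm_le {δ y : ℝ} {l : Plane} (hδ : 0 < δ) (h : |y| ≤ ‖l‖) :
    (1 + ‖l‖) ^ (-(1 + δ)) ≤ (1 + |y|) ^ (-(1 + δ)) :=
  Real.rpow_le_rpow_of_nonpos (by positivity) (by linarith) (by linarith)

/-- The fiber integral for two frequencies of the same sign. -/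
theorem lintegral_parallel_fiber_le {δ : ℝ} (hδ : 0 < δ) {η : ℝ} (hη : η = 1 ∨ η = -1)
    (c : Plane) (B : ℝ) :
    ∫⁻ l : Plane, ENNReal.ofReal ((1 + ‖l‖) ^ (-(1 + δ)) *
      kern (η * ‖c - l‖ ^ 2 + η * ‖l‖ ^ 2 + B)) ≤ ENNReal.ofReal (2 * Real.pi) * lineConst δ := by
  obtain ⟨P, hP, hn, A, A', hc, -⟩ := exists_adapted_coordinates c
  have hm : Measurable fun l : Plane => ENNReal.ofReal ((1 + ‖l‖) ^ (-(1 + δ)) *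
      kern (η * ‖c - l‖ ^ 2 + η * ‖l‖ ^ 2 + B)) := by
    have := continuous_kern.measurable
    fun_prop
  rw [hP _ hm]
  have hy : ∀ y : ℝ, ∫⁻ x : ℝ, ENNReal.ofReal ((1 + ‖P x y‖) ^ (-(1 + δ)) *
      kern (η * ‖c - P x y‖ ^ 2 + η * ‖P x y‖ ^ 2 + B)) ≤
      ENNReal.ofReal ((1 + |y|) ^ (-(1 + δ))) * ENNReal.ofReal (2 * Real.pi) := by
    intro y
    -- Completing the square in `x`; a negative sign is absorbed because the kernel is even. The `x`
    -- integral is bounded uniformly in `y`, and the weight takes care of the `y` integral.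
    obtain ⟨B', hB'⟩ : ∃ B' : ℝ, ∀ x : ℝ,
        kern (η * ‖c - P x y‖ ^ 2 + η * ‖P x y‖ ^ 2 + B) = kern (2 * (x + -(A / 2)) ^ 2 + B') := by
      rcases hη with rfl | rfl
      · refine ⟨A ^ 2 / 2 + (A' - y) ^ 2 + y ^ 2 + B, fun x => ?_⟩
        rw [hc, hn]; congr 1; ring
      · refine ⟨A ^ 2 / 2 + (A' - y) ^ 2 + y ^ 2 - B, fun x => ?_⟩
        rw [hc, hn, ← kern_neg]; congr 1; ring
    calc _ ≤ ∫⁻ x : ℝ, ENNReal.ofReal ((1 + |y|) ^ (-(1 + δ))) *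
          ENNReal.ofReal (kern (2 * (x + -(A / 2)) ^ 2 + B')) := by
          refine lintegral_mono fun x => ?_
          rw [hB', ← ENNReal.ofReal_mul (by positivity)]
          refine ENNReal.ofReal_le_ofReal (mul_le_mul_of_nonneg_right
            (rpow_one_add_norm_le hδ ?_) (kern_nonneg _))
          exact abs_le_of_sq_le_sq' (by rw [hn, sq_abs]; nlinarith [sq_nonneg x])
            (norm_nonneg _) |>.2
      _ ≤ _ := by
          rw [lintegral_const_mul]
          · gcongr; exact lintegral_kern_sq_le _ _
          · have := continuous_kern.measurable
            fun_prop
  refine (lintegral_mono hy).trans (le_of_eq ?_)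
  rw [lintegral_mul_const, mul_comm]
  · rfl
  · have : Measurable fun x : ℝ => |x| := continuous_abs.measurable
    fun_prop

/-- The region where the frequency `h` is large and `l` is much smaller. -/
def transversal (h l : Plane) : Prop := ‖l‖ ≤ ‖h‖ / 16 ∧ 1 / 20 ≤ ‖h‖

theorem measurableSet_transversal {α : Type*} [MeasurableSpace α] {f g : α → Plane}
    (hf : Measurable f) (hg : Measurable g) : MeasurableSet {x | transversal (f x) (g x)} := by
  have h : {x | transversal (f x) (g x)} = {x | ‖g x‖ ≤ ‖f x‖ / 16} ∩ {x | 1 / 20 ≤ ‖f x‖} := rfl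
  rw [h]
  exact (measurableSet_le (by fun_prop) (by fun_prop)).inter
    (measurableSet_le (by fun_prop) (by fun_prop))

/-- The fiber integral for a high and a low frequency. -/
theorem lintegral_transversal_fiber_le {δ : ℝ} (hδ : 0 < δ) (hδ1 : δ ≤ 1 / 2) {η₁ η₂ : ℝ}
    (h₁ : η₁ = 1 ∨ η₁ = -1) (h₂ : η₂ = 1 ∨ η₂ = -1) (c : Plane) (B : ℝ) :
    ∫⁻ l : Plane, {l | transversal (c - l) l}.indicator (fun l => ENNReal.ofReal
      (‖c - l‖ ^ (1 - 2 * δ) * (1 + ‖l‖) ^ (-(1 + δ)) *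
        kern (η₁ * ‖c - l‖ ^ 2 + η₂ * ‖l‖ ^ 2 + B))) l ≤
      4 * (7202 * lineConst δ + 4) * lineConst δ := by
  obtain ⟨P, hP, hn, A, A', hc, hA⟩ := exists_adapted_coordinates c
  have hset : MeasurableSet {l : Plane | transversal (c - l) l} :=
    measurableSet_transversal (by fun_prop) measurable_id
  have hm : Measurable ({l | transversal (c - l) l}.indicator fun l : Plane => ENNReal.ofReal
      (‖c - l‖ ^ (1 - 2 * δ) * (1 + ‖l‖) ^ (-(1 + δ)) *
        kern (η₁ * ‖c - l‖ ^ 2 + η₂ * ‖l‖ ^ 2 + B))) := by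
    have := continuous_kern.measurable
    exact Measurable.indicator (by fun_prop) hset
  have htri : ∀ l, transversal (c - l) l → ‖c - l‖ ≤ 16 / 15 * ‖c‖ := by
    intro l hl
    have := norm_sub_le c l
    linarith [hl.1]
  -- Transversality forces `‖c‖ ≥ (15/16)·(1/20) = 3/64`. Otherwise the region is empty; in the
  -- other case `|A| ≥ (7/10)‖c‖` exceeds `1/60`.
  rcases lt_or_ge ‖c‖ (3 / 64) with hsmall | hbig
  · have hempty : {l : Plane | transversal (c - l) l} = ∅ := by
      ext l
      simp only [Set.mem_ofPred_eq, Set.mem_empty_iff_false, iff_false]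
      intro hl
      linarith [htri l hl, hl.2]
    rw [hempty]
    simp
  have hA60 : 1 / 60 ≤ |A| := by linarith
  have hA0 : A ≠ 0 := abs_pos.1 (by linarith)
  rw [hP _ hm]
  have hy : ∀ y : ℝ, ∫⁻ x : ℝ, {l | transversal (c - l) l}.indicator (fun l => ENNReal.ofReal
      (‖c - l‖ ^ (1 - 2 * δ) * (1 + ‖l‖) ^ (-(1 + δ)) *
        kern (η₁ * ‖c - l‖ ^ 2 + η₂ * ‖l‖ ^ 2 + B))) (P x y) ≤
      ENNReal.ofReal ((1 + |y|) ^ (-(1 + δ))) * (4 * (7202 * lineConst δ + 4)) := by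
    intro y
    obtain ⟨x₁, x₂, hx⟩ := exists_kern_le (A := A)
      (B := η₁ * (A' - y) ^ 2 + η₂ * y ^ 2 + B) h₁ h₂ hA0
    set k : ℝ → ℝ → ℝ := fun x₀ x => (1 + |A| / 2 * |x - x₀|)⁻¹ with hk
    have hk0 : ∀ x₀ x, 0 ≤ k x₀ x := fun x₀ x => by simp only [hk]; positivity
    have hkm : ∀ x₀, Measurable fun x => ENNReal.ofReal (k x₀ x) := fun x₀ => by
      have : Measurable fun x : ℝ => |x - x₀| := (continuous_abs.comp (by fun_prop)).measurable
      simp only [hk]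
      fun_prop
    calc _ ≤ ∫⁻ x : ℝ, (Set.Icc (-|A|) |A|).indicator (fun x =>
          ENNReal.ofReal ((1 + |y|) ^ (-(1 + δ))) * (ENNReal.ofReal 2 * ENNReal.ofReal (|A| ^ (1 - 2 * δ)) *
            (ENNReal.ofReal (k x₁ x) + ENNReal.ofReal (k x₂ x)))) x := by
          refine lintegral_mono fun x => ?_
          by_cases hl : P x y ∈ {l | transversal (c - l) l}
          swap
          · rw [Set.indicator_of_notMem hl]; exact zero_le
          have hl' : transversal (c - P x y) (P x y) := hl
          have hh := htri _ hl'
          have hxl : |x| ≤ ‖P x y‖ :=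
            abs_le_of_sq_le_sq' (by rw [hn, sq_abs]; nlinarith [sq_nonneg y])
              (norm_nonneg _) |>.2
          have hyl : |y| ≤ ‖P x y‖ :=
            abs_le_of_sq_le_sq' (by rw [hn, sq_abs]; nlinarith [sq_nonneg x])
              (norm_nonneg _) |>.2
          have hx5 : |x| ≤ |A| / 5 := by linarith [hl'.1]
          have hxI : x ∈ Set.Icc (-|A|) |A| := abs_le.1 (by linarith [abs_nonneg A])
          rw [Set.indicator_of_mem hl, Set.indicator_of_mem hxI,
            ← ENNReal.ofReal_add (hk0 _ _) (hk0 _ _),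
            ← ENNReal.ofReal_mul (by norm_num), ← ENNReal.ofReal_mul (by positivity),
            ← ENNReal.ofReal_mul (by positivity)]
          refine ENNReal.ofReal_le_ofReal ?_
          have f1 : ‖c - P x y‖ ^ (1 - 2 * δ) ≤ 2 * |A| ^ (1 - 2 * δ) := by
            calc ‖c - P x y‖ ^ (1 - 2 * δ) ≤ (2 * |A|) ^ (1 - 2 * δ) :=
                  Real.rpow_le_rpow (norm_nonneg _) (by linarith) (by linarith)
              _ = 2 ^ (1 - 2 * δ) * |A| ^ (1 - 2 * δ) := Real.mul_rpow (by norm_num) (abs_nonneg _)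
              _ ≤ 2 ^ (1 : ℝ) * |A| ^ (1 - 2 * δ) := by
                  gcongr
                  · norm_num
                  · linarith
              _ = _ := by rw [Real.rpow_one]
          have f2 := rpow_one_add_norm_le hδ hyl
          have f3 : kern (η₁ * ‖c - P x y‖ ^ 2 + η₂ * ‖P x y‖ ^ 2 + B) ≤ k x₁ x + k x₂ x := by
            refine (le_of_eq ?_).trans (hx x hx5)
            rw [hc, hn]; congr 1; ring
          have g3 := kern_nonneg (η₁ * ‖c - P x y‖ ^ 2 + η₂ * ‖P x y‖ ^ 2 + B)
          calc _ ≤ 2 * |A| ^ (1 - 2 * δ) * (1 + |y|) ^ (-(1 + δ)) * (k x₁ x + k x₂ x) := by gcongr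
            _ = _ := by ring
      _ = ENNReal.ofReal ((1 + |y|) ^ (-(1 + δ))) * (ENNReal.ofReal 2 *
          (ENNReal.ofReal (|A| ^ (1 - 2 * δ)) * (∫⁻ x in Set.Icc (-|A|) |A|,
            ENNReal.ofReal (k x₁ x)) + ENNReal.ofReal (|A| ^ (1 - 2 * δ)) *
            (∫⁻ x in Set.Icc (-|A|) |A|, ENNReal.ofReal (k x₂ x)))) := by
          rw [lintegral_indicator measurableSet_Icc, lintegral_const_mul, lintegral_const_mul,
            lintegral_add_left]
          · ring
          · exact hkm x₁
          · exact (hkm x₁).add (hkm x₂)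
          · exact ((hkm x₁).add (hkm x₂)).const_mul _
      _ ≤ ENNReal.ofReal ((1 + |y|) ^ (-(1 + δ))) * (ENNReal.ofReal 2 *
          ((7202 * lineConst δ + 4) + (7202 * lineConst δ + 4))) := by
          gcongr
          · exact lintegral_line_le hδ hδ1 hA60 x₁
          · exact lintegral_line_le hδ hδ1 hA60 x₂
      _ = _ := by rw [ENNReal.ofReal_ofNat]; ring
  refine (lintegral_mono hy).trans (le_of_eq ?_)
  rw [lintegral_mul_const, mul_comm]
  · rfl
  · have : Measurable fun x : ℝ => |x| := continuous_abs.measurable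
    fun_prop

/-- `∫ (1 + |ξ|)^{-2-δ} dξ` over the plane. -/
def planeConst (δ : ℝ) : ℝ≥0∞ := ∫⁻ ξ : Plane, ENNReal.ofReal ((1 + ‖ξ‖) ^ (-(2 + δ)))

theorem planeConst_lt_top {δ : ℝ} (hδ : 0 < δ) : planeConst δ < ⊤ :=
  finite_integral_one_add_norm (E := Plane) (μ := volume) (r := 2 + δ) (by simp [hδ])

/-- Both exponents are transferred to the smaller base, so a product of two shifted weights is
controlled by two integrable ones, uniformly in the shift. -/
theorem rpow_mul_rpow_le {a b p q : ℝ} (ha : 0 < a) (hb : 0 < b) (hp : 0 ≤ p) (hq : 0 ≤ q) :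
    a ^ (-p) * b ^ (-q) ≤ a ^ (-(p + q)) + b ^ (-(p + q)) := by
  have e : ∀ t : ℝ, 0 < t → t ^ (-(p + q)) = t ^ (-p) * t ^ (-q) := fun t ht => by
    rw [← Real.rpow_add ht]; ring_nf
  rw [e a ha, e b hb]
  rcases le_total a b with h | h
  · have := Real.rpow_le_rpow_of_nonpos ha h (by linarith : -q ≤ 0)
    have h1 : 0 ≤ a ^ (-p) := by positivity
    have h2 : 0 ≤ b ^ (-p) * b ^ (-q) := by positivity
    nlinarith
  · have := Real.rpow_le_rpow_of_nonpos hb h (by linarith : -p ≤ 0)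
    have h1 : 0 ≤ b ^ (-q) := by positivity
    have h2 : 0 ≤ a ^ (-p) * a ^ (-q) := by positivity
    nlinarith

theorem lintegral_plane_two_weights_le {p q δ : ℝ} (hp : 0 ≤ p) (hq : 0 ≤ q) (hpq : p + q = 2 + δ)
    (c : Plane) :
    ∫⁻ x : Plane, ENNReal.ofReal ((1 + ‖x‖) ^ (-p) * (1 + ‖c - x‖) ^ (-q)) ≤
      2 * planeConst δ := by
  calc _ ≤ ∫⁻ x : Plane, (ENNReal.ofReal ((1 + ‖x‖) ^ (-(2 + δ))) +
        ENNReal.ofReal ((1 + ‖c - x‖) ^ (-(2 + δ)))) := by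
        refine lintegral_mono fun x => ?_
        rw [← ENNReal.ofReal_add (by positivity) (by positivity), ← hpq]
        exact ENNReal.ofReal_le_ofReal
          (rpow_mul_rpow_le (by positivity) (by positivity) hp hq)
    _ = 2 * planeConst δ := by
        rw [lintegral_add_left (by fun_prop), lintegral_sub_left_eq_self
          (fun x : Plane => ENNReal.ofReal ((1 + ‖x‖) ^ (-(2 + δ)))) c, two_mul]
        rfl

end

end IMethod

namespace IMethod

noncomputable section

/-! ### A Schur test on the hyperplane -/

/-- The exchange of the two halves of a six-tuple. -/
def swapHalves : Equiv.Perm (Fin 6) := Equiv.addRight 3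

theorem swapHalves_apply_apply (j : Fin 6) : swapHalves (swapHalves j) = j := by
  revert j; decide

theorem comp_swapHalves_comp_swapHalves {α : Type*} (ξ : Fin 6 → α) :
    (ξ ∘ swapHalves) ∘ swapHalves = ξ :=
  funext fun j => congrArg ξ (swapHalves_apply_apply j)

/-- The integrals of `K` over the last three frequencies are at most `C`. -/
def FiberBound (K : (Fin 6 → Plane) → ℝ≥0∞) (C : ℝ≥0∞) : Prop :=
  ∀ a b c : Plane, ∫⁻ d : Plane, ∫⁻ e : Plane, K ![a, b, c, d, e, -(a + b + c + d + e)] ≤ C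

theorem measurable_vec_last (a b c d : Plane) :
    Measurable fun e : Plane => ![a, b, c, d, e, -(a + b + c + d + e)] := by
  refine measurable_pi_lambda _ fun j => ?_
  fin_cases j <;> simp <;> fun_prop

theorem measurable_vec_last_two (a b c : Plane) :
    Measurable fun q : Plane × Plane =>
      ![a, b, c, q.1, q.2, -(a + b + c + q.1 + q.2)] := by
  refine measurable_pi_lambda _ fun j => ?_
  fin_cases j <;> simp <;> fun_prop

theorem lintegral_half_le {K : (Fin 6 → Plane) → ℝ≥0∞} (hK : Measurable K) {C : ℝ≥0∞}
    (hC : FiberBound K C) {H₀ H₁ H₂ : Plane → ℝ≥0∞} (h₀ : Measurable H₀) (h₁ : Measurable H₁)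
    (h₂ : Measurable H₂) :
    ∫⁻ ξ, (H₀ (ξ 0) * H₁ (ξ 1) * H₂ (ξ 2)) ^ 2 * K ξ ∂hyperMeasure 5 ≤
      C * ((∫⁻ x, H₀ x ^ 2) * (∫⁻ x, H₁ x ^ 2) * (∫⁻ x, H₂ x ^ 2)) := by
  rw [lintegral_hyperMeasure_five (by fun_prop)]
  have hin : ∀ a b c : Plane, ∫⁻ d : Plane, ∫⁻ e : Plane, (H₀ a * H₁ b * H₂ c) ^ 2 *
      K ![a, b, c, d, e, -(a + b + c + d + e)] ≤ H₀ a ^ 2 * (H₁ b ^ 2 * (H₂ c ^ 2 * C)) := by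
    intro a b c
    have h1 : ∀ d : Plane, ∫⁻ e : Plane, (H₀ a * H₁ b * H₂ c) ^ 2 *
        K ![a, b, c, d, e, -(a + b + c + d + e)] = (H₀ a * H₁ b * H₂ c) ^ 2 *
          ∫⁻ e : Plane, K ![a, b, c, d, e, -(a + b + c + d + e)] := fun d =>
      lintegral_const_mul _ (hK.comp (measurable_vec_last a b c d))
    have h2 : Measurable fun d : Plane =>
        ∫⁻ e : Plane, K ![a, b, c, d, e, -(a + b + c + d + e)] :=
      Measurable.lintegral_prod_right' (hK.comp (measurable_vec_last_two a b c))
    simp only [h1]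
    rw [lintegral_const_mul _ h2]
    calc _ ≤ (H₀ a * H₁ b * H₂ c) ^ 2 * C := by gcongr; exact hC a b c
      _ = _ := by ring
  calc _ ≤ ∫⁻ a, ∫⁻ b, ∫⁻ c, H₀ a ^ 2 * (H₁ b ^ 2 * (H₂ c ^ 2 * C)) :=
        lintegral_mono fun a => lintegral_mono fun b => lintegral_mono fun c => hin a b c
    _ = _ := by
        have e1 : ∀ a b : Plane, ∫⁻ c, H₀ a ^ 2 * (H₁ b ^ 2 * (H₂ c ^ 2 * C)) =
            H₀ a ^ 2 * (H₁ b ^ 2 * ((∫⁻ c, H₂ c ^ 2) * C)) := fun a b => by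
          rw [lintegral_const_mul _ (by fun_prop), lintegral_const_mul _ (by fun_prop),
            lintegral_mul_const _ (by fun_prop)]
        have e2 : ∀ a : Plane, ∫⁻ b, H₀ a ^ 2 * (H₁ b ^ 2 * ((∫⁻ c, H₂ c ^ 2) * C)) =
            H₀ a ^ 2 * ((∫⁻ b, H₁ b ^ 2) * ((∫⁻ c, H₂ c ^ 2) * C)) := fun a => by
          rw [lintegral_const_mul _ (by fun_prop), lintegral_mul_const _ (by fun_prop)]
        simp only [e1, e2]
        rw [lintegral_mul_const _ (by fun_prop)]
        ring

/-- A Schur test: the six functions are split into two halves, and the kernel is integrated over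
each half with the other one frozen. -/
theorem lintegral_prod_mul_kernel_le {K K' : (Fin 6 → Plane) → ℝ≥0∞} (hK : Measurable K)
    (hK' : Measurable K') {C : ℝ≥0∞} (hC : FiberBound K C) (hC' : FiberBound K' C)
    {H : Fin 6 → Plane → ℝ≥0∞} (hH : ∀ j, Measurable (H j)) :
    ∫⁻ ξ, (∏ j, H j (ξ j)) * (K ξ ^ (1 / 2 : ℝ) * K' (ξ ∘ swapHalves) ^ (1 / 2 : ℝ))
        ∂hyperMeasure 5 ≤ C * ∏ j, (∫⁻ x, H j x ^ 2) ^ (1 / 2 : ℝ) := by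
  have hperm : Measurable fun ξ : Fin 6 → Plane => ξ ∘ swapHalves :=
    measurable_pi_lambda _ fun j => measurable_pi_apply _
  have hK's : Measurable fun ξ : Fin 6 → Plane => K' (ξ ∘ swapHalves) := hK'.comp hperm
  have h0 := hH 0
  have h1 := hH 1
  have h2 := hH 2
  have h3 := hH 3
  have h4 := hH 4
  have h5 := hH 5
  -- Cauchy–Schwarz: each factor carries three functions and the square root of the kernel that is
  -- to be integrated over the other three frequencies. After squaring, the three functions are
  -- constant on the fiber.
  set f : (Fin 6 → Plane) → ℝ≥0∞ := fun ξ =>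
    H 0 (ξ 0) * H 1 (ξ 1) * H 2 (ξ 2) * K ξ ^ (1 / 2 : ℝ) with hf
  set g : (Fin 6 → Plane) → ℝ≥0∞ := fun ξ =>
    H 3 (ξ 3) * H 4 (ξ 4) * H 5 (ξ 5) * K' (ξ ∘ swapHalves) ^ (1 / 2 : ℝ) with hg
  have hsq : ∀ a k : ℝ≥0∞, (a * k ^ (1 / 2 : ℝ)) ^ (2 : ℝ) = a ^ 2 * k := by
    intro a k
    rw [ENNReal.mul_rpow_of_nonneg _ _ (by norm_num), ← ENNReal.rpow_mul]
    norm_num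
  have hfi : ∫⁻ ξ, f ξ ^ (2 : ℝ) ∂hyperMeasure 5 ≤
      C * ((∫⁻ x, H 0 x ^ 2) * (∫⁻ x, H 1 x ^ 2) * (∫⁻ x, H 2 x ^ 2)) := by
    simp only [hf, hsq]
    exact lintegral_half_le hK hC h0 h1 h2
  have hgi : ∫⁻ ξ, g ξ ^ (2 : ℝ) ∂hyperMeasure 5 ≤
      C * ((∫⁻ x, H 3 x ^ 2) * (∫⁻ x, H 4 x ^ 2) * (∫⁻ x, H 5 x ^ 2)) := by
    simp only [hg, hsq]
    have hp := lintegral_comp_perm swapHalves (f := fun ξ : Fin 6 → Plane =>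
      (H 3 (ξ 3) * H 4 (ξ 4) * H 5 (ξ 5)) ^ 2 * K' (ξ ∘ swapHalves)) (by fun_prop)
    refine hp.symm.le.trans ((lintegral_mono fun ξ => ?_).trans
      (lintegral_half_le hK' hC' h3 h4 h5))
    change _ * K' ((ξ ∘ swapHalves) ∘ swapHalves) ≤ _
    rw [comp_swapHalves_comp_swapHalves]
    exact le_rfl
  have hfm : Measurable f := by simp only [hf]; fun_prop
  have hgm : Measurable g := by simp only [hg]; fun_prop
  have hol := ENNReal.lintegral_mul_le_Lp_mul_Lq (hyperMeasure 5)
    (Real.HolderConjugate.two_two) hfm.aemeasurable hgm.aemeasurable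
  calc _ = ∫⁻ ξ, (f * g) ξ ∂hyperMeasure 5 := by
        refine lintegral_congr fun ξ => ?_
        simp only [hf, hg, Pi.mul_apply, Fin.prod_univ_six]
        ring
    _ ≤ _ := hol
    _ ≤ (C * ((∫⁻ x, H 0 x ^ 2) * (∫⁻ x, H 1 x ^ 2) * (∫⁻ x, H 2 x ^ 2))) ^ (1 / 2 : ℝ) *
        (C * ((∫⁻ x, H 3 x ^ 2) * (∫⁻ x, H 4 x ^ 2) * (∫⁻ x, H 5 x ^ 2))) ^ (1 / 2 : ℝ) := by
        gcongr
    _ = _ := by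
        have hcc : C ^ (1 / 2 : ℝ) * C ^ (1 / 2 : ℝ) = C := by
          rw [← ENNReal.rpow_add_of_nonneg _ _ (by norm_num) (by norm_num)]
          norm_num
        have hm : ∀ a b : ℝ≥0∞, (a * b) ^ (1 / 2 : ℝ) = a ^ (1 / 2 : ℝ) * b ^ (1 / 2 : ℝ) :=
          fun a b => ENNReal.mul_rpow_of_nonneg _ _ (by norm_num)
        simp only [hm, Fin.prod_univ_six]
        conv_rhs => rw [← hcc]
        ring

/-! ### The kernels -/

/-- The quadratic form with signs `η`. -/
def signedForm (η : Fin 6 → ℝ) (ξ : Fin 6 → Plane) : ℝ := ∑ j, η j * ‖ξ j‖ ^ 2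

theorem measurable_signedForm (η : Fin 6 → ℝ) : Measurable (signedForm η) := by
  unfold signedForm; fun_prop

theorem signedForm_comp (η : Fin 6 → ℝ) (ξ : Fin 6 → Plane) (e : Equiv.Perm (Fin 6)) :
    signedForm (η ∘ e) (ξ ∘ e) = signedForm η ξ :=
  Equiv.sum_comp e fun j => η j * ‖ξ j‖ ^ 2

open scoped Classical in
/-- The kernel for two frequencies of the same sign. -/
def parallelKernel (δ : ℝ) (η : Fin 6 → ℝ) (B : ℝ) (ξ : Fin 6 → Plane) : ℝ≥0∞ :=
  if η 5 = η 4 then ENNReal.ofReal ((1 + ‖ξ 3‖) ^ (-(2 + δ)) * (1 + ‖ξ 4‖) ^ (-(1 + δ)) *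
    kern (signedForm η ξ + B)) else 0

/-- The kernel for a high and a low frequency. -/
def transversalKernel (δ : ℝ) (η : Fin 6 → ℝ) (B : ℝ) : (Fin 6 → Plane) → ℝ≥0∞ :=
  {ξ | transversal (ξ 5) (ξ 4)}.indicator fun ξ => ENNReal.ofReal
    ((1 + ‖ξ 3‖) ^ (-(2 + δ)) * (1 + ‖ξ 4‖) ^ (-(1 + δ)) * ‖ξ 5‖ ^ (1 - 2 * δ) *
      kern (signedForm η ξ + B))

theorem measurable_parallelKernel (δ : ℝ) (η : Fin 6 → ℝ) (B : ℝ) :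
    Measurable (parallelKernel δ η B) := by
  have := continuous_kern.measurable
  have := measurable_signedForm η
  unfold parallelKernel
  split_ifs <;> fun_prop

theorem measurable_transversalKernel (δ : ℝ) (η : Fin 6 → ℝ) (B : ℝ) :
    Measurable (transversalKernel δ η B) := by
  have := continuous_kern.measurable
  have := measurable_signedForm η
  exact Measurable.indicator (by fun_prop) (measurableSet_transversal (by fun_prop) (by fun_prop))

theorem signedForm_vec (η : Fin 6 → ℝ) (a b c d e : Plane) :
    signedForm η ![a, b, c, d, e, -(a + b + c + d + e)] =
      η 5 * ‖-(a + b + c + d) - e‖ ^ 2 + η 4 * ‖e‖ ^ 2 +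
        (η 0 * ‖a‖ ^ 2 + η 1 * ‖b‖ ^ 2 + η 2 * ‖c‖ ^ 2 + η 3 * ‖d‖ ^ 2) := by
  have : -(a + b + c + d + e) = -(a + b + c + d) - e := by abel
  simp only [signedForm, Fin.sum_univ_six, this]
  simp
  ring

/-- With the first four frequencies frozen the last two have a fixed sum, which is the planar fiber
integral, bounded uniformly in that sum. The remaining weight in the fourth frequency is integrable
over the plane. -/
theorem fiberBound_parallelKernel {δ : ℝ} (hδ : 0 < δ) {η : Fin 6 → ℝ}
    (hη : ∀ j, η j = 1 ∨ η j = -1) (B : ℝ) :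
    FiberBound (parallelKernel δ η B)
      (planeConst δ * (ENNReal.ofReal (2 * Real.pi) * lineConst δ)) := by
  intro a b c
  by_cases h : η 5 = η 4
  swap
  · simp [parallelKernel, h]
  calc _ ≤ ∫⁻ d : Plane, ENNReal.ofReal ((1 + ‖d‖) ^ (-(2 + δ))) *
        (ENNReal.ofReal (2 * Real.pi) * lineConst δ) := by
        refine lintegral_mono fun d => ?_
        simp only [parallelKernel, if_pos h, signedForm_vec]
        refine le_trans (le_of_eq ?_) (mul_le_mul_right (lintegral_parallel_fiber_le hδ (hη 4)
          (-(a + b + c + d))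
          (η 0 * ‖a‖ ^ 2 + η 1 * ‖b‖ ^ 2 + η 2 * ‖c‖ ^ 2 + η 3 * ‖d‖ ^ 2 + B)) _)
        rw [← lintegral_const_mul' _ _ ENNReal.ofReal_ne_top]
        refine lintegral_congr fun e => ?_
        rw [← ENNReal.ofReal_mul (by positivity), h]
        congr 1
        simp only [Matrix.cons_val]
        rw [add_assoc _ _ B]
        ring
    _ = _ := by
        rw [lintegral_mul_const _ (by fun_prop)]
        rfl

theorem fiberBound_transversalKernel {δ : ℝ} (hδ : 0 < δ) (hδ1 : δ ≤ 1 / 2) {η : Fin 6 → ℝ}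
    (hη : ∀ j, η j = 1 ∨ η j = -1) (B : ℝ) :
    FiberBound (transversalKernel δ η B)
      (planeConst δ * (4 * (7202 * lineConst δ + 4) * lineConst δ)) := by
  intro a b c
  calc _ ≤ ∫⁻ d : Plane, ENNReal.ofReal ((1 + ‖d‖) ^ (-(2 + δ))) *
        (4 * (7202 * lineConst δ + 4) * lineConst δ) := by
        refine lintegral_mono fun d => ?_
        refine le_trans (le_of_eq ?_) (mul_le_mul_right (lintegral_transversal_fiber_le hδ hδ1
          (hη 5) (hη 4) (-(a + b + c + d))
          (η 0 * ‖a‖ ^ 2 + η 1 * ‖b‖ ^ 2 + η 2 * ‖c‖ ^ 2 + η 3 * ‖d‖ ^ 2 + B)) _)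
        rw [← lintegral_const_mul' _ _ ENNReal.ofReal_ne_top]
        refine lintegral_congr fun e => ?_
        have hneg : -(a + b + c + d + e) = -(a + b + c + d) - e := by abel
        have hiff : ![a, b, c, d, e, -(a + b + c + d + e)] ∈
            {ξ : Fin 6 → Plane | transversal (ξ 5) (ξ 4)} ↔
            e ∈ {l | transversal (-(a + b + c + d) - l) l} := by
          have : transversal (-(a + b + c + d + e)) e ↔
            transversal (-(a + b + c + d) - e) e := by rw [hneg]
          exact this
        by_cases hm : e ∈ {l | transversal (-(a + b + c + d) - l) l}
        · rw [transversalKernel, Set.indicator_of_mem (hiff.2 hm), Set.indicator_of_mem hm,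
            ← ENNReal.ofReal_mul (by positivity), signedForm_vec]
          congr 1
          simp only [Matrix.cons_val, hneg]
          rw [add_assoc _ _ B]
          ring
        · rw [transversalKernel, Set.indicator_of_notMem (fun h => hm (hiff.1 h)),
            Set.indicator_of_notMem hm, mul_zero]
    _ = _ := by
        rw [lintegral_mul_const _ (by fun_prop)]
        rfl

end

end IMethod

namespace IMethod

noncomputable section

/-! ### Weights -/

/-- A majorant of `1 / (m(ξ) ⟨ξ⟩)` as a function of `|ξ|`, up to a constant; here `σ = 1 - s`. -/
def weight (N σ x : ℝ) : ℝ := (1 + x / N) ^ σ * (1 + x)⁻¹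

theorem weight_nonneg {N σ x : ℝ} (hN : 1 ≤ N) (hx : 0 ≤ x) : 0 ≤ weight N σ x := by
  unfold weight; positivity

theorem measurable_weight (N σ : ℝ) : Measurable (weight N σ) := by
  unfold weight; fun_prop

theorem weight_sq {N σ x : ℝ} (hN : 1 ≤ N) (hx : 0 ≤ x) :
    weight N σ x ^ 2 = (1 + x / N) ^ (2 * σ) * (1 + x) ^ (-2 : ℝ) := by
  have h1 : 0 ≤ 1 + x / N := by positivity
  rw [weight, mul_pow, ← Real.rpow_natCast ((1 + x / N) ^ σ), ← Real.rpow_mul h1, inv_pow,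
    Real.rpow_neg (by positivity)]
  norm_num [mul_comm]

/-- The loss from `1/m` is replaced by its value at the largest frequency, where `1 + n/N ≤ 4n/N`
because `n/N ≥ 1/3`. -/
theorem weight_sq_le_of_le {N σ x n : ℝ} (hN : 1 ≤ N) (hσ : 0 ≤ σ) (hx : 0 ≤ x) (hxn : x ≤ n)
    (hn : N / 3 ≤ n) : weight N σ x ^ 2 ≤ (4 * (n / N)) ^ (2 * σ) * (1 + x) ^ (-2 : ℝ) := by
  rw [weight_sq hN hx]
  have hN0 : 0 < N := by linarith
  have h3 : 1 / 3 ≤ n / N := by rw [le_div_iff₀ hN0]; linarith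
  have h4 : x / N ≤ n / N := by gcongr
  gcongr
  linarith

/-- For the unpaired frequency of a triple: a loss `n^δ` buys integrability over the plane. -/
theorem weight_sq_le_free {N σ δ x n : ℝ} (hN : 1 ≤ N) (hσ : 0 ≤ σ) (hδ : 0 ≤ δ) (hx : 0 ≤ x)
    (hxn : x ≤ n) (hn : N / 3 ≤ n) :
    weight N σ x ^ 2 ≤ (4 * (n / N)) ^ (2 * σ) * (4 * n) ^ δ * (1 + x) ^ (-(2 + δ)) := by
  refine (weight_sq_le_of_le hN hσ hx hxn hn).trans ?_
  have e : (1 + x) ^ (-2 : ℝ) = (1 + x) ^ δ * (1 + x) ^ (-(2 + δ)) := by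
    rw [← Real.rpow_add (by linarith)]; ring_nf
  have h1 : (1 + x) ^ δ ≤ (4 * n) ^ δ := Real.rpow_le_rpow (by linarith) (by linarith) hδ
  have hnN : 0 ≤ n / N := div_nonneg (by linarith) (by linarith)
  rw [e, mul_assoc]
  gcongr

/-- For the low partner of a transversal pair: only integrability along a line is needed, so `1/m`
is absorbed without any power of `n/N`. -/
theorem weight_sq_le_low {N σ δ x : ℝ} (hN : 1 ≤ N) (hσ : 0 ≤ σ) (hσδ : 2 * σ + δ ≤ 1)
    (hx : 0 ≤ x) : weight N σ x ^ 2 ≤ (1 + x) ^ (-(1 + δ)) := by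
  rw [weight_sq hN hx]
  have h1 : (1 + x / N) ^ (2 * σ) ≤ (1 + x) ^ (2 * σ) := by
    have := div_le_self hx hN
    exact Real.rpow_le_rpow (by positivity) (by linarith) (by linarith)
  calc _ ≤ (1 + x) ^ (2 * σ) * (1 + x) ^ (-2 : ℝ) := by gcongr
    _ = (1 + x) ^ (2 * σ - 2) := by rw [← Real.rpow_add (by linarith)]; ring_nf
    _ ≤ _ := Real.rpow_le_rpow_of_exponent_le (by linarith) (by linarith)

theorem rpow_neg_split {x y p q r : ℝ} (hy : 0 < y) (hyx : y ≤ x) (hp : 0 ≤ p) (h : p + q = r) :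
    (1 + x) ^ (-r) ≤ y ^ (-p) * (1 + x) ^ (-q) := by
  rw [← h, neg_add, Real.rpow_add (by linarith)]
  have := Real.rpow_le_rpow_of_nonpos hy (by linarith : y ≤ 1 + x) (by linarith : -p ≤ 0)
  exact mul_le_mul_of_nonneg_right this (Real.rpow_nonneg (by linarith) _)

/-- The arithmetic of the powers of `N` and of the largest frequency `ν N`. -/
theorem power_bound {ν N p q δ : ℝ} (hν : 1 / 3 ≤ ν) (hN : 1 ≤ N) (hp : 0 ≤ p) (hδ : 0 ≤ δ)
    (hδ1 : δ ≤ 1) (hpq : p + δ ≤ q) (hq : q ≤ 3) :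
    (4 * ν) ^ p * (4 * (ν * N)) ^ δ * (ν * N / 80) ^ (-q) ≤ 3538944000 * N ^ (δ - q) := by
  have hν0 : 0 < ν := by linarith
  have hN0 : 0 < N := by linarith
  have e : (4 * ν) ^ p * (4 * (ν * N)) ^ δ * (ν * N / 80) ^ (-q) =
      4 ^ p * 4 ^ δ * 80 ^ q * ν ^ (-(q - p - δ)) * N ^ (δ - q) := by
    rw [Real.mul_rpow (by norm_num) hν0.le, Real.mul_rpow (by norm_num) (by positivity),
      Real.mul_rpow hν0.le hN0.le, Real.div_rpow (by positivity) (by norm_num),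
      Real.mul_rpow hν0.le hN0.le, Real.rpow_neg (by norm_num : (0 : ℝ) ≤ 80),
      show -(q - p - δ) = p + δ + -q by ring, Real.rpow_add hν0, Real.rpow_add hν0,
      show δ - q = δ + -q by ring, Real.rpow_add hN0]
    field_simp
  rw [e]
  have b1 : (4 : ℝ) ^ p ≤ 64 := by
    calc (4 : ℝ) ^ p ≤ 4 ^ (3 : ℝ) :=
          Real.rpow_le_rpow_of_exponent_le (by norm_num) (by linarith)
      _ = 64 := by norm_num
  have b2 : (4 : ℝ) ^ δ ≤ 4 := by
    calc (4 : ℝ) ^ δ ≤ 4 ^ (1 : ℝ) := Real.rpow_le_rpow_of_exponent_le (by norm_num) hδ1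
      _ = 4 := by norm_num
  have b3 : (80 : ℝ) ^ q ≤ 512000 := by
    calc (80 : ℝ) ^ q ≤ 80 ^ (3 : ℝ) := Real.rpow_le_rpow_of_exponent_le (by norm_num) hq
      _ = 512000 := by norm_num
  have b4 : ν ^ (-(q - p - δ)) ≤ 27 := by
    calc ν ^ (-(q - p - δ)) ≤ (1 / 3) ^ (-(q - p - δ)) :=
          Real.rpow_le_rpow_of_nonpos (by norm_num) hν (by linarith)
      _ = 3 ^ (q - p - δ) := by
          rw [one_div, Real.inv_rpow (by norm_num), Real.rpow_neg (by norm_num), inv_inv]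
      _ ≤ 3 ^ (3 : ℝ) := Real.rpow_le_rpow_of_exponent_le (by norm_num) (by linarith)
      _ = 27 := by norm_num
  -- The factors are `4³`, `4`, `80³` and `3³`. The power of `ν` has nonpositive exponent because `p
  -- + δ ≤ q`; this is the condition that limits how far `1/m` may grow.
  calc _ ≤ 64 * 4 * 512000 * 27 * N ^ (δ - q) := by gcongr
    _ = _ := by ring

/-- The gain `N^{-3+3δ}`, with its constant. -/
def gain (N δ : ℝ) : ℝ := 3538944000 * N ^ (-3 + 3 * δ)

theorem gain_nonneg {N δ : ℝ} (hN : 1 ≤ N) : 0 ≤ gain N δ := by unfold gain; positivity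

/-- The squared weight `h⁻²` is written as `h^{-3+2δ} h^{1-2δ}`: the second factor is what the
transversal fiber integral absorbs, the first is the gain. Only `r` and `h` lose powers of `n/N`, in
total `4σ`. -/
theorem weight_transversal_le {N σ δ n r l h : ℝ} (hN : 1 ≤ N) (hσ : 0 ≤ σ) (hδ : 0 < δ)
    (hδ1 : δ ≤ 1 / 4) (hσδ : 2 * σ + 2 * δ ≤ 1) (hn : N / 3 ≤ n) (hr : 0 ≤ r) (hrn : r ≤ n)
    (hl : 0 ≤ l) (hh : n / 80 ≤ h) (hhn : h ≤ n) :
    weight N σ r * weight N σ l * weight N σ h ≤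
      √(gain N δ * ((1 + r) ^ (-(2 + δ)) * (1 + l) ^ (-(1 + δ)) * h ^ (1 - 2 * δ))) := by
  have hN0 : 0 < N := by linarith
  have hn0 : 0 < n := by linarith
  have hh0 : 0 < h := by linarith
  refine Real.le_sqrt_of_sq_le ?_
  have w1 := weight_sq_le_free hN hσ hδ.le hr hrn hn
  have w2 := weight_sq_le_low (δ := δ) hN hσ (by linarith) hl
  have w3 : weight N σ h ^ 2 ≤ (4 * (n / N)) ^ (2 * σ) *
      ((n / 80) ^ (-(3 - 2 * δ)) * h ^ (1 - 2 * δ)) := by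
    refine (weight_sq_le_of_le hN hσ hh0.le hhn hn).trans ?_
    have hnN : 0 ≤ n / N := by positivity
    gcongr
    calc (1 + h) ^ (-2 : ℝ) ≤ h ^ (-2 : ℝ) :=
          Real.rpow_le_rpow_of_nonpos hh0 (by linarith) (by norm_num)
      _ = h ^ (-(3 - 2 * δ)) * h ^ (1 - 2 * δ) := by rw [← Real.rpow_add hh0]; ring_nf
      _ ≤ _ := by
          gcongr ?_ * _
          exact Real.rpow_le_rpow_of_nonpos (by positivity) hh (by linarith)
  have hν : 1 / 3 ≤ n / N := by rw [le_div_iff₀ hN0]; linarith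
  have hpb := power_bound (p := 4 * σ) (q := 3 - 2 * δ) hν hN (by linarith) hδ.le (by linarith)
    (by linarith) (by linarith)
  rw [div_mul_cancel₀ _ hN0.ne'] at hpb
  have e4 : (4 * (n / N)) ^ (4 * σ) = (4 * (n / N)) ^ (2 * σ) * (4 * (n / N)) ^ (2 * σ) := by
    rw [← Real.rpow_add (by positivity)]; ring_nf
  rw [show δ - (3 - 2 * δ) = -3 + 3 * δ by ring] at hpb
  calc _ = weight N σ r ^ 2 * weight N σ l ^ 2 * weight N σ h ^ 2 := by ring
    _ ≤ ((4 * (n / N)) ^ (2 * σ) * (4 * n) ^ δ * (1 + r) ^ (-(2 + δ))) * (1 + l) ^ (-(1 + δ)) *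
        ((4 * (n / N)) ^ (2 * σ) * ((n / 80) ^ (-(3 - 2 * δ)) * h ^ (1 - 2 * δ))) := by gcongr
    _ = ((4 * (n / N)) ^ (4 * σ) * (4 * n) ^ δ * (n / 80) ^ (-(3 - 2 * δ))) *
        ((1 + r) ^ (-(2 + δ)) * (1 + l) ^ (-(1 + δ)) * h ^ (1 - 2 * δ)) := by rw [e4]; ring
    _ ≤ _ := by
        unfold gain
        gcongr

/-- Here the two large frequencies give `n⁻²` and `n^{-1+δ}`, the rest of the weight in `l` being
kept for the fiber integral. All three weights lose powers of `n/N`, in total `6σ`, and `6σ < 3` is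
again `s > 1/2`. -/
theorem weight_parallel_le {N σ δ n r l h : ℝ} (hN : 1 ≤ N) (hσ : 0 ≤ σ) (hδ : 0 < δ)
    (hδ1 : δ ≤ 1 / 4) (hσδ : 2 * σ + 2 * δ ≤ 1) (hn : N / 3 ≤ n) (hr : 0 ≤ r) (hrn : r ≤ n)
    (hl : n / 80 ≤ l) (hln : l ≤ n) (hh : n / 80 ≤ h) (hhn : h ≤ n) :
    weight N σ r * weight N σ l * weight N σ h ≤
      √(gain N δ * ((1 + r) ^ (-(2 + δ)) * (1 + l) ^ (-(1 + δ)))) := by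
  have hN0 : 0 < N := by linarith
  have hn0 : 0 < n := by linarith
  have hn80 : 0 < n / 80 := by positivity
  have hh0 : 0 < h := by linarith
  have hl0 : 0 < l := by linarith
  have hnN : 0 ≤ n / N := by positivity
  refine Real.le_sqrt_of_sq_le ?_
  have w1 := weight_sq_le_free hN hσ hδ.le hr hrn hn
  have w2 : weight N σ l ^ 2 ≤ (4 * (n / N)) ^ (2 * σ) *
      ((n / 80) ^ (-(1 - δ)) * (1 + l) ^ (-(1 + δ))) := by
    refine (weight_sq_le_of_le hN hσ hl0.le hln hn).trans ?_
    gcongr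
    exact rpow_neg_split hn80 hl (by linarith) (by ring)
  have w3 : weight N σ h ^ 2 ≤ (4 * (n / N)) ^ (2 * σ) * (n / 80) ^ (-2 : ℝ) := by
    refine (weight_sq_le_of_le hN hσ hh0.le hhn hn).trans ?_
    exact mul_le_mul_of_nonneg_left
      (Real.rpow_le_rpow_of_nonpos hn80 (by linarith) (by norm_num)) (by positivity)
  have hν : 1 / 3 ≤ n / N := by rw [le_div_iff₀ hN0]; linarith
  have hpb := power_bound (p := 6 * σ) (q := 3 - δ) hν hN (by linarith) hδ.le (by linarith)
    (by linarith) (by linarith)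
  rw [div_mul_cancel₀ _ hN0.ne'] at hpb
  have hmono : N ^ (δ - (3 - δ)) ≤ N ^ (-3 + 3 * δ) :=
    Real.rpow_le_rpow_of_exponent_le hN (by linarith)
  have e4 : (4 * (n / N)) ^ (6 * σ) = (4 * (n / N)) ^ (2 * σ) * (4 * (n / N)) ^ (2 * σ) *
      (4 * (n / N)) ^ (2 * σ) := by
    rw [← Real.rpow_add (by positivity), ← Real.rpow_add (by positivity)]; ring_nf
  have e5 : (n / 80) ^ (-(3 - δ)) = (n / 80) ^ (-(1 - δ)) * (n / 80) ^ (-2 : ℝ) := by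
    rw [← Real.rpow_add hn80]; ring_nf
  calc _ = weight N σ r ^ 2 * weight N σ l ^ 2 * weight N σ h ^ 2 := by ring
    _ ≤ ((4 * (n / N)) ^ (2 * σ) * (4 * n) ^ δ * (1 + r) ^ (-(2 + δ))) *
        ((4 * (n / N)) ^ (2 * σ) * ((n / 80) ^ (-(1 - δ)) * (1 + l) ^ (-(1 + δ)))) *
        ((4 * (n / N)) ^ (2 * σ) * (n / 80) ^ (-2 : ℝ)) := by gcongr
    _ = ((4 * (n / N)) ^ (6 * σ) * (4 * n) ^ δ * (n / 80) ^ (-(3 - δ))) *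
        ((1 + r) ^ (-(2 + δ)) * (1 + l) ^ (-(1 + δ))) := by rw [e4, e5]; ring
    _ ≤ _ := by
        unfold gain
        exact mul_le_mul_of_nonneg_right
          (hpb.trans (mul_le_mul_of_nonneg_left hmono (by norm_num))) (by positivity)

/-! ### Arrangement of the frequencies -/

/-- The sign of the `j`-th frequency in the resonance function. -/
def altSign (j : Fin 6) : ℝ := if (j : ℕ) % 2 = 0 then 1 else -1

theorem altSign_eq (j : Fin 6) : altSign j = 1 ∨ altSign j = -1 := by
  unfold altSign; split_ifs <;> simp

/-- In each half, positions `2` and `5` hold the high frequency, `1` and `4` its partner, and `0`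
and `3` the unpaired one. The full symmetric group is transitive on quadruples of distinct indices.
-/
theorem exists_perm_of_ne {i₀ i₁ l₁ l₂ : Fin 6} (h1 : i₀ ≠ i₁) (h2 : i₀ ≠ l₁) (h3 : i₀ ≠ l₂)
    (h4 : i₁ ≠ l₁) (h5 : i₁ ≠ l₂) (h6 : l₁ ≠ l₂) :
    ∃ e : Equiv.Perm (Fin 6), e 2 = i₀ ∧ e 5 = i₁ ∧ e 1 = l₁ ∧ e 4 = l₂ := by
  have hp := Equiv.Perm.isMultiplyPretransitive (Fin 6) 4
  let x : Fin 4 ↪ Fin 6 := ⟨![2, 5, 1, 4], by decide⟩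
  let y : Fin 4 ↪ Fin 6 := ⟨![i₀, i₁, l₁, l₂], by
    intro a b hab
    fin_cases a <;> fin_cases b <;> simp_all⟩
  obtain ⟨e, he⟩ := hp.exists_smul_eq x y
  have h : ∀ k, e (x k) = y k := fun k => DFunLike.congr_fun he k
  exact ⟨e, h 0, h 1, h 2, h 3⟩

/-- The index `j` is sent to the unpaired position `0`; the two others of its parity form one pair,
and two of the three of the other parity form the second. -/
theorem exists_perm_parity (j : Fin 6) :
    ∃ e : Equiv.Perm (Fin 6), altSign (e 2) = altSign (e 1) ∧ altSign (e 5) = altSign (e 4) ∧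
      e 1 ≠ j ∧ e 2 ≠ j ∧ e 4 ≠ j ∧ e 5 ≠ j := by
  have key : ∃ f : Fin 6 → Fin 6, Function.Injective f ∧ (f 2 : ℕ) % 2 = (f 1 : ℕ) % 2 ∧
      (f 5 : ℕ) % 2 = (f 4 : ℕ) % 2 ∧ f 1 ≠ j ∧ f 2 ≠ j ∧ f 4 ≠ j ∧ f 5 ≠ j := by
    fin_cases j
    · exact ⟨![0, 2, 4, 1, 3, 5], by decide⟩
    · exact ⟨![1, 3, 5, 0, 2, 4], by decide⟩
    · exact ⟨![2, 0, 4, 1, 3, 5], by decide⟩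
    · exact ⟨![3, 1, 5, 0, 2, 4], by decide⟩
    · exact ⟨![4, 2, 0, 1, 3, 5], by decide⟩
    · exact ⟨![5, 1, 3, 0, 2, 4], by decide⟩
  obtain ⟨f, hf, h1, h2, h⟩ := key
  exact ⟨Equiv.ofBijective f (Finite.injective_iff_bijective.1 hf),
    by simp only [altSign, Equiv.ofBijective_apply, h1],
    by simp only [altSign, Equiv.ofBijective_apply, h2], h⟩

/-- Either two small frequencies can be paired with two large ones, or all frequencies but one are
comparable to the largest. -/
theorem exists_arrangement {ξ : Fin 6 → Plane} (h : ξ ∈ hyper 6) {N : ℝ} (hN : 1 ≤ N)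
    (hlarge : ∃ j, N / 3 < ‖ξ j‖) :
    ∃ n : ℝ, N / 3 ≤ n ∧ (∀ j, ‖ξ j‖ ≤ n) ∧ ∃ e : Equiv.Perm (Fin 6),
      n / 80 ≤ ‖ξ (e 2)‖ ∧ n / 80 ≤ ‖ξ (e 5)‖ ∧
      ((transversal (ξ (e 2)) (ξ (e 1)) ∧ transversal (ξ (e 5)) (ξ (e 4))) ∨
        (n / 80 ≤ ‖ξ (e 1)‖ ∧ n / 80 ≤ ‖ξ (e 4)‖ ∧
          altSign (e 2) = altSign (e 1) ∧ altSign (e 5) = altSign (e 4))) := by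
  obtain ⟨i₀, -, hi₀⟩ := Finset.exists_max_image Finset.univ (fun k => ‖ξ k‖)
    ⟨0, Finset.mem_univ 0⟩
  have hmax : ∀ j, ‖ξ j‖ ≤ ‖ξ i₀‖ := fun j => hi₀ j (Finset.mem_univ j)
  obtain ⟨j, hj⟩ := hlarge
  have hn : N / 3 ≤ ‖ξ i₀‖ := hj.le.trans (hmax j)
  refine ⟨‖ξ i₀‖, hn, hmax, ?_⟩
  set n := ‖ξ i₀‖ with hndef
  have hn0 : 0 < n := by linarith
  by_cases hlow : ∃ l₁ l₂ : Fin 6, l₁ ≠ l₂ ∧ ‖ξ l₁‖ < n / 80 ∧ ‖ξ l₂‖ < n / 80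
  · obtain ⟨l₁, l₂, hne, h1, h2⟩ := hlow
    -- The largest frequency is minus the sum of the five others. A low frequency is below `n/80 =
    -- (n/5)/16`, and `n/5 ≥ 1/15 > 1/20`, so both pairs are transversal.
    obtain ⟨i₁, hi₁, hbig⟩ : ∃ i₁, i₁ ≠ i₀ ∧ n / 5 ≤ ‖ξ i₁‖ := by
      by_contra hcon
      push Not at hcon
      have hs : ∑ k ∈ Finset.univ.erase i₀, ξ k = -ξ i₀ := by
        have h' : ∑ k, ξ k = 0 := h
        rw [← Finset.add_sum_erase _ _ (Finset.mem_univ i₀)] at h'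
        exact (neg_eq_of_add_eq_zero_right h').symm
      have hlt : ‖∑ k ∈ Finset.univ.erase i₀, ξ k‖ < n := by
        refine (norm_sum_le _ _).trans_lt ?_
        have hne : (Finset.univ.erase i₀).Nonempty := by
          rw [← Finset.card_pos, Finset.card_erase_of_mem (Finset.mem_univ _)]
          simp
        calc _ < ∑ k ∈ Finset.univ.erase i₀, n / 5 :=
              Finset.sum_lt_sum_of_nonempty hne fun k hk => hcon k (Finset.ne_of_mem_erase hk)
          _ = n := by
              rw [Finset.sum_const, Finset.card_erase_of_mem (Finset.mem_univ _)]
              simp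
              ring
      rw [hs, norm_neg] at hlt
      exact lt_irrefl _ hlt
    have n1 : i₀ ≠ l₁ := fun hh => by rw [← hh] at h1; linarith
    have n2 : i₀ ≠ l₂ := fun hh => by rw [← hh] at h2; linarith
    have n3 : i₁ ≠ l₁ := fun hh => by rw [← hh] at h1; linarith
    have n4 : i₁ ≠ l₂ := fun hh => by rw [← hh] at h2; linarith
    obtain ⟨e, e2, e5, e1, e4⟩ := exists_perm_of_ne hi₁.symm n1 n2 n3 n4 hne
    refine ⟨e, ?_⟩
    rw [e1, e2, e4, e5]
    exact ⟨by linarith, by linarith,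
      Or.inl ⟨⟨by linarith, by linarith⟩, ⟨by linarith, by linarith⟩⟩⟩
  · push Not at hlow
    obtain ⟨j, hj⟩ : ∃ j : Fin 6, ∀ k, k ≠ j → n / 80 ≤ ‖ξ k‖ := by
      by_cases hex : ∃ j, ‖ξ j‖ < n / 80
      · obtain ⟨j, hj⟩ := hex
        exact ⟨j, fun k hk => hlow j k hk.symm hj⟩
      · push Not at hex
        exact ⟨0, fun k _ => hex k⟩
    obtain ⟨e, s1, s2, m1, m2, m4, m5⟩ := exists_perm_parity j
    exact ⟨e, hj _ m2, hj _ m5, Or.inr ⟨hj _ m1, hj _ m4, s1, s2⟩⟩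

end

end IMethod

namespace IMethod

noncomputable section

/-! ### The weighted sextilinear estimate on the frequency side -/

/-- The sum of the two kernels. -/
def totalKernel (δ : ℝ) (η : Fin 6 → ℝ) (B : ℝ) (ξ : Fin 6 → Plane) : ℝ≥0∞ :=
  parallelKernel δ η B ξ + transversalKernel δ η B ξ

theorem measurable_totalKernel (δ : ℝ) (η : Fin 6 → ℝ) (B : ℝ) :
    Measurable (totalKernel δ η B) :=
  (measurable_parallelKernel δ η B).add (measurable_transversalKernel δ η B)

/-- The constant in the fiber bound of `totalKernel`. -/
def kernelConst (δ : ℝ) : ℝ≥0∞ :=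
  planeConst δ * (ENNReal.ofReal (2 * Real.pi) * lineConst δ) +
    planeConst δ * (4 * (7202 * lineConst δ + 4) * lineConst δ)

theorem kernelConst_lt_top {δ : ℝ} (hδ : 0 < δ) : kernelConst δ < ⊤ := by
  have h1 := planeConst_lt_top hδ
  have h2 := lineConst_lt_top hδ
  unfold kernelConst
  finiteness

theorem fiberBound_totalKernel {δ : ℝ} (hδ : 0 < δ) (hδ1 : δ ≤ 1 / 2) {η : Fin 6 → ℝ}
    (hη : ∀ j, η j = 1 ∨ η j = -1) (B : ℝ) :
    FiberBound (totalKernel δ η B) (kernelConst δ) := by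
  intro a b c
  have hm : Measurable fun d : Plane => ∫⁻ e : Plane,
      parallelKernel δ η B ![a, b, c, d, e, -(a + b + c + d + e)] :=
    Measurable.lintegral_prod_right'
      ((measurable_parallelKernel δ η B).comp (measurable_vec_last_two a b c))
  have e1 : ∀ d : Plane, ∫⁻ e : Plane, totalKernel δ η B ![a, b, c, d, e, -(a + b + c + d + e)] =
      (∫⁻ e : Plane, parallelKernel δ η B ![a, b, c, d, e, -(a + b + c + d + e)]) +
      ∫⁻ e : Plane, transversalKernel δ η B ![a, b, c, d, e, -(a + b + c + d + e)] := fun d =>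
    lintegral_add_left ((measurable_parallelKernel δ η B).comp (measurable_vec_last a b c d)) _
  simp only [e1]
  rw [lintegral_add_left hm]
  exact add_le_add (fiberBound_parallelKernel hδ hη B a b c)
    (fiberBound_transversalKernel hδ hδ1 hη B a b c)

theorem kern_pos (x : ℝ) : 0 < kern x := by unfold kern; positivity

/-- Each triple receives the square root of the oscillatory kernel and of the gain, so that squaring
in the Schur test restores one full copy of each. The sum of the two kernels covers both
alternatives. -/
theorem weight_half_le {N σ δ n B : ℝ} (hN : 1 ≤ N) (hσ : 0 ≤ σ) (hδ : 0 < δ)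
    (hδ1 : δ ≤ 1 / 4) (hσδ : 2 * σ + 2 * δ ≤ 1) (hn : N / 3 ≤ n) {η : Fin 6 → ℝ}
    {ζ : Fin 6 → Plane} (hζ : ∀ j, ‖ζ j‖ ≤ n) (h5 : n / 80 ≤ ‖ζ 5‖)
    (h : transversal (ζ 5) (ζ 4) ∨ (n / 80 ≤ ‖ζ 4‖ ∧ η 5 = η 4)) :
    ENNReal.ofReal (weight N σ ‖ζ 3‖ * weight N σ ‖ζ 4‖ * weight N σ ‖ζ 5‖ *
      √(kern (signedForm η ζ + B))) ≤
      ENNReal.ofReal (√(gain N δ)) * totalKernel δ η B ζ ^ (1 / 2 : ℝ) := by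
  have hk := kern_pos (signedForm η ζ + B)
  have hg : 0 ≤ gain N δ := gain_nonneg hN
  have key : ∀ v : ℝ, 0 ≤ v → weight N σ ‖ζ 3‖ * weight N σ ‖ζ 4‖ * weight N σ ‖ζ 5‖ ≤
      √(gain N δ * v) → ENNReal.ofReal (v * kern (signedForm η ζ + B)) ≤ totalKernel δ η B ζ →
      ENNReal.ofReal (weight N σ ‖ζ 3‖ * weight N σ ‖ζ 4‖ * weight N σ ‖ζ 5‖ *
      √(kern (signedForm η ζ + B))) ≤
      ENNReal.ofReal (√(gain N δ)) * totalKernel δ η B ζ ^ (1 / 2 : ℝ) := by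
    intro v hv hw hT
    calc _ ≤ ENNReal.ofReal (√(gain N δ * v) * √(kern (signedForm η ζ + B))) :=
          ENNReal.ofReal_le_ofReal (mul_le_mul_of_nonneg_right hw (Real.sqrt_nonneg _))
      _ = ENNReal.ofReal (√(gain N δ)) *
          ENNReal.ofReal (v * kern (signedForm η ζ + B)) ^ (1 / 2 : ℝ) := by
          rw [ENNReal.ofReal_rpow_of_nonneg (by positivity) (by norm_num),
            ← Real.sqrt_eq_rpow, ← ENNReal.ofReal_mul (Real.sqrt_nonneg _),
            Real.sqrt_mul hg, Real.sqrt_mul hv, mul_assoc]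
      _ ≤ _ := by gcongr
  rcases h with h | ⟨h4, hη⟩
  · refine key ((1 + ‖ζ 3‖) ^ (-(2 + δ)) * (1 + ‖ζ 4‖) ^ (-(1 + δ)) * ‖ζ 5‖ ^ (1 - 2 * δ))
      (by positivity)
      (weight_transversal_le hN hσ hδ hδ1 hσδ hn (norm_nonneg _) (hζ 3) (norm_nonneg _) h5 (hζ 5))
      ?_
    rw [totalKernel, transversalKernel, Set.indicator_of_mem (by exact h)]
    exact le_add_self
  · refine key ((1 + ‖ζ 3‖) ^ (-(2 + δ)) * (1 + ‖ζ 4‖) ^ (-(1 + δ)))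
      (by positivity)
      (weight_parallel_le hN hσ hδ hδ1 hσδ hn (norm_nonneg _) (hζ 3) h4 (hζ 4) h5 (hζ 5)) ?_
    rw [totalKernel, parallelKernel, if_pos hη]
    exact le_self_add

theorem exists_perm_weight_le {N σ δ : ℝ} (hN : 1 ≤ N) (hσ : 0 ≤ σ) (hδ : 0 < δ)
    (hδ1 : δ ≤ 1 / 4) (hσδ : 2 * σ + 2 * δ ≤ 1) (B : ℝ) {ξ : Fin 6 → Plane} (h : ξ ∈ hyper 6)
    (hlarge : ∃ j, N / 3 < ‖ξ j‖) : ∃ e : Equiv.Perm (Fin 6),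
      ENNReal.ofReal ((∏ j, weight N σ ‖ξ j‖) * kern (signedForm altSign ξ + B)) ≤
        ENNReal.ofReal (gain N δ) * (totalKernel δ (altSign ∘ e) B (ξ ∘ e) ^ (1 / 2 : ℝ) *
          totalKernel δ ((altSign ∘ e) ∘ swapHalves) B ((ξ ∘ e) ∘ swapHalves) ^ (1 / 2 : ℝ)) := by
  obtain ⟨n, hn, hmax, e, h2, h5, hcase⟩ := exists_arrangement h hN hlarge
  refine ⟨e, ?_⟩
  have hk := kern_pos (signedForm altSign ξ + B)
  have A := weight_half_le (B := B) hN hσ hδ hδ1 hσδ hn (η := altSign ∘ e) (ζ := ξ ∘ e)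
    (fun j => hmax _) h5 (hcase.imp (fun h => h.2) fun h => ⟨h.2.1, h.2.2.2⟩)
  have A' := weight_half_le (B := B) hN hσ hδ hδ1 hσδ hn (η := (altSign ∘ e) ∘ swapHalves)
    (ζ := (ξ ∘ e) ∘ swapHalves) (fun j => hmax _) h2
    (hcase.imp (fun h => h.1) fun h => ⟨h.1, h.2.2.1⟩)
  rw [signedForm_comp, signedForm_comp] at A'
  rw [signedForm_comp] at A
  calc _ = ENNReal.ofReal ((weight N σ ‖ξ (e 3)‖ * weight N σ ‖ξ (e 4)‖ * weight N σ ‖ξ (e 5)‖ *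
        √(kern (signedForm altSign ξ + B))) *
        (weight N σ ‖ξ (e 0)‖ * weight N σ ‖ξ (e 1)‖ * weight N σ ‖ξ (e 2)‖ *
        √(kern (signedForm altSign ξ + B)))) := by
        congr 1
        rw [← Equiv.prod_comp e, Fin.prod_univ_six]
        have := Real.mul_self_sqrt hk.le
        linear_combination (-(weight N σ ‖ξ (e 0)‖ * weight N σ ‖ξ (e 1)‖ *
          weight N σ ‖ξ (e 2)‖ * weight N σ ‖ξ (e 3)‖ * weight N σ ‖ξ (e 4)‖ *
          weight N σ ‖ξ (e 5)‖)) * this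
    _ = ENNReal.ofReal (weight N σ ‖ξ (e 3)‖ * weight N σ ‖ξ (e 4)‖ * weight N σ ‖ξ (e 5)‖ *
        √(kern (signedForm altSign ξ + B))) *
        ENNReal.ofReal (weight N σ ‖ξ (e 0)‖ * weight N σ ‖ξ (e 1)‖ * weight N σ ‖ξ (e 2)‖ *
        √(kern (signedForm altSign ξ + B))) := by
        have hw : ∀ j, 0 ≤ weight N σ ‖ξ j‖ := fun j => weight_nonneg hN (norm_nonneg _)
        refine ENNReal.ofReal_mul (mul_nonneg (mul_nonneg (mul_nonneg (hw _) (hw _)) (hw _))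
          (Real.sqrt_nonneg _))
    _ ≤ _ := mul_le_mul' A A'
    _ = _ := by
        rw [← Real.mul_self_sqrt (gain_nonneg (δ := δ) hN),
          ENNReal.ofReal_mul (Real.sqrt_nonneg _)]
        simp only [Real.mul_self_sqrt (gain_nonneg (δ := δ) hN)]
        ring

theorem measurableSet_exists_norm_gt (r : ℝ) :
    MeasurableSet {ξ : Fin 6 → Plane | ∃ j, r < ‖ξ j‖} := by
  rw [Set.ofPred_exists]
  exact MeasurableSet.iUnion fun j => measurableSet_lt measurable_const (by fun_prop)

/-- The weighted sextilinear estimate for frozen modulations. -/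
theorem lintegral_weighted_le {N σ δ : ℝ} (hN : 1 ≤ N) (hσ : 0 ≤ σ) (hδ : 0 < δ)
    (hδ1 : δ ≤ 1 / 4) (hσδ : 2 * σ + 2 * δ ≤ 1) (B : ℝ) {H : Fin 6 → Plane → ℝ≥0∞}
    (hH : ∀ j, Measurable (H j)) :
    ∫⁻ ξ in {ξ : Fin 6 → Plane | ∃ j, N / 3 < ‖ξ j‖}, (∏ j, H j (ξ j)) *
        ENNReal.ofReal ((∏ j, weight N σ ‖ξ j‖) * kern (signedForm altSign ξ + B))
        ∂hyperMeasure 5 ≤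
      720 * kernelConst δ * ENNReal.ofReal (gain N δ) *
        ∏ j, (∫⁻ x, H j x ^ 2) ^ (1 / 2 : ℝ) := by
  have hmeas : ∀ e : Equiv.Perm (Fin 6), Measurable fun ζ : Fin 6 → Plane =>
      (∏ j, H (e j) (ζ j)) * (totalKernel δ (altSign ∘ e) B ζ ^ (1 / 2 : ℝ) *
        totalKernel δ ((altSign ∘ e) ∘ swapHalves) B (ζ ∘ swapHalves) ^ (1 / 2 : ℝ)) := by
    intro e
    have h1 := measurable_totalKernel δ (altSign ∘ e) B
    have h2 := (measurable_totalKernel δ ((altSign ∘ e) ∘ swapHalves) B).comp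
      (measurable_pi_lambda (fun ζ : Fin 6 → Plane => ζ ∘ swapHalves)
        fun j => measurable_pi_apply _)
    refine Measurable.mul (Finset.measurable_fun_prod _ fun j _ => (hH _).comp
      (measurable_pi_apply j)) ((h1.pow_const _).mul (h2.pow_const _))
  have hcomp : ∀ e : Equiv.Perm (Fin 6), Measurable fun ξ : Fin 6 → Plane => ξ ∘ e := fun e =>
    measurable_pi_lambda _ fun j => measurable_pi_apply _
  calc _ ≤ ∫⁻ ξ in {ξ : Fin 6 → Plane | ∃ j, N / 3 < ‖ξ j‖},
        ∑ e : Equiv.Perm (Fin 6), ENNReal.ofReal (gain N δ) * ((∏ j, H (e j) ((ξ ∘ e) j)) *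
          (totalKernel δ (altSign ∘ e) B (ξ ∘ e) ^ (1 / 2 : ℝ) *
          totalKernel δ ((altSign ∘ e) ∘ swapHalves) B ((ξ ∘ e) ∘ swapHalves) ^ (1 / 2 : ℝ)))
          ∂hyperMeasure 5 := by
        refine lintegral_mono_ae ?_
        filter_upwards [ae_restrict_of_ae (ae_mem_hyper 5),
          ae_restrict_mem (measurableSet_exists_norm_gt (N / 3))] with ξ hξ hξ'
        obtain ⟨e, he⟩ := exists_perm_weight_le hN hσ hδ hδ1 hσδ B hξ hξ'
        -- The good permutation depends on the point; summing over all `720` of them avoids a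
        -- measurable choice.
        refine le_trans ?_ (Finset.single_le_sum (fun _ _ => zero_le) (Finset.mem_univ e))
        have hp : ∏ j, H (e j) ((ξ ∘ e) j) = ∏ j, H j (ξ j) :=
          Equiv.prod_comp e fun j => H j (ξ j)
        rw [hp]
        calc _ ≤ _ := mul_le_mul_right he _
          _ = _ := by ring
    _ ≤ ∫⁻ ξ, ∑ e : Equiv.Perm (Fin 6), ENNReal.ofReal (gain N δ) *
        ((∏ j, H (e j) ((ξ ∘ e) j)) *
          (totalKernel δ (altSign ∘ e) B (ξ ∘ e) ^ (1 / 2 : ℝ) *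
          totalKernel δ ((altSign ∘ e) ∘ swapHalves) B ((ξ ∘ e) ∘ swapHalves) ^ (1 / 2 : ℝ)))
          ∂hyperMeasure 5 := setLIntegral_le_lintegral _ _
    _ = ∑ e : Equiv.Perm (Fin 6), ENNReal.ofReal (gain N δ) *
        ∫⁻ ζ, (∏ j, H (e j) (ζ j)) * (totalKernel δ (altSign ∘ e) B ζ ^ (1 / 2 : ℝ) *
          totalKernel δ ((altSign ∘ e) ∘ swapHalves) B (ζ ∘ swapHalves) ^ (1 / 2 : ℝ))
          ∂hyperMeasure 5 := by
        refine (lintegral_finsetSum _ fun e _ =>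
          ((hmeas e).comp (hcomp e)).const_mul (ENNReal.ofReal (gain N δ))).trans ?_
        refine Finset.sum_congr rfl fun e _ => ?_
        refine (lintegral_const_mul _ ((hmeas e).comp (hcomp e))).trans ?_
        congr 1
        exact lintegral_comp_perm e (hmeas e)
    _ ≤ ∑ e : Equiv.Perm (Fin 6), ENNReal.ofReal (gain N δ) * (kernelConst δ *
        ∏ j, (∫⁻ x, H j x ^ 2) ^ (1 / 2 : ℝ)) := by
        refine Finset.sum_le_sum fun e _ => mul_le_mul_right ?_ _
        rw [← Equiv.prod_comp e fun j => (∫⁻ x, H j x ^ 2) ^ (1 / 2 : ℝ)]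
        exact lintegral_prod_mul_kernel_le (measurable_totalKernel _ _ _)
          (measurable_totalKernel _ _ _)
          (fiberBound_totalKernel hδ (by linarith) (fun j => altSign_eq _) B)
          (fiberBound_totalKernel hδ (by linarith) (fun j => altSign_eq _) B) fun j => hH (e j)
    _ = _ := by
        rw [Finset.sum_const, Finset.card_univ, Fintype.card_perm, Fintype.card_fin, nsmul_eq_mul]
        norm_num [Nat.factorial]
        ring

end

end IMethod

namespace IMethod

noncomputable section

/-! ### Absolute convergence -/

/-- The kernel for the absolute convergence of the sextilinear form. -/
def decayKernel (s : ℝ) (ξ : Fin 6 → Plane) : ℝ≥0∞ :=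
  ENNReal.ofReal ((1 + ‖ξ 3‖) ^ (-2 : ℝ) * (1 + ‖ξ 4‖) ^ (-(2 * s)) * (1 + ‖ξ 5‖) ^ (-(2 * s)))

theorem measurable_decayKernel (s : ℝ) : Measurable (decayKernel s) := by
  unfold decayKernel; fun_prop

theorem one_add_norm_le_mul (c e : Plane) : 1 + ‖c‖ ≤ (1 + ‖e‖) * (1 + ‖c - e‖) := by
  have h1 : ‖c‖ ≤ ‖e‖ + ‖c - e‖ := by
    calc ‖c‖ = ‖e + (c - e)‖ := by rw [add_sub_cancel]
      _ ≤ _ := norm_add_le _ _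
  nlinarith [mul_nonneg (norm_nonneg e) (norm_nonneg (c - e))]

/-- Each planar integral needs total decay beyond `2`, which the first weight `-2` just misses. An
exponent `θ = s - 1/2` is borrowed from each of the other two; by the triangle inequality it becomes
decay in the sum of the last two frequencies. What is left there, `2s + 1`, still exceeds `2`. -/
theorem fiberBound_decayKernel {s : ℝ} (hs : 1 / 2 < s) :
    FiberBound (decayKernel s)
      (2 * planeConst (2 * s - 1) * (2 * planeConst ((2 * s - 1) / 2))) := by
  intro a b c
  set θ := (2 * s - 1) / 2 with hθ
  have hθ0 : 0 < θ := by rw [hθ]; linarith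
  set c' := -(a + b + c) with hc'
  have hpt : ∀ d e : Plane, decayKernel s ![a, b, c, d, e, -(a + b + c + d + e)] ≤
      ENNReal.ofReal ((1 + ‖d‖) ^ (-2 : ℝ) * (1 + ‖c' - d‖) ^ (-θ)) *
      ENNReal.ofReal ((1 + ‖e‖) ^ (-(s + 1 / 2)) * (1 + ‖c' - d - e‖) ^ (-(s + 1 / 2))) := by
    intro d e
    rw [decayKernel, ← ENNReal.ofReal_mul (by positivity)]
    refine ENNReal.ofReal_le_ofReal ?_
    have hneg : -(a + b + c + d + e) = c' - d - e := by rw [hc']; abel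
    simp only [Matrix.cons_val, hneg]
    have e1 : ∀ x : ℝ, 0 ≤ x → (1 + x) ^ (-(2 * s)) = (1 + x) ^ (-θ) * (1 + x) ^ (-(s + 1 / 2)) :=
      fun x hx => by rw [← Real.rpow_add (by linarith), hθ]; ring_nf
    have e2 : (1 + ‖e‖) ^ (-θ) * (1 + ‖c' - d - e‖) ^ (-θ) ≤ (1 + ‖c' - d‖) ^ (-θ) := by
      rw [← Real.mul_rpow (by positivity) (by positivity)]
      exact Real.rpow_le_rpow_of_nonpos (by positivity) (one_add_norm_le_mul _ _) (by linarith)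
    rw [e1 _ (norm_nonneg e), e1 _ (norm_nonneg (c' - d - e))]
    calc _ = (1 + ‖d‖) ^ (-2 : ℝ) * ((1 + ‖e‖) ^ (-θ) * (1 + ‖c' - d - e‖) ^ (-θ)) *
          ((1 + ‖e‖) ^ (-(s + 1 / 2)) * (1 + ‖c' - d - e‖) ^ (-(s + 1 / 2))) := by ring
      _ ≤ _ := by gcongr
  calc _ ≤ ∫⁻ d : Plane, ∫⁻ e : Plane,
        ENNReal.ofReal ((1 + ‖d‖) ^ (-2 : ℝ) * (1 + ‖c' - d‖) ^ (-θ)) *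
        ENNReal.ofReal ((1 + ‖e‖) ^ (-(s + 1 / 2)) * (1 + ‖c' - d - e‖) ^ (-(s + 1 / 2))) :=
        lintegral_mono fun d => lintegral_mono fun e => hpt d e
    _ ≤ ∫⁻ d : Plane, ENNReal.ofReal ((1 + ‖d‖) ^ (-2 : ℝ) * (1 + ‖c' - d‖) ^ (-θ)) *
        (2 * planeConst (2 * s - 1)) := by
        refine lintegral_mono fun d => ?_
        rw [lintegral_const_mul' _ _ ENNReal.ofReal_ne_top]
        exact mul_le_mul_right (lintegral_plane_two_weights_le (by linarith) (by linarith)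
          (by ring) _) _
    _ = (∫⁻ d : Plane, ENNReal.ofReal ((1 + ‖d‖) ^ (-2 : ℝ) * (1 + ‖c' - d‖) ^ (-θ))) *
        (2 * planeConst (2 * s - 1)) := lintegral_mul_const _ (by fun_prop)
    _ ≤ _ := by
        rw [mul_comm]
        exact mul_le_mul_right (lintegral_plane_two_weights_le (by norm_num) hθ0.le rfl c') _

/-- The rearrangement which puts the arguments `ξ₃, ξ₅, ξ₆` into the second half. -/
def regroup : Equiv.Perm (Fin 6) :=
  Equiv.ofBijective ![3, 0, 1, 4, 2, 5] (Finite.injective_iff_bijective.1 (by decide))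

theorem weight_le_rpow {N s x : ℝ} (hN : 1 ≤ N) (hs' : s < 1) (hx : 0 ≤ x) :
    weight N (1 - s) x ≤ (1 + x) ^ (-s) := by
  have h1 : (1 + x / N) ^ (1 - s) ≤ (1 + x) ^ (1 - s) := by
    have := div_le_self hx hN
    exact Real.rpow_le_rpow (by positivity) (by linarith) (by linarith)
  calc _ ≤ (1 + x) ^ (1 - s) * (1 + x)⁻¹ := by unfold weight; gcongr
    _ = _ := by
        rw [← Real.rpow_neg_one, ← Real.rpow_add (by linarith)]; ring_nf

/-- The decay `(1 + |ξ|/N)^{-(2-2s)}` is shared between two arguments by a geometric mean, which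
improves two of the six weights from exponent `-s` to `-1`, one for each half. The constant depends
on `N`, which is harmless: only finiteness is at stake. -/
theorem exists_sigmaFourTilde_mul_weight_le {s : ℝ} (hs : 1 / 2 < s) (hs' : s < 1)
    (φ : Profile s) {N θ₀ : ℝ} (hN : 1 ≤ N) (hθ : 0 < θ₀) (hθ1 : θ₀ < 1) :
    ∃ C : ℝ, ∀ ζ ∈ hyper 6,
      ENNReal.ofReal (‖sigmaFourTilde φ N θ₀ (contract ζ)‖ * ∏ j, weight N (1 - s) ‖ζ j‖) ≤
        ENNReal.ofReal C * (decayKernel s (ζ ∘ regroup) ^ (1 / 2 : ℝ) *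
          decayKernel s ((ζ ∘ regroup) ∘ swapHalves) ^ (1 / 2 : ℝ)) := by
  obtain ⟨C, hC, hbound⟩ := exists_sigmaFourTilde_bound hs hs' φ
  have hN0 : 0 < N := by linarith
  refine ⟨C * θ₀⁻¹ * N ^ (2 - 2 * s), fun ζ hζ => ?_⟩
  set M := ‖sigmaFourTilde φ N θ₀ (contract ζ)‖ with hM
  set D := C * θ₀⁻¹ * N ^ (2 - 2 * s) with hD
  have hD0 : 0 ≤ D := by positivity
  have hdec : ∀ x : ℝ, 0 ≤ x →
      C * θ₀⁻¹ * (1 + x / N) ^ (-(2 - 2 * s)) ≤ D * (1 + x) ^ (-(2 - 2 * s)) := by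
    intro x hx
    have h1 : (1 + x) / N ≤ 1 + x / N := by
      rw [add_div]; gcongr; exact (div_le_one hN0).2 hN
    have h2 : (1 + x / N) ^ (-(2 - 2 * s)) ≤ ((1 + x) / N) ^ (-(2 - 2 * s)) :=
      Real.rpow_le_rpow_of_nonpos (by positivity) h1 (by linarith)
    have h3 : ((1 + x) / N) ^ (-(2 - 2 * s)) = N ^ (2 - 2 * s) * (1 + x) ^ (-(2 - 2 * s)) := by
      rw [Real.div_rpow (by positivity) hN0.le, Real.rpow_neg hN0.le, div_inv_eq_mul, mul_comm]
    calc _ ≤ C * θ₀⁻¹ * ((1 + x) / N) ^ (-(2 - 2 * s)) := by gcongr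
      _ = _ := by rw [h3, hD]; ring
  have b3 : M ≤ D * (1 + ‖ζ 3‖) ^ (-(2 - 2 * s)) :=
    (hbound N hN0 θ₀ hθ hθ1 _ (contract_mem hζ) 1).trans (hdec _ (norm_nonneg _))
  have b4 : M ≤ D * (1 + ‖ζ 4‖) ^ (-(2 - 2 * s)) :=
    (hbound N hN0 θ₀ hθ hθ1 _ (contract_mem hζ) 2).trans (hdec _ (norm_nonneg _))
  have hsq : ∀ x : ℝ, 0 ≤ x → (1 + x) ^ (-(2 - 2 * s)) = ((1 + x) ^ (-(1 - s))) ^ 2 := by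
    intro x hx
    rw [← Real.rpow_natCast, ← Real.rpow_mul (by linarith)]; norm_num; ring_nf
  have bM : M ≤ D * ((1 + ‖ζ 3‖) ^ (-(1 - s)) * (1 + ‖ζ 4‖) ^ (-(1 - s))) := by
    have hM0 : 0 ≤ M := norm_nonneg _
    rw [hsq _ (norm_nonneg _)] at b3 b4
    refine abs_le_of_sq_le_sq' ?_ (by positivity) |>.2
    calc M ^ 2 = M * M := sq M
      _ ≤ (D * ((1 + ‖ζ 3‖) ^ (-(1 - s))) ^ 2) * (D * ((1 + ‖ζ 4‖) ^ (-(1 - s))) ^ 2) :=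
        mul_le_mul b3 b4 hM0 (by positivity)
      _ = _ := by ring
  have hw0 : ∀ j, 0 ≤ weight N (1 - s) ‖ζ j‖ := fun j => weight_nonneg hN (norm_nonneg _)
  have hprod : ∏ j, weight N (1 - s) ‖ζ j‖ ≤ ∏ j, (1 + ‖ζ j‖) ^ (-s) :=
    Finset.prod_le_prod (fun j _ => hw0 j) fun j _ => weight_le_rpow hN hs' (norm_nonneg _)
  have hroot : ∀ x y z : ℝ, 0 ≤ x → 0 ≤ y → 0 ≤ z →
      ENNReal.ofReal ((1 + x) ^ (-2 : ℝ) * (1 + y) ^ (-(2 * s)) * (1 + z) ^ (-(2 * s))) ^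
        (1 / 2 : ℝ) = ENNReal.ofReal ((1 + x) ^ (-1 : ℝ) * (1 + y) ^ (-s) * (1 + z) ^ (-s)) := by
    intro x y z hx hy hz
    rw [ENNReal.ofReal_rpow_of_nonneg (by positivity) (by norm_num),
      Real.mul_rpow (by positivity) (by positivity), Real.mul_rpow (by positivity) (by positivity),
      ← Real.rpow_mul (by positivity), ← Real.rpow_mul (by positivity),
      ← Real.rpow_mul (by positivity)]
    norm_num
    ring_nf
  rw [decayKernel, decayKernel, hroot _ _ _ (norm_nonneg _) (norm_nonneg _) (norm_nonneg _),
    hroot _ _ _ (norm_nonneg _) (norm_nonneg _) (norm_nonneg _),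
    ← ENNReal.ofReal_mul (by positivity), ← ENNReal.ofReal_mul hD0]
  refine ENNReal.ofReal_le_ofReal ?_
  have hone : ∀ x : ℝ, 0 ≤ x → (1 + x) ^ (-1 : ℝ) = (1 + x) ^ (-(1 - s)) * (1 + x) ^ (-s) :=
    fun x hx => by rw [← Real.rpow_add (by linarith)]; ring_nf
  change M * _ ≤ D * ((1 + ‖ζ 4‖) ^ (-1 : ℝ) * (1 + ‖ζ 2‖) ^ (-s) * (1 + ‖ζ 5‖) ^ (-s) *
    ((1 + ‖ζ 3‖) ^ (-1 : ℝ) * (1 + ‖ζ 0‖) ^ (-s) * (1 + ‖ζ 1‖) ^ (-s)))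
  rw [hone _ (norm_nonneg (ζ 3)), hone _ (norm_nonneg (ζ 4))]
  calc _ ≤ D * ((1 + ‖ζ 3‖) ^ (-(1 - s)) * (1 + ‖ζ 4‖) ^ (-(1 - s))) *
        ∏ j, (1 + ‖ζ j‖) ^ (-s) :=
        mul_le_mul bM hprod (Finset.prod_nonneg fun j _ => hw0 j) (by positivity)
    _ = _ := by rw [Fin.prod_univ_six]; ring

/-- The sextilinear form converges absolutely on the weighted `L²` spaces. -/
theorem lintegral_sextilinearSymbol_lt_top {s : ℝ} (hs : 1 / 2 < s) (hs' : s < 1)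
    (φ : Profile s) {N θ₀ : ℝ} (hN : 1 ≤ N) (hθ : 0 < θ₀) (hθ1 : θ₀ < 1)
    {H : Fin 6 → Plane → ℝ≥0∞} (hH : ∀ j, Measurable (H j))
    (hfin : ∀ j, ∫⁻ x, H j x ^ 2 < ⊤) :
    ∫⁻ ξ, ‖sextilinearSymbol φ N θ₀ ξ‖ₑ * ((∏ j, H j (ξ j)) *
      ENNReal.ofReal (∏ j, weight N (1 - s) ‖ξ j‖)) ∂hyperMeasure 5 < ⊤ := by
  obtain ⟨C, hC⟩ := exists_sigmaFourTilde_mul_weight_le hs hs' φ hN hθ hθ1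
  set F : Equiv.Perm (Fin 6) → (Fin 6 → Plane) → ℝ≥0∞ := fun e ζ =>
    4 * ENNReal.ofReal C * ((∏ j, H ((regroup.trans e) j) (ζ j)) *
      (decayKernel s ζ ^ (1 / 2 : ℝ) * decayKernel s (ζ ∘ swapHalves) ^ (1 / 2 : ℝ))) with hF
  have hFm : ∀ e, Measurable (F e) := by
    intro e
    have h1 := measurable_decayKernel s
    have h2 := h1.comp (measurable_pi_lambda (fun ζ : Fin 6 → Plane => ζ ∘ swapHalves)
        fun j => measurable_pi_apply _)
    exact ((Finset.measurable_fun_prod _ fun j _ => (hH _).comp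
      (measurable_pi_apply j)).mul ((h1.pow_const _).mul (h2.pow_const _))).const_mul _
  have hcomp : ∀ e : Equiv.Perm (Fin 6), Measurable fun ξ : Fin 6 → Plane => ξ ∘ e := fun e =>
    measurable_pi_lambda _ fun j => measurable_pi_apply _
  have hpt : ∀ᵐ ξ ∂hyperMeasure 5, ‖sextilinearSymbol φ N θ₀ ξ‖ₑ * ((∏ j, H j (ξ j)) *
      ENNReal.ofReal (∏ j, weight N (1 - s) ‖ξ j‖)) ≤
      ∑ e : Equiv.Perm (Fin 6), F e (ξ ∘ (regroup.trans e)) := by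
    filter_upwards [ae_mem_hyper 5] with ξ hξ
    have hw0 : 0 ≤ ∏ j, weight N (1 - s) ‖ξ j‖ :=
      Finset.prod_nonneg fun j _ => weight_nonneg hN (norm_nonneg _)
    calc _ = (∏ j, H j (ξ j)) * ENNReal.ofReal (‖sextilinearSymbol φ N θ₀ ξ‖ *
          ∏ j, weight N (1 - s) ‖ξ j‖) := by
          rw [ENNReal.ofReal_mul (norm_nonneg _), ofReal_norm]; ring
      _ ≤ (∏ j, H j (ξ j)) * ∑ e : Equiv.Perm (Fin 6), 4 * ENNReal.ofReal
          (‖sigmaFourTilde φ N θ₀ (contract (ξ ∘ e))‖ * ∏ j, weight N (1 - s) ‖ξ j‖) := by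
          gcongr
          calc _ ≤ ENNReal.ofReal ((∑ e : Equiv.Perm (Fin 6),
                4 * ‖sigmaFourTilde φ N θ₀ (contract (ξ ∘ e))‖) *
                ∏ j, weight N (1 - s) ‖ξ j‖) :=
                ENNReal.ofReal_le_ofReal (mul_le_mul_of_nonneg_right
                  (norm_sextilinearSymbol_le φ N θ₀ ξ) hw0)
            _ = _ := by
                rw [Finset.sum_mul, ENNReal.ofReal_sum_of_nonneg fun e _ => by positivity]
                refine Finset.sum_congr rfl fun e _ => ?_
                rw [mul_assoc, ENNReal.ofReal_mul (by norm_num), ENNReal.ofReal_ofNat]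
      _ ≤ _ := by
          rw [Finset.mul_sum]
          refine Finset.sum_le_sum fun e _ => ?_
          have h1 := hC (ξ ∘ e) (comp_perm_mem_hyper hξ e)
          have h2 : ∏ j, weight N (1 - s) ‖(ξ ∘ e) j‖ = ∏ j, weight N (1 - s) ‖ξ j‖ :=
            Equiv.prod_comp e fun j => weight N (1 - s) ‖ξ j‖
          have h3 : ∏ j, H ((regroup.trans e) j) ((ξ ∘ (regroup.trans e)) j) = ∏ j, H j (ξ j) :=
            Equiv.prod_comp (regroup.trans e) fun j => H j (ξ j)
          rw [h2] at h1
          simp only [hF, h3]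
          calc _ ≤ (∏ j, H j (ξ j)) * (4 * _) := mul_le_mul_right (mul_le_mul_right h1 _) _
            _ = _ := by
              simp only [Equiv.coe_trans, Function.comp_assoc]
              ring
  refine (lintegral_mono_ae hpt).trans_lt ?_
  refine (lintegral_finsetSum _ fun e _ => (hFm e).comp (hcomp _)).trans_lt ?_
  refine ENNReal.sum_lt_top.2 fun e _ => ?_
  refine (lintegral_comp_perm (regroup.trans e) (hFm e)).trans_lt ?_
  simp only [hF]
  rw [lintegral_const_mul' _ _ (by finiteness)]
  refine ENNReal.mul_lt_top (by finiteness) ?_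
  refine (lintegral_prod_mul_kernel_le (measurable_decayKernel s) (measurable_decayKernel s)
    (fiberBound_decayKernel hs) (fiberBound_decayKernel hs) fun j => hH _).trans_lt ?_
  have h1 := planeConst_lt_top (δ := 2 * s - 1) (by linarith)
  have h2 := planeConst_lt_top (δ := (2 * s - 1) / 2) (by linarith)
  refine ENNReal.mul_lt_top (by finiteness) (ENNReal.prod_lt_top fun j _ => ?_)
  exact ENNReal.rpow_lt_top_of_nonneg (by norm_num) (hfin _).ne

end

end IMethod

namespace IMethod

noncomputable section

/-! ### Modulation weights -/

theorem lintegral_fin_prod {n : ℕ} {f : Fin n → ℝ → ℝ≥0∞} (hf : ∀ j, Measurable (f j)) :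
    ∫⁻ x : Fin n → ℝ, ∏ j, f j (x j) = ∏ j, ∫⁻ x, f j x := by
  induction n with
  | zero =>
    have : (volume : Measure (Fin 0 → ℝ)) = Measure.dirac ![] := Measure.volume_pi_eq_dirac _
    simp [this]
  | succ n ih =>
    have h := (volume_preserving_piFinSuccAbove (fun _ : Fin (n + 1) => ℝ) 0).symm
    have hm : Measurable fun x : Fin (n + 1) → ℝ => ∏ j, f j (x j) :=
      Finset.measurable_fun_prod _ fun j _ => (hf j).comp (measurable_pi_apply j)
    rw [← h.lintegral_comp hm, Measure.volume_eq_prod]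
    have e : ∀ q : ℝ × (Fin n → ℝ), ∏ j, f j ((MeasurableEquiv.piFinSuccAbove
        (fun _ : Fin (n + 1) => ℝ) 0).symm q j) = f 0 q.1 * ∏ j : Fin n, f j.succ (q.2 j) := by
      intro q
      rw [Fin.prod_univ_succ]
      simp [MeasurableEquiv.piFinSuccAbove]
    simp only [e]
    have hm' : Measurable fun x : Fin n → ℝ => ∏ j : Fin n, f j.succ (x j) :=
      Finset.measurable_fun_prod _ fun j _ => (hf j.succ).comp (measurable_pi_apply j)
    rw [lintegral_prod_mul (hf 0).aemeasurable hm'.aemeasurable, ih fun j => hf j.succ,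
      Fin.prod_univ_succ]

theorem japanese_pos (r : ℝ) : 0 < japanese r := by unfold japanese; positivity

theorem continuous_japanese : Continuous japanese := by unfold japanese; fun_prop

/-- The integral of `⟨λ⟩^{-2b}`. -/
def modulationConst (b : ℝ) : ℝ≥0∞ := ∫⁻ x : ℝ, ENNReal.ofReal (japanese x ^ (-(2 * b)))

theorem modulationConst_lt_top {b : ℝ} (hb : 1 / 2 < b) : modulationConst b < ⊤ := by
  have h := integrable_rpow_neg_one_add_norm_sq (E := ℝ) (μ := volume) (r := 2 * b)
    (by simp; linarith)
  have h2 := h.lintegral_lt_top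
  refine lt_of_eq_of_lt (lintegral_congr fun x => ?_) h2
  congr 1
  rw [japanese, Real.sqrt_eq_rpow, ← Real.rpow_mul (by positivity), Real.norm_eq_abs, sq_abs]
  ring_nf

theorem rpow_half_sq (x : ℝ≥0∞) : (x ^ (1 / 2 : ℝ)) ^ 2 = x := by
  rw [← ENNReal.rpow_natCast, ← ENNReal.rpow_mul]; norm_num

theorem sq_rpow_half (x : ℝ≥0∞) : (x ^ 2) ^ (1 / 2 : ℝ) = x := by
  rw [← ENNReal.rpow_natCast, ← ENNReal.rpow_mul]; norm_num

/-- Cauchy–Schwarz after inserting `⟨x + c⟩^{-b} ⟨x + c⟩^{b}`; the constant is finite when `b >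
1/2`. -/
theorem lintegral_le_modulation (b : ℝ) {f : ℝ → ℝ≥0∞} (hf : Measurable f) (c : ℝ) :
    ∫⁻ x, f x ≤ modulationConst b ^ (1 / 2 : ℝ) *
      (∫⁻ x, (ENNReal.ofReal (japanese (x + c) ^ b) * f x) ^ 2) ^ (1 / 2 : ℝ) := by
  have hj := continuous_japanese.measurable
  have hol := ENNReal.lintegral_mul_le_Lp_mul_Lq volume Real.HolderConjugate.two_two
    (f := fun x : ℝ => ENNReal.ofReal (japanese (x + c) ^ (-b)))
    (g := fun x => ENNReal.ofReal (japanese (x + c) ^ b) * f x)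
    (by fun_prop) (by fun_prop)
  have e1 : ∫⁻ x : ℝ, ENNReal.ofReal (japanese (x + c) ^ (-b)) ^ (2 : ℝ) =
      modulationConst b := by
    rw [modulationConst, ← lintegral_add_right_eq_self
      (fun x => ENNReal.ofReal (japanese x ^ (-(2 * b)))) c]
    refine lintegral_congr fun x => ?_
    rw [ENNReal.ofReal_rpow_of_nonneg (Real.rpow_nonneg (japanese_pos _).le _) (by norm_num),
      ← Real.rpow_mul (japanese_pos _).le]
    ring_nf
  calc _ = ∫⁻ x, ((fun x : ℝ => ENNReal.ofReal (japanese (x + c) ^ (-b))) *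
        fun x => ENNReal.ofReal (japanese (x + c) ^ b) * f x) x := by
        refine lintegral_congr fun x => ?_
        rw [Pi.mul_apply, ← mul_assoc, ← ENNReal.ofReal_mul
          (Real.rpow_nonneg (japanese_pos _).le _), ← Real.rpow_add (japanese_pos _)]
        simp
    _ ≤ _ := hol
    _ = _ := by
        rw [e1]
        simp only [ENNReal.rpow_ofNat]

/-- The square of the `X^{s,b}` norm with spatial weight `a`. -/
def energy (b : ℝ) (a : Plane → ℝ) (V : ℝ × Plane → ℂ) : ℝ≥0∞ :=
  ∫⁻ ξ : Plane, ∫⁻ τ : ℝ,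
    (ENNReal.ofReal (a ξ * japanese (τ + ‖ξ‖ ^ 2) ^ b) * ‖V (τ, ξ)‖ₑ) ^ 2

variable {b : ℝ} {a : Plane → ℝ} {V : ℝ × Plane → ℂ}

/-- The frequency-side form of the embedding of `X^{·,b}` into bounded functions of time; it
supplies the functions in the absolute convergence argument. -/
theorem lintegral_sq_time_le (hb : 1 / 2 < b) (hV : Measurable V) (ha : ∀ ξ, 0 ≤ a ξ) :
    ∫⁻ ξ : Plane, (ENNReal.ofReal (a ξ) * ∫⁻ τ : ℝ, ‖V (τ, ξ)‖ₑ) ^ 2 ≤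
      modulationConst b * energy b a V := by
  have hj := continuous_japanese.measurable
  rw [energy]
  rw [← lintegral_const_mul' _ _ (modulationConst_lt_top hb).ne]
  refine lintegral_mono fun ξ => ?_
  have h := lintegral_le_modulation b (f := fun τ => ‖V (τ, ξ)‖ₑ) (by fun_prop) (‖ξ‖ ^ 2)
  calc _ ≤ (ENNReal.ofReal (a ξ) * (modulationConst b ^ (1 / 2 : ℝ) * (∫⁻ τ,
        (ENNReal.ofReal (japanese (τ + ‖ξ‖ ^ 2) ^ b) * ‖V (τ, ξ)‖ₑ) ^ 2) ^ (1 / 2 : ℝ))) ^ 2 := by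
        gcongr
    _ = _ := by
        rw [mul_pow, mul_pow, rpow_half_sq, rpow_half_sq, mul_left_comm,
          ← lintegral_const_mul _ (by fun_prop)]
        congr 1
        refine lintegral_congr fun τ => ?_
        rw [ENNReal.ofReal_mul (ha ξ), mul_pow, mul_pow, mul_pow, mul_assoc]

/-- Here `l` is the modulation `τ + |ξ|²`, taken as the outer variable: the left side is a sum over
parabolic layers of the weighted `L²` norms. -/
theorem lintegral_time_sq_le (hV : Measurable V) (ha : ∀ ξ, 0 ≤ a ξ)
    (ham : Measurable a) :
    ∫⁻ l : ℝ, (∫⁻ ξ : Plane, (ENNReal.ofReal (a ξ) * ‖V (l - ‖ξ‖ ^ 2, ξ)‖ₑ) ^ 2) ^ (1 / 2 : ℝ) ≤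
      modulationConst b ^ (1 / 2 : ℝ) * energy b a V ^ (1 / 2 : ℝ) := by
  have hj := continuous_japanese.measurable
  have hm : Measurable fun q : ℝ × Plane =>
      (ENNReal.ofReal (a q.2) * ‖V (q.1 - ‖q.2‖ ^ 2, q.2)‖ₑ) ^ 2 := by fun_prop
  refine (lintegral_le_modulation b ((hm.lintegral_prod_right').pow_const _) 0).trans ?_
  gcongr
  calc _ = ∫⁻ l : ℝ, ∫⁻ ξ : Plane,
        (ENNReal.ofReal (a ξ * japanese l ^ b) * ‖V (l - ‖ξ‖ ^ 2, ξ)‖ₑ) ^ 2 := by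
        refine lintegral_congr fun l => ?_
        rw [mul_pow, rpow_half_sq, ← lintegral_const_mul' _ _ (by finiteness)]
        refine lintegral_congr fun ξ => ?_
        rw [ENNReal.ofReal_mul (ha ξ), add_zero]
        ring
    _ = ∫⁻ ξ : Plane, ∫⁻ l : ℝ,
        (ENNReal.ofReal (a ξ * japanese l ^ b) * ‖V (l - ‖ξ‖ ^ 2, ξ)‖ₑ) ^ 2 :=
        lintegral_lintegral_swap (by fun_prop)
    _ ≤ energy b a V := by
        rw [energy]
        refine lintegral_mono fun ξ => le_of_eq ?_
        rw [← lintegral_add_right_eq_self _ (‖ξ‖ ^ 2)]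
        simp

/-- For a conjugated factor only `ξ` is reflected. The sign of the time frequency is carried by the
coefficient `-1` in `timeWave`, so both types of factor live on the same paraboloid. -/
theorem energy_reflect (ha : ∀ ξ, a (-ξ) = a ξ) :
    energy b a (fun q => conj (V (q.1, -q.2))) = energy b a V := by
  rw [energy, energy, ← lintegral_neg_eq_self]
  simp [ha]

end

end IMethod

namespace IMethod

noncomputable section

/-! ### Integration in time -/

/-- The trivial bound `t₀ ≤ 1` and the bound `2/|x|` from the primitive; both are below `3/(1 +
|x|)` on their side of the crossover `|x| = 2`. -/
theorem norm_integral_exp_le {t₀ : ℝ} (h0 : 0 ≤ t₀) (h1 : t₀ ≤ 1) (x : ℝ) :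
    ‖∫ t in (0 : ℝ)..t₀, Complex.exp (Complex.I * ((t * x : ℝ) : ℂ))‖ ≤ 3 * kern x := by
  have hexp : ∀ r : ℝ, ‖Complex.exp (Complex.I * (r : ℂ))‖ = 1 := fun r => by
    rw [mul_comm]; exact Complex.norm_exp_ofReal_mul_I r
  have ha : 0 ≤ |x| := abs_nonneg x
  have hk : 3 * kern x = 3 / (1 + |x|) := by rw [kern, div_eq_mul_inv]
  rw [hk]
  rcases le_or_gt |x| 2 with h | h
  · have := intervalIntegral.norm_integral_le_of_norm_le_const (a := 0) (b := t₀) (C := 1)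
      (f := fun t : ℝ => Complex.exp (Complex.I * ((t * x : ℝ) : ℂ))) fun t _ => (hexp _).le
    refine this.trans ?_
    rw [sub_zero, abs_of_nonneg h0, one_mul, le_div_iff₀ (by positivity)]
    nlinarith
  · have hx : (x : ℂ) ≠ 0 := by
      rw [Complex.ofReal_ne_zero]; rintro rfl; norm_num at h
    have e := integral_exp_mul_complex (a := 0) (b := t₀) (mul_ne_zero Complex.I_ne_zero hx)
    have e' : ∀ t : ℝ, Complex.I * ((t * x : ℝ) : ℂ) = Complex.I * x * t := fun t => by
      push_cast; ring
    simp only [e']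
    rw [e, norm_div, norm_mul, Complex.norm_I, one_mul, Complex.norm_real, Real.norm_eq_abs,
      div_le_div_iff₀ (by linarith) (by positivity)]
    have hn : ‖Complex.exp (Complex.I * x * t₀) - Complex.exp (Complex.I * x * (0 : ℝ))‖ ≤ 2 := by
      refine (norm_sub_le _ _).trans ?_
      rw [← e', ← e', hexp, hexp]
      norm_num
    nlinarith [norm_nonneg (Complex.exp (Complex.I * x * t₀) -
      Complex.exp (Complex.I * x * (0 : ℝ)))]

theorem enorm_finset_prod {ι : Type*} (s : Finset ι) (f : ι → ℂ) :
    ‖∏ j ∈ s, f j‖ₑ = ∏ j ∈ s, ‖f j‖ₑ := by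
  rw [← ofReal_norm, norm_prod, ENNReal.ofReal_prod_of_nonneg fun _ _ => norm_nonneg _]
  simp only [ofReal_norm]

/-- The superposition `∫ exp(i c t τ) V(τ,ξ) dτ` of time oscillations. -/
def timeWave (c : ℝ) (V : ℝ × Plane → ℂ) (t : ℝ) (ξ : Plane) : ℂ :=
  ∫ τ : ℝ, Complex.exp (Complex.I * ((t * (c * τ) : ℝ) : ℂ)) * V (τ, ξ)

/-- The integrand of the sextilinear form in space-time frequencies. -/
def spaceTimeIntegrand (M : (Fin 6 → Plane) → ℂ) (V : Fin 6 → ℝ × Plane → ℂ)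
    (p : (Fin 6 → Plane) × (Fin 6 → ℝ)) : ℂ := M p.1 * ∏ j, V j (p.2 j, p.1 j)

/-- The time oscillation of the integrand. -/
def phase (c : Fin 6 → ℝ) (t : ℝ) (τ : Fin 6 → ℝ) : ℂ :=
  Complex.exp (Complex.I * ((t * ∑ j, c j * τ j : ℝ) : ℂ))

theorem norm_phase (c : Fin 6 → ℝ) (t : ℝ) (τ : Fin 6 → ℝ) : ‖phase c t τ‖ = 1 := by
  rw [phase, mul_comm]; exact Complex.norm_exp_ofReal_mul_I _

theorem mul_prod_timeWave (M : (Fin 6 → Plane) → ℂ) (V : Fin 6 → ℝ × Plane → ℂ) (c : Fin 6 → ℝ)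
    (t : ℝ) (ξ : Fin 6 → Plane) :
    M ξ * ∏ j, timeWave (c j) (V j) t (ξ j) =
      ∫ τ, phase c t τ * spaceTimeIntegrand M V (ξ, τ) := by
  unfold timeWave
  rw [← integral_fintype_prod_volume_eq_prod (fun j (τ : ℝ) =>
    Complex.exp (Complex.I * ((t * (c j * τ) : ℝ) : ℂ)) * V j (τ, ξ j)), ← integral_const_mul]
  refine integral_congr_ae (Filter.Eventually.of_forall fun τ => ?_)
  simp only [Finset.prod_mul_distrib, ← Complex.exp_sum, phase, spaceTimeIntegrand]
  rw [Finset.mul_sum, Complex.ofReal_sum, Finset.mul_sum]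
  ring

section

variable {μ : Measure (Fin 6 → Plane)} {M : (Fin 6 → Plane) → ℂ}
  {V : Fin 6 → ℝ × Plane → ℂ} (hM : Measurable M) (hV : ∀ j, Measurable (V j))

include hM hV in
theorem measurable_spaceTimeIntegrand : Measurable (spaceTimeIntegrand M V) := by
  unfold spaceTimeIntegrand
  have h1 : Measurable fun p : (Fin 6 → Plane) × (Fin 6 → ℝ) => ∏ j, V j (p.2 j, p.1 j) :=
    Finset.measurable_fun_prod _ fun j _ => (hV j).comp (by fun_prop)
  exact (hM.comp measurable_fst).mul h1

variable (hfin : ∫⁻ ξ, ‖M ξ‖ₑ * ∏ j, (∫⁻ τ : ℝ, ‖V j (τ, ξ j)‖ₑ) ∂μ < ⊤)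

include hM hV hfin

theorem integrable_spaceTimeIntegrand : Integrable (spaceTimeIntegrand M V) (μ.prod volume) := by
  have hm := measurable_spaceTimeIntegrand hM hV
  refine ⟨hm.aestronglyMeasurable, ?_⟩
  rw [hasFiniteIntegral_iff_enorm, lintegral_prod _ hm.enorm.aemeasurable]
  refine lt_of_eq_of_lt (lintegral_congr fun ξ => ?_) hfin
  have he : ∀ τ : Fin 6 → ℝ, ‖spaceTimeIntegrand M V (ξ, τ)‖ₑ =
      ‖M ξ‖ₑ * ∏ j, ‖V j (τ j, ξ j)‖ₑ := fun τ => by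
    rw [spaceTimeIntegrand, enorm_mul, enorm_finset_prod]
  simp only [he]
  have hVj : ∀ j, Measurable fun τ : ℝ => ‖V j (τ, ξ j)‖ₑ := fun j =>
    ((hV j).comp measurable_prodMk_right).enorm
  rw [lintegral_const_mul' _ _ enorm_ne_top, lintegral_fin_prod hVj]

theorem integrable_phase_mul_slice (c : Fin 6 → ℝ) (t : ℝ) :
    Integrable (fun p : (Fin 6 → Plane) × (Fin 6 → ℝ) =>
      phase c t p.2 * spaceTimeIntegrand M V p) (μ.prod volume) := by
  refine (integrable_spaceTimeIntegrand hM hV hfin).bdd_mul (c := 1) ?_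
    (Filter.Eventually.of_forall fun q => (norm_phase _ _ _).le)
  have : Continuous fun p : (Fin 6 → Plane) × (Fin 6 → ℝ) => phase c t p.2 := by
    unfold phase; fun_prop
  exact this.aestronglyMeasurable

theorem integrable_mul_prod_timeWave (c : Fin 6 → ℝ) (t : ℝ) :
    Integrable (fun ξ => M ξ * ∏ j, timeWave (c j) (V j) t (ξ j)) μ := by
  simp only [mul_prod_timeWave]
  exact (integrable_phase_mul_slice hM hV hfin c t).integral_prod_left

variable [SFinite μ]

theorem integrable_phase_mul {t₀ : ℝ} (c : Fin 6 → ℝ) :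
    Integrable (fun q : ℝ × ((Fin 6 → Plane) × (Fin 6 → ℝ)) =>
      phase c q.1 q.2.2 * spaceTimeIntegrand M V q.2)
      ((volume.restrict (Set.Ioc 0 t₀)).prod (μ.prod volume)) := by
  have h := (integrable_spaceTimeIntegrand hM hV hfin).comp_snd (volume.restrict (Set.Ioc 0 t₀))
  refine h.bdd_mul (c := 1) ?_ (Filter.Eventually.of_forall fun q => (norm_phase _ _ _).le)
  have : Continuous fun q : ℝ × ((Fin 6 → Plane) × (Fin 6 → ℝ)) => phase c q.1 q.2.2 := by
    unfold phase; fun_prop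
  exact this.aestronglyMeasurable

theorem integral_mul_prod_timeWave (c : Fin 6 → ℝ) (t : ℝ) :
    ∫ ξ, M ξ * ∏ j, timeWave (c j) (V j) t (ξ j) ∂μ =
      ∫ p, phase c t p.2 * spaceTimeIntegrand M V p ∂(μ.prod volume) := by
  simp only [mul_prod_timeWave]
  exact (integral_prod _ (integrable_phase_mul_slice hM hV hfin c t)).symm

theorem intervalIntegrable_integral_timeWave {t₀ : ℝ} (h0 : 0 ≤ t₀) (c : Fin 6 → ℝ) :
    IntervalIntegrable (fun t => ∫ ξ, M ξ * ∏ j, timeWave (c j) (V j) t (ξ j) ∂μ) volume 0 t₀ := by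
  rw [intervalIntegrable_iff_integrableOn_Ioc_of_le h0]
  simp only [integral_mul_prod_timeWave hM hV hfin]
  exact (integrable_phase_mul hM hV hfin c).integral_prod_left

/-- Absolute integrability in all frequencies allows the time integral to be taken first, before
absolute values; this is the only place where oscillation in time is used. -/
theorem enorm_integral_timeWave_le {t₀ : ℝ} (h0 : 0 ≤ t₀) (h1 : t₀ ≤ 1) (c : Fin 6 → ℝ) :
    ‖∫ t in (0 : ℝ)..t₀, ∫ ξ, M ξ * ∏ j, timeWave (c j) (V j) t (ξ j) ∂μ‖ₑ ≤
      3 * ∫⁻ ξ, (∫⁻ τ : Fin 6 → ℝ, ‖M ξ‖ₑ * ((∏ j, ‖V j (τ j, ξ j)‖ₑ) *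
        ENNReal.ofReal (kern (∑ j, c j * τ j)))) ∂μ := by
  have hm := measurable_spaceTimeIntegrand hM hV
  have hkm := continuous_kern.measurable
  have e1 : ∫ t in (0 : ℝ)..t₀, ∫ ξ, M ξ * ∏ j, timeWave (c j) (V j) t (ξ j) ∂μ =
      ∫ p, (∫ t in (0 : ℝ)..t₀, phase c t p.2) * spaceTimeIntegrand M V p ∂(μ.prod volume) := by
    simp only [integral_mul_prod_timeWave hM hV hfin]
    rw [intervalIntegral.integral_of_le h0]
    refine (integral_integral_swap (integrable_phase_mul hM hV hfin c)).trans ?_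
    refine integral_congr_ae (Filter.Eventually.of_forall fun p => ?_)
    simp only
    rw [intervalIntegral.integral_of_le h0, integral_mul_const]
  rw [e1]
  have hmeas : Measurable fun p : (Fin 6 → Plane) × (Fin 6 → ℝ) =>
      ENNReal.ofReal (kern (∑ j, c j * p.2 j)) * ‖spaceTimeIntegrand M V p‖ₑ := by
    refine Measurable.mul ?_ hm.enorm
    fun_prop
  calc _ ≤ ∫⁻ p, ‖(∫ t in (0 : ℝ)..t₀, phase c t p.2) * spaceTimeIntegrand M V p‖ₑ
        ∂(μ.prod volume) := enorm_integral_le_lintegral_enorm _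
    _ ≤ ∫⁻ p : (Fin 6 → Plane) × (Fin 6 → ℝ), 3 * (ENNReal.ofReal (kern (∑ j, c j * p.2 j)) * ‖spaceTimeIntegrand M V p‖ₑ)
        ∂(μ.prod volume) := by
        refine lintegral_mono fun p => ?_
        rw [enorm_mul, ← mul_assoc]
        gcongr
        rw [← ofReal_norm, ← ENNReal.ofReal_ofNat 3, ← ENNReal.ofReal_mul (by norm_num)]
        exact ENNReal.ofReal_le_ofReal (norm_integral_exp_le h0 h1 _)
    _ = 3 * ∫⁻ p : (Fin 6 → Plane) × (Fin 6 → ℝ), (ENNReal.ofReal (kern (∑ j, c j * p.2 j)) * ‖spaceTimeIntegrand M V p‖ₑ)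
        ∂(μ.prod volume) := lintegral_const_mul' _ _ (by norm_num)
    _ = _ := by
        rw [lintegral_prod _ hmeas.aemeasurable]
        congr 1
        refine lintegral_congr fun ξ => lintegral_congr fun τ => ?_
        rw [spaceTimeIntegrand, enorm_mul, enorm_finset_prod]
        ring

end

end

end IMethod

namespace IMethod

noncomputable section

/-! ### The space-time estimate -/

theorem Profile.half_rpow_le {s : ℝ} (hs : 0 < s) (hs' : s < 1) (φ : Profile s) {r : ℝ}
    (hr : 0 ≤ r) : 1 / 2 * (1 + r) ^ (-(1 - s)) ≤ φ.toFun r := by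
  have h1 : (1 + r) ^ (-(1 - s)) ≤ 1 :=
    Real.rpow_le_one_of_one_le_of_nonpos (by linarith) (by linarith)
  rcases le_or_gt r 2 with h | h
  · have h2 : φ.toFun 2 ≤ φ.toFun r := φ.antitone h
    have h3 : (1 / 2 : ℝ) ≤ 2 ^ (s - 1) := by
      calc (1 / 2 : ℝ) = 2 ^ (-1 : ℝ) := by rw [Real.rpow_neg_one]; norm_num
        _ ≤ 2 ^ (s - 1) := Real.rpow_le_rpow_of_exponent_le (by norm_num) (by linarith)
    rw [φ.eq_rpow 2 le_rfl] at h2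
    linarith
  · rw [φ.eq_rpow r h.le]
    have h2 : (1 + r) ^ (-(1 - s)) ≤ r ^ (-(1 - s)) :=
      Real.rpow_le_rpow_of_nonpos (by linarith) (by linarith) (by linarith)
    have h3 : 0 ≤ (1 + r) ^ (-(1 - s)) := by positivity
    rw [show s - 1 = -(1 - s) by ring]
    linarith

/-- The spatial weight `m(ξ) ⟨ξ⟩` of the modified energy space. -/
def spatialWeight {s : ℝ} (φ : Profile s) (N : ℝ) (ξ : Plane) : ℝ :=
  symb φ N ξ * japanese ‖ξ‖

theorem spatialWeight_nonneg {s : ℝ} (φ : Profile s) (N : ℝ) (ξ : Plane) :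
    0 ≤ spatialWeight φ N ξ := mul_nonneg (φ.nonneg _) (japanese_pos _).le

theorem spatialWeight_neg {s : ℝ} (φ : Profile s) (N : ℝ) (ξ : Plane) :
    spatialWeight φ N (-ξ) = spatialWeight φ N ξ := by
  rw [spatialWeight, spatialWeight, symb_neg, norm_neg]

theorem measurable_spatialWeight {s : ℝ} (φ : Profile s) (N : ℝ) :
    Measurable (spatialWeight φ N) :=
  (measurable_symb φ N).mul (continuous_japanese.measurable.comp measurable_norm)

/-- One factor `2` comes from the lower bound for `m`, the other from `⟨ξ⟩ ≥ (1 + |ξ|)/2`. Over six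
factors the constant becomes `4⁶ = 4096`. -/
theorem one_le_weight_mul_spatialWeight {s : ℝ} (hs : 0 < s) (hs' : s < 1) (φ : Profile s)
    {N : ℝ} (hN : 1 ≤ N) (ξ : Plane) :
    1 ≤ 4 * weight N (1 - s) ‖ξ‖ * spatialWeight φ N ξ := by
  have hr : 0 ≤ ‖ξ‖ := norm_nonneg ξ
  have hrN : 0 ≤ ‖ξ‖ / N := by positivity
  have h1 := φ.half_rpow_le hs hs' hrN
  have h2 : (1 + ‖ξ‖) / 2 ≤ japanese ‖ξ‖ := Real.le_sqrt_of_sq_le (by nlinarith)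
  have h3 : (1 + ‖ξ‖ / N) ^ (1 - s) * (1 + ‖ξ‖ / N) ^ (-(1 - s)) = 1 := by
    rw [← Real.rpow_add (by positivity)]; simp
  have hw := weight_nonneg (σ := 1 - s) hN hr
  calc (1 : ℝ) = ((1 + ‖ξ‖ / N) ^ (1 - s) * (1 + ‖ξ‖ / N) ^ (-(1 - s))) *
        ((1 + ‖ξ‖)⁻¹ * (1 + ‖ξ‖)) := by rw [h3, inv_mul_cancel₀ (by positivity), one_mul]
    _ = 4 * weight N (1 - s) ‖ξ‖ *
        (1 / 2 * (1 + ‖ξ‖ / N) ^ (-(1 - s)) * ((1 + ‖ξ‖) / 2)) := by rw [weight]; ring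
    _ ≤ _ := by
        refine mul_le_mul_of_nonneg_left ?_ (by positivity)
        exact mul_le_mul h1 h2 (by positivity) (φ.nonneg _)

theorem prod_le_prod_weight {N σ : ℝ} (hN : 1 ≤ N) {a : Plane → ℝ}
    (haw : ∀ ξ, 1 ≤ 4 * weight N σ ‖ξ‖ * a ξ) (ξ : Fin 6 → Plane) (v : Fin 6 → ℝ≥0∞) :
    ∏ j, v j ≤ 4096 * ((∏ j, ENNReal.ofReal (a (ξ j)) * v j) *
      ENNReal.ofReal (∏ j, weight N σ ‖ξ j‖)) := by
  calc ∏ j, v j ≤ ∏ j, 4 * (ENNReal.ofReal (weight N σ ‖ξ j‖) *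
        (ENNReal.ofReal (a (ξ j)) * v j)) := by
        refine Finset.prod_le_prod' fun j _ => ?_
        have h := ENNReal.ofReal_le_ofReal (haw (ξ j))
        rw [ENNReal.ofReal_mul (mul_nonneg (by norm_num) (weight_nonneg hN (norm_nonneg (ξ j)))),
          ENNReal.ofReal_mul (by norm_num), ENNReal.ofReal_one, ENNReal.ofReal_ofNat] at h
        calc v j = 1 * v j := (one_mul _).symm
          _ ≤ _ := mul_le_mul_left h _
          _ = _ := by ring
    _ = _ := by
        rw [Finset.prod_mul_distrib, Finset.prod_mul_distrib,
          ENNReal.ofReal_prod_of_nonneg fun j _ => weight_nonneg hN (norm_nonneg _)]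
        simp only [Finset.prod_const, Finset.card_univ, Fintype.card_fin]
        norm_num
        ring

/-- For frozen modulations this is the weighted sextilinear estimate, uniform in the additive
constant of the resonance function. That uniformity is what lets the integral over the modulations
factor into six one-dimensional ones. -/
theorem lintegral_modulation_le {N σ δ b : ℝ} (hN : 1 ≤ N) (hσ : 0 ≤ σ) (hδ : 0 < δ)
    (hδ1 : δ ≤ 1 / 4) (hσδ : 2 * σ + 2 * δ ≤ 1) {a : Plane → ℝ} (ha : ∀ ξ, 0 ≤ a ξ)
    (ham : Measurable a) (haw : ∀ ξ, 1 ≤ 4 * weight N σ ‖ξ‖ * a ξ)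
    {M : (Fin 6 → Plane) → ℂ} (hM : Measurable M) {B : ℝ≥0∞}
    (hMB : ∀ᵐ ξ ∂hyperMeasure 5, ‖M ξ‖ₑ ≤ B)
    (hM0 : ∀ᵐ ξ ∂hyperMeasure 5, (∀ j, ‖ξ j‖ ≤ N / 3) → M ξ = 0)
    {V : Fin 6 → ℝ × Plane → ℂ} (hV : ∀ j, Measurable (V j)) :
    ∫⁻ ξ, (∫⁻ τ : Fin 6 → ℝ, ‖M ξ‖ₑ * ((∏ j, ‖V j (τ j, ξ j)‖ₑ) *
        ENNReal.ofReal (kern (∑ j, altSign j * τ j)))) ∂hyperMeasure 5 ≤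
      B * 4096 * (720 * kernelConst δ * ENNReal.ofReal (gain N δ)) *
        ∏ j, (modulationConst b ^ (1 / 2 : ℝ) * energy b a (V j) ^ (1 / 2 : ℝ)) := by
  have hk := continuous_kern.measurable
  have hsf := measurable_signedForm altSign
  set H : (Fin 6 → ℝ) → Fin 6 → Plane → ℝ≥0∞ := fun l j x =>
    ENNReal.ofReal (a x) * ‖V j (l j - ‖x‖ ^ 2, x)‖ₑ with hH
  have hHm : ∀ l j, Measurable (H l j) := fun l j => by
    have := hV j
    simp only [hH]; fun_prop
  -- The substitution `τ_j = l_j - |ξ_j|²`; evenness of the kernel fixes the sign of the quadratic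
  -- form.
  have hshift : ∀ ξ : Fin 6 → Plane, ∫⁻ τ : Fin 6 → ℝ, ‖M ξ‖ₑ * ((∏ j, ‖V j (τ j, ξ j)‖ₑ) *
      ENNReal.ofReal (kern (∑ j, altSign j * τ j))) =
      ∫⁻ l : Fin 6 → ℝ, ‖M ξ‖ₑ * ((∏ j, ‖V j (l j - ‖ξ j‖ ^ 2, ξ j)‖ₑ) *
      ENNReal.ofReal (kern (signedForm altSign ξ + -∑ j, altSign j * l j))) := by
    intro ξ
    rw [← lintegral_sub_right_eq_self _ (fun j => ‖ξ j‖ ^ 2)]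
    refine lintegral_congr fun l => ?_
    simp only [Pi.sub_apply]
    rw [← kern_neg]
    congr 4
    simp only [signedForm, mul_sub, Finset.sum_sub_distrib]
    ring
  have hmeas : Measurable fun p : (Fin 6 → Plane) × (Fin 6 → ℝ) =>
      ‖M p.1‖ₑ * ((∏ j, ‖V j (p.2 j - ‖p.1 j‖ ^ 2, p.1 j)‖ₑ) *
      ENNReal.ofReal (kern (signedForm altSign p.1 + -∑ j, altSign j * p.2 j))) := by
    have h1 : Measurable fun p : (Fin 6 → Plane) × (Fin 6 → ℝ) =>
        ∏ j, ‖V j (p.2 j - ‖p.1 j‖ ^ 2, p.1 j)‖ₑ :=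
      Finset.measurable_fun_prod _ fun j _ => ((hV j).comp (by fun_prop)).enorm
    refine (hM.comp measurable_fst).enorm.mul (h1.mul ?_)
    fun_prop
  have hfix : ∀ l : Fin 6 → ℝ, ∫⁻ ξ, ‖M ξ‖ₑ * ((∏ j, ‖V j (l j - ‖ξ j‖ ^ 2, ξ j)‖ₑ) *
      ENNReal.ofReal (kern (signedForm altSign ξ + -∑ j, altSign j * l j))) ∂hyperMeasure 5 ≤
      B * 4096 * (720 * kernelConst δ * ENNReal.ofReal (gain N δ)) *
        ∏ j, (∫⁻ x, H l j x ^ 2) ^ (1 / 2 : ℝ) := by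
    intro l
    set Bl := -∑ j, altSign j * l j with hBl
    have hS := measurableSet_exists_norm_gt (N / 3)
    calc _ ≤ ∫⁻ ξ, B * 4096 * {ξ : Fin 6 → Plane | ∃ j, N / 3 < ‖ξ j‖}.indicator
          (fun ξ => (∏ j, H l j (ξ j)) *
          ENNReal.ofReal ((∏ j, weight N σ ‖ξ j‖) * kern (signedForm altSign ξ + Bl))) ξ
          ∂hyperMeasure 5 := by
          refine lintegral_mono_ae ?_
          filter_upwards [hMB, hM0] with ξ h1 h2
          by_cases hξ : ∃ j, N / 3 < ‖ξ j‖
          · rw [Set.indicator_of_mem (by exact hξ), ENNReal.ofReal_mul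
              (Finset.prod_nonneg fun j _ => weight_nonneg hN (norm_nonneg _))]
            calc _ ≤ B * (4096 * ((∏ j, H l j (ξ j)) * ENNReal.ofReal (∏ j, weight N σ ‖ξ j‖)) *
                  ENNReal.ofReal (kern (signedForm altSign ξ + Bl))) := by
                  gcongr
                  exact prod_le_prod_weight hN haw ξ _
              _ = _ := by ring
          · push Not at hξ
            rw [h2 hξ]
            simp
      _ = B * 4096 * ∫⁻ ξ in {ξ : Fin 6 → Plane | ∃ j, N / 3 < ‖ξ j‖}, (∏ j, H l j (ξ j)) *
          ENNReal.ofReal ((∏ j, weight N σ ‖ξ j‖) * kern (signedForm altSign ξ + Bl))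
          ∂hyperMeasure 5 := by
          rw [← lintegral_indicator hS, lintegral_const_mul]
          refine Measurable.indicator ?_ hS
          have h1 : Measurable fun ξ : Fin 6 → Plane => ∏ j, H l j (ξ j) :=
            Finset.measurable_fun_prod _ fun j _ => (hHm l j).comp (measurable_pi_apply j)
          have h2 : Measurable fun ξ : Fin 6 → Plane => ∏ j, weight N σ ‖ξ j‖ :=
            Finset.measurable_fun_prod _ fun j _ =>
              (measurable_weight N σ).comp (measurable_pi_apply j).norm
          fun_prop
      _ ≤ _ := by
          rw [mul_assoc (B * 4096)]
          exact mul_le_mul_right (lintegral_weighted_le hN hσ hδ hδ1 hσδ Bl (hHm l)) _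
  simp only [hshift]
  rw [lintegral_lintegral_swap hmeas.aemeasurable]
  have hjm : ∀ j, Measurable fun l : ℝ =>
      (∫⁻ x : Plane, (ENNReal.ofReal (a x) * ‖V j (l - ‖x‖ ^ 2, x)‖ₑ) ^ 2) ^ (1 / 2 : ℝ) := by
    intro j
    have := hV j
    have hm : Measurable fun q : ℝ × Plane =>
      (ENNReal.ofReal (a q.2) * ‖V j (q.1 - ‖q.2‖ ^ 2, q.2)‖ₑ) ^ 2 := by fun_prop
    exact (hm.lintegral_prod_right').pow_const _
  refine (lintegral_mono hfix).trans ?_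
  have hpm : Measurable fun l : Fin 6 → ℝ => ∏ j, (∫⁻ x, H l j x ^ 2) ^ (1 / 2 : ℝ) :=
    Finset.measurable_fun_prod _ fun j _ => (hjm j).comp (measurable_pi_apply j)
  rw [lintegral_const_mul _ hpm]
  refine mul_le_mul_right ?_ _
  rw [lintegral_fin_prod hjm]
  exact Finset.prod_le_prod' fun j _ => lintegral_time_sq_le (hV j) ha ham

end

end IMethod

namespace IMethod

noncomputable section

/-! ### The Fourier transform of a solution and of its time slices -/

theorem lintegral_comp_smul_of_ne_zero {E : Type*} [NormedAddCommGroup E] [NormedSpace ℝ E]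
    [FiniteDimensional ℝ E] [MeasureSpace E] [BorelSpace E]
    [(volume : Measure E).IsAddHaarMeasure] {r : ℝ} (hr : r ≠ 0) {f : E → ℝ≥0∞}
    (hf : Measurable f) :
    ∫⁻ x, f (r • x) = ENNReal.ofReal |(r ^ Module.finrank ℝ E)⁻¹| * ∫⁻ x, f x := by
  rw [← lintegral_map hf (measurable_const_smul r), Measure.map_addHaar_smul _ hr,
    lintegral_smul_measure, smul_eq_mul]

theorem quasiMeasurePreserving_smul {E : Type*} [NormedAddCommGroup E] [NormedSpace ℝ E]
    [FiniteDimensional ℝ E] [MeasureSpace E] [BorelSpace E]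
    [(volume : Measure E).IsAddHaarMeasure] {r : ℝ} (hr : r ≠ 0) :
    Measure.QuasiMeasurePreserving (fun ξ : E => r • ξ) volume volume := by
  refine ⟨measurable_const_smul r, ?_⟩
  rw [Measure.map_addHaar_smul _ hr]
  exact Measure.smul_absolutelyContinuous

/-- The space-time transform as a function of the pair `(τ, ξ)`. -/
def pairHat (u : L2SpaceTime) (q : ℝ × Plane) : ℂ := spaceTimeHat u (WithLp.toLp 2 q)

theorem measurable_spaceTimeHat (u : L2SpaceTime) : Measurable (spaceTimeHat u) :=
  (Lp.stronglyMeasurable (𝓕 u : L2SpaceTime)).measurable.comp (measurable_const_smul _)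

theorem measurable_pairHat (u : L2SpaceTime) : Measurable (pairHat u) :=
  (measurable_spaceTimeHat u).comp (by fun_prop)

theorem pairHat_eq (u : L2SpaceTime) (τ : ℝ) (ξ : Plane) :
    pairHat u (τ, ξ) = (𝓕 u : L2SpaceTime)
      (WithLp.toLp 2 ((2 * Real.pi)⁻¹ * τ, (2 * Real.pi)⁻¹ • ξ)) := rfl

theorem spaceTimeHat_opI_ae {s : ℝ} (φ : Profile s) (N : ℝ) (u : L2SpaceTime) :
    spaceTimeHat (opI φ N u) =ᵐ[volume] fun p => symb φ N p.snd * spaceTimeHat u p := by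
  have hpi : (2 * Real.pi)⁻¹ ≠ 0 := by positivity
  have h := (quasiMeasurePreserving_smul (E := SpaceTime) hpi).ae
    (memLp_symb_mul φ N (𝓕 u)).coeFn_toLp
  filter_upwards [h] with p hp
  rw [spaceTimeHat, opI, FourierTransform.fourier_fourierInv_eq, hp, spaceTimeHat]
  congr 3
  rw [WithLp.smul_snd, smul_smul, mul_inv_cancel₀ (by positivity), one_smul]

/-- The squared norm of `Iu` in `X^{1,b}` is the weighted energy of the transform of `u`. -/
theorem xsbENorm_opI_sq {s : ℝ} (φ : Profile s) (N b : ℝ) (u : L2SpaceTime) :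
    xsbENorm 1 b (opI φ N u) ^ 2 = energy b (spatialWeight φ N) (pairHat u) := by
  have hj := continuous_japanese.measurable
  have hsw := measurable_spatialWeight φ N
  have hU := measurable_spaceTimeHat u
  have hP := measurable_pairHat u
  have hae : (fun p : SpaceTime => ((japanese ‖p.snd‖ ^ (1 : ℝ) *
      japanese (p.fst + ‖p.snd‖ ^ 2) ^ b : ℝ) : ℂ) * spaceTimeHat (opI φ N u) p) =ᵐ[volume]
      fun p : SpaceTime => ((spatialWeight φ N p.snd *
        japanese (p.fst + ‖p.snd‖ ^ 2) ^ b : ℝ) : ℂ) * spaceTimeHat u p := by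
    filter_upwards [spaceTimeHat_opI_ae φ N u] with p hp
    rw [hp, spatialWeight, Real.rpow_one]
    push_cast
    ring
  have hm : Measurable fun p : SpaceTime => ‖((spatialWeight φ N p.snd *
      japanese (p.fst + ‖p.snd‖ ^ 2) ^ b : ℝ) : ℂ) * spaceTimeHat u p‖ₑ ^ 2 := by fun_prop
  rw [xsbENorm, eLpNorm_congr_ae hae, eLpNorm_eq_lintegral_rpow_enorm_toReal (by norm_num)
    (by norm_num)]
  simp only [ENNReal.toReal_ofNat, ENNReal.rpow_ofNat]
  rw [rpow_half_sq, ← (WithLp.volume_preserving_toLp ℝ Plane).lintegral_comp hm,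
    Measure.volume_eq_prod, energy]
  refine (lintegral_prod_symm' _ (hm.comp (WithLp.measurable_toLp 2 (ℝ × Plane)))).trans ?_
  refine lintegral_congr fun ξ => lintegral_congr fun τ => ?_
  simp only [Function.comp_apply]
  rw [enorm_mul, ← ofReal_norm, Complex.norm_real, Real.norm_of_nonneg]
  · rfl
  · exact mul_nonneg (spatialWeight_nonneg _ _ _) (Real.rpow_nonneg (japanese_pos _).le _)

theorem lintegral_sq_fourier_lt_top {u : L2SpaceTime}
    (h : ∫⁻ ξ : Plane, (∫⁻ τ : ℝ, ‖pairHat u (τ, ξ)‖ₑ) ^ 2 < ⊤) :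
    ∫⁻ ξ : Plane, (∫⁻ τ : ℝ, ‖(𝓕 u : L2SpaceTime) (WithLp.toLp 2 (τ, ξ))‖ₑ) ^ 2 < ⊤ := by
  have hpi : (2 * Real.pi)⁻¹ ≠ 0 := by positivity
  set V : ℝ × Plane → ℂ := fun q => (𝓕 u : L2SpaceTime) (WithLp.toLp 2 q) with hVdef
  have hV : StronglyMeasurable V :=
    (Lp.stronglyMeasurable (𝓕 u : L2SpaceTime)).comp_measurable (by fun_prop)
  have hVm := hV.measurable
  have e1 : ∀ ξ : Plane, ∫⁻ τ : ℝ, ‖pairHat u (τ, ξ)‖ₑ =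
      ENNReal.ofReal |((2 * Real.pi)⁻¹ ^ Module.finrank ℝ ℝ)⁻¹| *
        ∫⁻ τ : ℝ, ‖V (τ, (2 * Real.pi)⁻¹ • ξ)‖ₑ := fun ξ =>
    lintegral_comp_smul_of_ne_zero (E := ℝ) hpi (f := fun τ => ‖V (τ, (2 * Real.pi)⁻¹ • ξ)‖ₑ)
      (by fun_prop)
  have hmt := measurable_lintegral_time hV
  have e2 := lintegral_comp_smul_of_ne_zero (E := Plane) hpi
    (f := fun ξ => (∫⁻ τ : ℝ, ‖V (τ, ξ)‖ₑ) ^ 2) (hmt.pow_const 2)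
  simp only [e1, mul_pow] at h
  rw [lintegral_const_mul' _ _ (by finiteness), e2] at h
  have c1 : ENNReal.ofReal |((2 * Real.pi)⁻¹ ^ Module.finrank ℝ ℝ)⁻¹| ≠ 0 := by
    rw [Ne, ENNReal.ofReal_eq_zero, not_le]; positivity
  have c2 : ENNReal.ofReal |((2 * Real.pi)⁻¹ ^ Module.finrank ℝ Plane)⁻¹| ≠ 0 := by
    rw [Ne, ENNReal.ofReal_eq_zero, not_le]; positivity
  exact ENNReal.lt_top_of_mul_ne_top_right
    (ENNReal.lt_top_of_mul_ne_top_right h.ne (pow_ne_zero 2 c1)).ne c2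

theorem timeSynthesis_smul_eq (u : L2SpaceTime) (t : ℝ) (ξ : Plane) :
    timeSynthesis (fun q => (𝓕 u : L2SpaceTime) (WithLp.toLp 2 q)) t ((2 * Real.pi)⁻¹ • ξ) =
      ((2 * Real.pi)⁻¹ : ℝ) * timeWave 1 (pairHat u) t ξ := by
  have h := Measure.integral_comp_mul_left (fun τ : ℝ => Real.fourierChar (t * τ) •
    (𝓕 u : L2SpaceTime) (WithLp.toLp 2 (τ, (2 * Real.pi)⁻¹ • ξ))) (2 * Real.pi)⁻¹
  have e : timeWave 1 (pairHat u) t ξ = ∫ τ : ℝ, Real.fourierChar (t * ((2 * Real.pi)⁻¹ * τ)) •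
      (𝓕 u : L2SpaceTime) (WithLp.toLp 2 ((2 * Real.pi)⁻¹ * τ, (2 * Real.pi)⁻¹ • ξ)) := by
    rw [timeWave]
    refine integral_congr_ae (Filter.Eventually.of_forall fun τ => ?_)
    simp only
    rw [Circle.smul_def, smul_eq_mul, Real.fourierChar_apply, pairHat_eq]
    congr 2
    rw [show 2 * Real.pi * (t * ((2 * Real.pi)⁻¹ * τ)) = t * (1 * τ) by
      field_simp]
    ring
  rw [e, h, inv_inv, abs_of_pos (by positivity), Complex.real_smul, ← mul_assoc,
    ← Complex.ofReal_mul, inv_mul_cancel₀ (by positivity), Complex.ofReal_one, one_mul,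
    timeSynthesis]

theorem ae_spatialHat_slice_eq {u : L2SpaceTime}
    (h : ∫⁻ ξ : Plane, (∫⁻ τ : ℝ, ‖pairHat u (τ, ξ)‖ₑ) ^ 2 < ⊤) :
    ∀ᵐ t : ℝ, spatialHat (slice u t) =ᵐ[volume]
      fun ξ => ((2 * Real.pi)⁻¹ : ℝ) * timeWave 1 (pairHat u) t ξ := by
  filter_upwards [ae_fourier_slice_eq u (lintegral_sq_fourier_lt_top h)] with t ht
  filter_upwards [(quasiMeasurePreserving_smul (E := Plane)
    (r := (2 * Real.pi)⁻¹) (by positivity)).ae ht] with ξ hξ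
  rw [spatialHat, hξ, timeSynthesis_smul_eq]

/-- The space-time transforms of the six factors `u, ū, u, ū, u, ū`. -/
def factorHat (u : L2SpaceTime) (j : Fin 6) : ℝ × Plane → ℂ :=
  if (j : ℕ) % 2 = 0 then pairHat u else fun q => conj (pairHat u (q.1, -q.2))

theorem measurable_factorHat (u : L2SpaceTime) (j : Fin 6) : Measurable (factorHat u j) := by
  have h := measurable_pairHat u
  unfold factorHat
  split_ifs
  · exact h
  · exact Complex.continuous_conj.measurable.comp (h.comp (by fun_prop))

theorem energy_factorHat {b : ℝ} {a : Plane → ℝ} (ha : ∀ ξ, a (-ξ) = a ξ) (u : L2SpaceTime)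
    (j : Fin 6) : energy b a (factorHat u j) = energy b a (pairHat u) := by
  unfold factorHat
  split_ifs
  · rfl
  · exact energy_reflect ha

theorem conj_timeWave (V : ℝ × Plane → ℂ) (t : ℝ) (ξ : Plane) :
    conj (timeWave 1 V t (-ξ)) = timeWave (-1) (fun q => conj (V (q.1, -q.2))) t ξ := by
  rw [timeWave, timeWave, ← integral_conj]
  refine integral_congr_ae (Filter.Eventually.of_forall fun τ => ?_)
  simp only [map_mul, ← Complex.exp_conj, Complex.conj_I, Complex.conj_ofReal]
  congr 2
  push_cast
  ring

theorem ae_spatialHat_alternating_eq {u : L2SpaceTime}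
    (h : ∫⁻ ξ : Plane, (∫⁻ τ : ℝ, ‖pairHat u (τ, ξ)‖ₑ) ^ 2 < ⊤) :
    ∀ᵐ t : ℝ, ∀ j : Fin 6, spatialHat (alternating 6 (slice u t) j) =ᵐ[volume]
      fun ξ => ((2 * Real.pi)⁻¹ : ℝ) * timeWave (altSign j) (factorHat u j) t ξ := by
  filter_upwards [ae_spatialHat_slice_eq h] with t ht j
  by_cases hj : (j : ℕ) % 2 = 0
  · simpa only [alternating, altSign, factorHat, if_pos hj] using ht
  · simp only [alternating, altSign, factorHat, if_neg hj]
    filter_upwards [spatialHat_star_ae (slice u t),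
      (Measure.measurePreserving_neg (volume : Measure Plane)).quasiMeasurePreserving.ae ht] with ξ h1 h2
    rw [h1, h2, map_mul, Complex.conj_ofReal, conj_timeWave]

theorem ae_multIntegrand_eq {u : L2SpaceTime}
    (h : ∫⁻ ξ : Plane, (∫⁻ τ : ℝ, ‖pairHat u (τ, ξ)‖ₑ) ^ 2 < ⊤) (M : Symbol 6) :
    ∀ᵐ t : ℝ, multIntegrand M (alternating 6 (slice u t)) =ᵐ[hyperMeasure 5] fun ξ =>
      (((2 * Real.pi)⁻¹ ^ 6 : ℝ) : ℂ) *
        (M ξ * ∏ j, timeWave (altSign j) (factorHat u j) t (ξ j)) := by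
  filter_upwards [ae_spatialHat_alternating_eq h] with t ht
  have h' : ∀ᵐ ξ ∂hyperMeasure 5, ∀ j : Fin 6, spatialHat (alternating 6 (slice u t) j) (ξ j) =
      ((2 * Real.pi)⁻¹ : ℝ) * timeWave (altSign j) (factorHat u j) t (ξ j) :=
    ae_all_iff.2 fun j => (quasiMeasurePreserving_eval (n := 4) j).ae (ht j)
  filter_upwards [h'] with ξ hξ
  simp only [multIntegrand, hξ, Finset.prod_mul_distrib, Finset.prod_const, Finset.card_univ,
    Fintype.card_fin]
  push_cast
  ring

end

end IMethod

namespace IMethod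

noncomputable section

/-! ### The sextilinear estimate -/

/-- The decay factor is discarded: the quantitative estimate needs only the size of the symbol. -/
theorem exists_sextilinearSymbol_bound {s : ℝ} (hs : 1 / 2 < s) (hs' : s < 1) (φ : Profile s) :
    ∃ C : ℝ, 0 < C ∧ ∀ N : ℝ, 0 < N → ∀ θ₀ : ℝ, 0 < θ₀ → θ₀ < 1 → ∀ ξ ∈ hyper 6,
      ‖sextilinearSymbol φ N θ₀ ξ‖ ≤ C * θ₀⁻¹ := by
  obtain ⟨C, hC, h⟩ := exists_sigmaFourTilde_bound hs hs' φ
  refine ⟨4 * C, by positivity, fun N hN θ₀ hθ hθ1 ξ hξ => ?_⟩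
  rw [mul_assoc]
  refine norm_sextilinearSymbol_le_of_forall φ fun e => ?_
  refine (h N hN θ₀ hθ hθ1 _ (contract_mem (comp_perm_mem_hyper hξ e)) 0).trans ?_
  refine mul_le_of_le_one_right (by positivity) (Real.rpow_le_one_of_one_le_of_nonpos ?_ ?_)
  · have : 0 ≤ ‖contract (ξ ∘ e) 0‖ / N := by positivity
    linarith
  · linarith

theorem lintegral_sq_time_lt_top {s : ℝ} (hs : 0 < s) (hs' : s < 1) (φ : Profile s) {N b : ℝ}
    (hN : 1 ≤ N) (hb : 1 / 2 < b) {V : ℝ × Plane → ℂ} (hV : Measurable V)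
    (hE : energy b (spatialWeight φ N) V < ⊤) :
    ∫⁻ ξ : Plane, (∫⁻ τ : ℝ, ‖V (τ, ξ)‖ₑ) ^ 2 < ⊤ := by
  refine lt_of_le_of_lt ?_ (ENNReal.mul_lt_top (by norm_num : (16 : ℝ≥0∞) < ⊤)
    ((lintegral_sq_time_le hb hV (spatialWeight_nonneg φ N)).trans_lt
      (ENNReal.mul_lt_top (modulationConst_lt_top hb) hE)))
  rw [← lintegral_const_mul' _ _ (by norm_num)]
  refine lintegral_mono fun ξ => ?_
  have h1 : (1 : ℝ) ≤ 4 * spatialWeight φ N ξ := by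
    refine (one_le_weight_mul_spatialWeight hs hs' φ hN ξ).trans ?_
    have h2 : weight N (1 - s) ‖ξ‖ ≤ 1 := (weight_le_rpow hN hs' (norm_nonneg ξ)).trans
      (Real.rpow_le_one_of_one_le_of_nonpos (by linarith [norm_nonneg ξ]) (by linarith))
    exact mul_le_mul_of_nonneg_right (by linarith) (spatialWeight_nonneg φ N ξ)
  have h2 := ENNReal.ofReal_le_ofReal h1
  rw [ENNReal.ofReal_one, ENNReal.ofReal_mul (by norm_num), ENNReal.ofReal_ofNat] at h2
  calc _ = (1 * ∫⁻ τ : ℝ, ‖V (τ, ξ)‖ₑ) ^ 2 := by rw [one_mul]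
    _ ≤ (4 * ENNReal.ofReal (spatialWeight φ N ξ) * ∫⁻ τ : ℝ, ‖V (τ, ξ)‖ₑ) ^ 2 := by gcongr
    _ = _ := by ring

theorem lintegral_symbol_mul_prod_lt_top {s : ℝ} (hs : 1 / 2 < s) (hs' : s < 1)
    (φ : Profile s) {N θ₀ b : ℝ} (hN : 1 ≤ N) (hθ : 0 < θ₀) (hθ1 : θ₀ < 1) (hb : 1 / 2 < b)
    {V : Fin 6 → ℝ × Plane → ℂ} (hV : ∀ j, Measurable (V j))
    (hE : ∀ j, energy b (spatialWeight φ N) (V j) < ⊤) :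
    ∫⁻ ξ, ‖sextilinearSymbol φ N θ₀ ξ‖ₑ * ∏ j, (∫⁻ τ : ℝ, ‖V j (τ, ξ j)‖ₑ) ∂hyperMeasure 5 < ⊤ := by
  have hsw := measurable_spatialWeight φ N
  have hm : ∀ j, Measurable fun ξ : Plane => ∫⁻ τ : ℝ, ‖V j (τ, ξ)‖ₑ := fun j =>
    Measurable.lintegral_prod_left' (f := fun q : ℝ × Plane => ‖V j q‖ₑ) (hV j).enorm
  have h := lintegral_sextilinearSymbol_lt_top hs hs' φ hN hθ hθ1
    (H := fun j ξ => ENNReal.ofReal (spatialWeight φ N ξ) * ∫⁻ τ : ℝ, ‖V j (τ, ξ)‖ₑ)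
    (fun j => by have := hm j; fun_prop) fun j =>
      (lintegral_sq_time_le hb (hV j) (spatialWeight_nonneg φ N)).trans_lt
        (ENNReal.mul_lt_top (modulationConst_lt_top hb) (hE j))
  refine lt_of_le_of_lt ?_ (ENNReal.mul_lt_top (by norm_num : (4096 : ℝ≥0∞) < ⊤) h)
  rw [← lintegral_const_mul' _ _ (by norm_num)]
  refine lintegral_mono fun ξ => ?_
  rw [mul_left_comm]
  exact mul_le_mul_right (prod_le_prod_weight hN
    (one_le_weight_mul_spatialWeight (by linarith) hs' φ hN) ξ _) _

end

end IMethod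

/-! ### Conclusion: choice of exponents and assembly -/

theorem mainTheorem5 (s : ℝ) (hs : 1 / 2 < s) (hs' : s < 1) (φ : IMethod.Profile s)
    (b : ℝ) (hb : 1 / 2 < b) (ε : ℝ) (hε : 0 < ε) :
    ∃ C : ℝ, 0 < C ∧
      ∀ (N : ℝ), 1 ≤ N →
      ∀ (θ₀ : ℝ), 0 < θ₀ → θ₀ < 1 / 100 →
      ∀ (u : IMethod.L2SpaceTime), IMethod.MemXsb 1 b (IMethod.opI φ N u) →
      ∀ (t₀ : ℝ), 0 < t₀ → t₀ < 1 →
        (∀ᵐ t ∂(volume.restrict (Set.Icc 0 t₀)),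
          Integrable
            (IMethod.multIntegrand (IMethod.sextilinearSymbol φ N θ₀)
              (IMethod.alternating 6 (IMethod.slice u t)))
            (IMethod.hyperMeasure 5)) ∧
        IntervalIntegrable
          (fun t => IMethod.form (n := 5) (IMethod.sextilinearSymbol φ N θ₀) (IMethod.slice u t))
          volume 0 t₀ ∧
        |∫ t in (0 : ℝ)..t₀,
            IMethod.form (n := 5) (IMethod.sextilinearSymbol φ N θ₀) (IMethod.slice u t)| ≤
          C * θ₀⁻¹ * N ^ (-3 + ε) * IMethod.xsbNorm 1 b (IMethod.opI φ N u) ^ 6 := by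
  obtain ⟨C₀, hC₀, hbound⟩ := IMethod.exists_sextilinearSymbol_bound hs hs' φ
  -- The gain is `N^{-3+3δ}`, whence `3δ ≤ ε`; the third condition leaves room in the power counting
  -- and is possible because `s > 1/2`.
  obtain ⟨δ, hδ, hδ1, hδ2, hδ3⟩ : ∃ δ : ℝ, 0 < δ ∧ δ ≤ 1 / 4 ∧ 2 * (1 - s) + 2 * δ ≤ 1 ∧
      3 * δ ≤ ε :=
    ⟨min (ε / 3) (min ((2 * s - 1) / 2) (1 / 4)),
      lt_min (by linarith) (lt_min (by linarith) (by norm_num)),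
      (min_le_right _ _).trans (min_le_right _ _),
      by linarith [(min_le_right (ε / 3) _).trans (min_le_left ((2 * s - 1) / 2) (1 / 4))],
      by linarith [min_le_left (ε / 3) (min ((2 * s - 1) / 2) (1 / 4))]⟩
  set κ := (IMethod.kernelConst δ).toReal with hκ
  set c := (IMethod.modulationConst b).toReal with hc
  -- The summand `1` makes the constant positive without showing that `κ` and `c` are.
  refine ⟨3 * (C₀ * 4096 * (720 * κ * 3538944000) * c ^ 3) + 1, by positivity, ?_⟩
  intro N hN θ₀ hθ hθ1 u hu t₀ ht₀ ht₁
  have hN0 : 0 < N := by linarith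
  have hθ1' : θ₀ < 1 := by linarith
  have hE : IMethod.energy b (IMethod.spatialWeight φ N) (IMethod.pairHat u) < ⊤ := by
    rw [← IMethod.xsbENorm_opI_sq]
    exact ENNReal.pow_lt_top hu
  have hEj : ∀ j, IMethod.energy b (IMethod.spatialWeight φ N) (IMethod.factorHat u j) =
      IMethod.xsbENorm 1 b (IMethod.opI φ N u) ^ 2 := fun j => by
    rw [IMethod.energy_factorHat (IMethod.spatialWeight_neg φ N), IMethod.xsbENorm_opI_sq]
  have hM := IMethod.measurable_sextilinearSymbol φ N θ₀
  have hV := IMethod.measurable_factorHat u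
  have hfin := IMethod.lintegral_symbol_mul_prod_lt_top hs hs' φ hN hθ hθ1' hb hV
    fun j => by rw [hEj]; exact ENNReal.pow_lt_top hu
  have hG : ∫⁻ ξ : IMethod.Plane, (∫⁻ τ : ℝ, ‖IMethod.pairHat u (τ, ξ)‖ₑ) ^ 2 < ⊤ :=
    IMethod.lintegral_sq_time_lt_top (by linarith) hs' φ hN hb (IMethod.measurable_pairHat u) hE
  have hae := IMethod.ae_multIntegrand_eq hG (IMethod.sextilinearSymbol φ N θ₀)
  set I : ℝ → ℂ := fun t => ∫ ξ, IMethod.sextilinearSymbol φ N θ₀ ξ *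
    ∏ j, IMethod.timeWave (IMethod.altSign j) (IMethod.factorHat u j) t (ξ j)
      ∂IMethod.hyperMeasure 5 with hI
  have hint : IntervalIntegrable I volume 0 t₀ :=
    IMethod.intervalIntegrable_integral_timeWave hM hV hfin ht₀.le IMethod.altSign
  -- The normalization of `Λ₆` times one factor `(2π)⁻¹` from each inverse transform in time; only
  -- `0 ≤ k ≤ 1` matters.
  set k : ℝ := 1 / (2 * Real.pi) ^ (2 * 5) * (2 * Real.pi)⁻¹ ^ 6 with hk
  have hform : ∀ᵐ t, IMethod.form (n := 5) (IMethod.sextilinearSymbol φ N θ₀)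
      (IMethod.slice u t) = k * (I t).re := by
    filter_upwards [hae] with t ht
    rw [IMethod.form, IMethod.multForm, integral_congr_ae ht, integral_const_mul,
      Complex.re_ofReal_mul, hk, hI, mul_assoc]
  refine ⟨?_, ?_, ?_⟩
  · refine ae_restrict_of_ae ?_
    filter_upwards [hae] with t ht
    exact ((IMethod.integrable_mul_prod_timeWave hM hV hfin IMethod.altSign t).const_mul _).congr
      ht.symm
  · have hre : IntervalIntegrable (fun t => (I t).re) volume 0 t₀ := ⟨hint.1.re, hint.2.re⟩
    refine (hre.const_mul k).congr_ae (ae_restrict_of_ae ?_)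
    filter_upwards [hform] with t ht
    exact ht.symm
  have hkey := IMethod.enorm_integral_timeWave_le hM hV hfin ht₀.le ht₁.le IMethod.altSign
  have hmod := IMethod.lintegral_modulation_le (b := b) hN (by linarith : 0 ≤ 1 - s) hδ hδ1 hδ2
    (IMethod.spatialWeight_nonneg φ N) (IMethod.measurable_spatialWeight φ N)
    (IMethod.one_le_weight_mul_spatialWeight (by linarith) hs' φ hN) hM
    (B := ENNReal.ofReal (C₀ * θ₀⁻¹))
    (by
      filter_upwards [IMethod.ae_mem_hyper 5] with ξ hξ
      rw [← ofReal_norm]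
      exact ENNReal.ofReal_le_ofReal (hbound N hN0 θ₀ hθ hθ1' ξ hξ))
    (IMethod.ae_sextilinearSymbol_eq_zero φ θ₀ hN0) hV
  have hnorm : ‖∫ t in (0 : ℝ)..t₀, I t‖ ≤
      3 * (C₀ * θ₀⁻¹ * 4096 * (720 * κ * IMethod.gain N δ) *
        (c ^ 3 * IMethod.xsbNorm 1 b (IMethod.opI φ N u) ^ 6)) := by
    have h3 := hkey.trans (mul_le_mul_right hmod 3)
    simp only [hEj, IMethod.sq_rpow_half, Finset.prod_const, Finset.card_univ, Fintype.card_fin,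
      mul_pow] at h3
    have h4 : (IMethod.modulationConst b ^ (1 / 2 : ℝ)) ^ 6 = IMethod.modulationConst b ^ 3 := by
      rw [show 6 = 2 * 3 by norm_num, pow_mul, IMethod.rpow_half_sq]
    rw [h4] at h3
    have hκt := IMethod.kernelConst_lt_top hδ
    have hct := IMethod.modulationConst_lt_top hb
    have hxt : IMethod.xsbENorm 1 b (IMethod.opI φ N u) < ⊤ := hu
    have h5 := ENNReal.toReal_mono (ENNReal.mul_ne_top ENNReal.ofNat_ne_top
      (ENNReal.mul_ne_top (ENNReal.mul_ne_top
        (ENNReal.mul_ne_top ENNReal.ofReal_ne_top ENNReal.ofNat_ne_top)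
        (ENNReal.mul_ne_top (ENNReal.mul_ne_top ENNReal.ofNat_ne_top hκt.ne)
          ENNReal.ofReal_ne_top))
        (ENNReal.mul_ne_top (ENNReal.pow_ne_top hct.ne) (ENNReal.pow_ne_top hxt.ne)))) h3
    rw [toReal_enorm] at h5
    simpa [ENNReal.toReal_mul, ENNReal.toReal_pow, ENNReal.toReal_ofReal,
      IMethod.gain_nonneg hN, hC₀.le, hθ.le, IMethod.xsbNorm, ← hκ, ← hc] using h5
  have hk1 : 0 ≤ k ∧ k ≤ 1 := by
    have hpi : 1 ≤ 2 * Real.pi := by linarith [Real.pi_gt_three]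
    refine ⟨by positivity, mul_le_one₀ ?_ (by positivity) ?_⟩
    · exact (div_le_one (by positivity)).2 (one_le_pow₀ hpi)
    · exact pow_le_one₀ (by positivity) (inv_le_one_of_one_le₀ hpi)
  have heq : ∫ t in (0 : ℝ)..t₀, IMethod.form (n := 5) (IMethod.sextilinearSymbol φ N θ₀)
      (IMethod.slice u t) = k * (∫ t in (0 : ℝ)..t₀, I t).re := by
    rw [intervalIntegral.integral_congr_ae (g := fun t => k * (I t).re)
      (by filter_upwards [hform] with t ht _ using ht), intervalIntegral.integral_const_mul]
    congr 1
    exact Complex.reCLM.intervalIntegral_comp_comm hint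
  have hX : 0 ≤ IMethod.xsbNorm 1 b (IMethod.opI φ N u) := ENNReal.toReal_nonneg
  have hgain : IMethod.gain N δ ≤ 3538944000 * N ^ (-3 + ε) := by
    unfold IMethod.gain
    exact mul_le_mul_of_nonneg_left (Real.rpow_le_rpow_of_exponent_le hN (by linarith))
      (by norm_num)
  have hκ0 : 0 ≤ κ := ENNReal.toReal_nonneg
  have hc0 : 0 ≤ c := ENNReal.toReal_nonneg
  calc _ = k * |(∫ t in (0 : ℝ)..t₀, I t).re| := by rw [heq, abs_mul, abs_of_nonneg hk1.1]
    _ ≤ 1 * ‖∫ t in (0 : ℝ)..t₀, I t‖ :=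
        mul_le_mul hk1.2 (Complex.abs_re_le_norm _) (abs_nonneg _) zero_le_one
    _ ≤ 3 * (C₀ * θ₀⁻¹ * 4096 * (720 * κ * (3538944000 * N ^ (-3 + ε))) *
        (c ^ 3 * IMethod.xsbNorm 1 b (IMethod.opI φ N u) ^ 6)) := by
        rw [one_mul]
        refine hnorm.trans ?_
        gcongr
    _ = 3 * (C₀ * 4096 * (720 * κ * 3538944000) * c ^ 3) * θ₀⁻¹ * N ^ (-3 + ε) *
        IMethod.xsbNorm 1 b (IMethod.opI φ N u) ^ 6 := by ring
    _ ≤ _ := by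
        gcongr
        linarith
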